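/- Let $(\mathcal A,\mathcal E)$ be an exact category in the sense of Quillen. Let $\Pi=\{(i,j)\in\mathbb Z\times\mathbb Z : i\le j\}$ with the order induced from $\mathbb Z\times\mathbb Z$. A functor $X:\Pi\to\mathcal A$ is admissible if for all $i\le j\le k$ the sequence $X_{i,j}\to X_{i,k}\to X_{j,k}$ belongs to $\mathcal E$. The Beilinson category $\underleftrightarrow{\lim}\,\mathcal A$ is the localization of the category of admissible functors at all natural maps $(X_{\varphi(i),\varphi(j)})_{i\le j}\to (X_{\psi(i),\psi(j)})_{i\le j}$, where $X$ is admissible and $\varphi\le\psi$ are nondecreasing maps $\mathbb Z\to\mathbb Z$ tending to $\pm\infty$ at $\pm\infty$. A sequence $X\to Y\to Z$ in $\underleftrightarrow{\lim}\,\mathcal A$ is called admissible if it is isomorphic to the image of a sequence $X'\to Y'\to Z'$ of admissible functors such that $X'_{i,j}\to Y'_{i,j}\to Z'_{i,j}$ is in $\mathcal E$ for all $i\le j$. With these sequences $\underleftrightarrow{\lim}\,\mathcal A$ is an exact category. Let $\mathrm{Ind}^a_{\aleph_0}(\mathcal A)\subset \mathrm{Ind}(\mathcal A)$ be the full subcategory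 of the objects that are formal filtered colimits, over countable directed preorders, of systems whose structure maps are admissible monomorphisms, and let $\mathrm{Pro}^a_{\aleph_0}(\mathcal A):=\mathrm{Ind}^a_{\aleph_0}(\mathcal A^{op})^{op}$ (formal limits of countable systems of admissible epimorphisms). (Ind) For every system $X_0\hookrightarrow X_1\hookrightarrow X_2\hookrightarrow\cdots$ of admissible monomorphisms choose quotients $X_j/X_i$, $0\le i\le j$, and attach to the system the admissible functor $$X_{i,j}=X_j/X_i\ \ (0\le i\le j),\qquad X_{i,j}=X_j\ \ (i<0\le j),\qquad X_{i,j}=0\ \ (i\le j<0),$$ with the obvious structure maps. This extends to a functor $F:\mathrm{Ind}^a_{\aleph_0}(\mathcal A)\to\underleftrightarrow{\lim}\,\mathcal A$, in the sense that there is an $F$ whose composite with the formal colimit functor on such systems (and natural transformations between them) is naturally isomorphic to the functor just described. Every such $F$ is fully faithful, its essential image is closed under extensions in $\underleftrightarrow{\lim}\,\mathcal A$, and $\mathrm{Ind}^a_{\aleph_0}(\mathcal A)$, with the sequences which $F$ sends to admissible sequences, is an exact category. (Pro) Dually, for every system $\cdots\twoheadrightarrow P_2\twoheadrightarrow P_1\twoheadrightarrow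 P_0$ of admissible epimorphisms choose kernels $\ker(P_n\to P_m)$, $n\ge m\ge 0$, and attach to the system the admissible functor $$P_{i,j}=\ker(P_{-i}\to P_{-j})\ \ (i\le j\le 0),\qquad P_{i,j}=P_{-i}\ \ (i\le 0<j),\qquad P_{i,j}=0\ \ (0<i\le j).$$ This extends, in the same sense, to a functor $F:\mathrm{Pro}^a_{\aleph_0}(\mathcal A)\to\underleftrightarrow{\lim}\,\mathcal A$, and every such $F$ is fully faithful, its essential image is closed under extensions in $\underleftrightarrow{\lim}\,\mathcal A$, and $\mathrm{Pro}^a_{\aleph_0}(\mathcal A)$, with the sequences which $F$ sends to admissible sequences, is an exact category. Thus both categories are (fully) exact subcategories of $\underleftrightarrow{\lim}\,\mathcal A$. -/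

import Mathlib

open CategoryTheory CategoryTheory.Limits Opposite
open scoped ZeroObject

universe v u

noncomputable section

namespace TateExact

/-! ### Exact categories -/

section Exact

variable {C : Type u} [Category.{v} C]

/-- A class of sequences `X ⟶ Y ⟶ Z` in a category. -/
abbrev SeqClass (C : Type u) [Category.{v} C] : Type (max u v) :=
  ∀ ⦃X Y Z : C⦄, (X ⟶ Y) → (Y ⟶ Z) → Prop

/-- Admissible monomorphisms: the first maps of the sequences of the class. -/
def IsAdmMono (E : SeqClass C) {X Y : C} (f : X ⟶ Y) : Prop :=
  ∃ (Z : C) (g : Y ⟶ Z), E f g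

/-- Admissible epimorphisms: the second maps of the sequences of the class. -/
def IsAdmEpi (E : SeqClass C) {Y Z : C} (g : Y ⟶ Z) : Prop :=
  ∃ (X : C) (f : X ⟶ Y), E f g

/-- Quillen's axioms, for a class of sequences in an additive category. -/
structure IsExactStructure [Preadditive C] (E : SeqClass C) : Prop where
  comp_zero : ∀ ⦃X Y Z : C⦄ (f : X ⟶ Y) (g : Y ⟶ Z), E f g → f ≫ g = 0
  isKernel : ∀ ⦃X Y Z : C⦄ (f : X ⟶ Y) (g : Y ⟶ Z) (_ : E f g) (w : f ≫ g = 0),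
    Nonempty (IsLimit (KernelFork.ofι f w))
  isCokernel : ∀ ⦃X Y Z : C⦄ (f : X ⟶ Y) (g : Y ⟶ Z) (_ : E f g) (w : f ≫ g = 0),
    Nonempty (IsColimit (CokernelCofork.ofπ g w))
  of_iso : ∀ ⦃X Y Z X' Y' Z' : C⦄ (f : X ⟶ Y) (g : Y ⟶ Z) (f' : X' ⟶ Y') (g' : Y' ⟶ Z')
    (a : X ≅ X') (b : Y ≅ Y') (c : Z ≅ Z'),
    f ≫ b.hom = a.hom ≫ f' → g ≫ c.hom = b.hom ≫ g' → E f g → E f' g'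
  split : ∀ ⦃X Z : C⦄ (b : BinaryBicone X Z), b.IsBilimit → E b.inl b.snd
  admMono_comp : ∀ ⦃X Y Z : C⦄ (f : X ⟶ Y) (g : Y ⟶ Z),
    IsAdmMono E f → IsAdmMono E g → IsAdmMono E (f ≫ g)
  admEpi_comp : ∀ ⦃X Y Z : C⦄ (f : X ⟶ Y) (g : Y ⟶ Z),
    IsAdmEpi E f → IsAdmEpi E g → IsAdmEpi E (f ≫ g)
  pullback : ∀ ⦃Y Z W : C⦄ (g : Y ⟶ Z) (h : W ⟶ Z), IsAdmEpi E g →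
    ∃ (P : C) (h' : P ⟶ Y) (g' : P ⟶ W), IsPullback h' g' g h ∧ IsAdmEpi E g'
  pushout : ∀ ⦃X Y W : C⦄ (f : X ⟶ Y) (h : X ⟶ W), IsAdmMono E f →
    ∃ (P : C) (h' : Y ⟶ P) (f' : W ⟶ P), IsPushout f h h' f' ∧ IsAdmMono E f'
  admEpi_of_comp : ∀ ⦃X Y Z : C⦄ (h : X ⟶ Y) (f : Y ⟶ Z), HasKernel f →
    IsAdmEpi E (h ≫ f) → IsAdmEpi E f
  admMono_of_comp : ∀ ⦃X Y Z : C⦄ (f : X ⟶ Y) (h : Y ⟶ Z), HasCokernel f →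
    IsAdmMono E (f ≫ h) → IsAdmMono E f

/-- `(C, E)` is an exact category: `C` is additive and `E` satisfies Quillen's axioms. (The
preadditive structure of an additive category is unique.) -/
def IsExactCategory (E : SeqClass C) : Prop :=
  ∃ _ : Preadditive C, HasFiniteBiproducts C ∧ IsExactStructure E

/-- The sequences of a class, read in the opposite category. -/
def SeqClass.op (E : SeqClass C) : SeqClass Cᵒᵖ := fun _ _ _ f g => E g.unop f.unop

lemma IsAdmMono.unop {E : SeqClass C} {X Y : Cᵒᵖ} {f : X ⟶ Y}
    (h : IsAdmMono (SeqClass.op E) f) : IsAdmEpi E f.unop := by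
  obtain ⟨Z, g, h⟩ := h
  exact ⟨Z.unop, g.unop, h⟩

lemma IsAdmEpi.unop {E : SeqClass C} {X Y : Cᵒᵖ} {f : X ⟶ Y}
    (h : IsAdmEpi (SeqClass.op E) f) : IsAdmMono E f.unop := by
  obtain ⟨Z, g, h⟩ := h
  exact ⟨Z.unop, g.unop, h⟩

lemma IsAdmMono.op {E : SeqClass C} {X Y : C} {f : X ⟶ Y}
    (h : IsAdmMono E f) : IsAdmEpi (SeqClass.op E) f.op := by
  obtain ⟨Z, g, h⟩ := h
  exact ⟨Opposite.op Z, g.op, h⟩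

lemma IsAdmEpi.op {E : SeqClass C} {X Y : C} {f : X ⟶ Y}
    (h : IsAdmEpi E f) : IsAdmMono (SeqClass.op E) f.op := by
  obtain ⟨Z, g, h⟩ := h
  exact ⟨Opposite.op Z, g.op, h⟩

/-- The opposite of an exact category is exact. -/
theorem IsExactStructure.op [Preadditive C] {E : SeqClass C} (hE : IsExactStructure E) :
    IsExactStructure (SeqClass.op E) where
  comp_zero X Y Z f g h := by
    have := hE.comp_zero _ _ h
    exact Quiver.Hom.unop_inj (by simpa using this)
  isKernel X Y Z f g h w := by
    obtain ⟨t⟩ := hE.isCokernel _ _ h (hE.comp_zero _ _ h)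
    exact ⟨CokernelCofork.IsColimit.ofπOp f.unop (f := g.unop) (hE.comp_zero _ _ h) t⟩
  isCokernel X Y Z f g h w := by
    obtain ⟨t⟩ := hE.isKernel _ _ h (hE.comp_zero _ _ h)
    exact ⟨KernelFork.IsLimit.ofιOp g.unop (f := f.unop) (hE.comp_zero _ _ h) t⟩
  of_iso X Y Z X' Y' Z' f g f' g' a b c h₁ h₂ h := by
    refine hE.of_iso g.unop f.unop g'.unop f'.unop c.unop.symm b.unop.symm a.unop.symm ?_ ?_ h
    · have := congrArg Quiver.Hom.unop h₂
      simp only [unop_comp] at this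
      simp only [Iso.symm_hom, Iso.unop_inv]
      have e₁ : c.hom.unop ≫ c.inv.unop = 𝟙 _ := by rw [← unop_comp]; simp
      have e₂ : b.inv.unop ≫ b.hom.unop = 𝟙 _ := by rw [← unop_comp]; simp
      have e₃ : b.hom.unop ≫ b.inv.unop = 𝟙 _ := by rw [← unop_comp]; simp
      have e₄ : c.inv.unop ≫ c.hom.unop = 𝟙 _ := by rw [← unop_comp]; simp
      calc g.unop ≫ b.inv.unop = (c.inv.unop ≫ c.hom.unop) ≫ g.unop ≫ b.inv.unop := by simp [e₄]
        _ = c.inv.unop ≫ (c.hom.unop ≫ g.unop) ≫ b.inv.unop := by simp only [Category.assoc]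
        _ = c.inv.unop ≫ g'.unop ≫ (b.hom.unop ≫ b.inv.unop) := by
          rw [this]; simp only [Category.assoc]
        _ = _ := by rw [e₃, Category.comp_id]
    · have := congrArg Quiver.Hom.unop h₁
      simp only [unop_comp] at this
      simp only [Iso.symm_hom, Iso.unop_inv]
      have e₁ : a.hom.unop ≫ a.inv.unop = 𝟙 _ := by rw [← unop_comp]; simp
      have e₂ : b.inv.unop ≫ b.hom.unop = 𝟙 _ := by rw [← unop_comp]; simp
      calc f.unop ≫ a.inv.unop = (b.inv.unop ≫ b.hom.unop) ≫ f.unop ≫ a.inv.unop := by simp [e₂]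
        _ = b.inv.unop ≫ (b.hom.unop ≫ f.unop) ≫ a.inv.unop := by simp only [Category.assoc]
        _ = b.inv.unop ≫ f'.unop ≫ (a.hom.unop ≫ a.inv.unop) := by
          rw [this]; simp only [Category.assoc]
        _ = _ := by rw [e₁, Category.comp_id]
  split X Z b hb := by
    let b' : BinaryBicone Z.unop X.unop :=
      { pt := b.pt.unop
        fst := b.inr.unop
        snd := b.inl.unop
        inl := b.snd.unop
        inr := b.fst.unop
        inl_fst := by rw [← unop_comp]; simp
        inl_snd := by rw [← unop_comp]; simp
        inr_fst := by rw [← unop_comp]; simp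
        inr_snd := by rw [← unop_comp]; simp }
    have hb' : b'.IsBilimit := by
      apply isBinaryBilimitOfTotal
      have := congrArg Quiver.Hom.unop (IsBilimit.binary_total hb)
      simp only [unop_add, unop_comp, unop_id] at this
      rw [add_comm] at this
      exact this
    exact hE.split b' hb'
  admMono_comp X Y Z f g hf hg := by
    simpa using (hE.admEpi_comp _ _ hg.unop hf.unop).op
  admEpi_comp X Y Z f g hf hg := by
    simpa using (hE.admMono_comp _ _ hg.unop hf.unop).op
  pullback Y Z W g h hg := by
    obtain ⟨P, h', g', hp, ha⟩ := hE.pushout g.unop h.unop hg.unop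
    exact ⟨Opposite.op P, h'.op, g'.op, hp.op.flip, ha.op⟩
  pushout X Y W f h hf := by
    obtain ⟨P, h', f', hp, ha⟩ := hE.pullback f.unop h.unop hf.unop
    exact ⟨Opposite.op P, h'.op, f'.op, hp.op.flip, ha.op⟩
  admEpi_of_comp X Y Z h f hk hc := by
    have : HasCokernel f.unop :=
      ⟨⟨_, KernelFork.IsLimit.ofιUnop _ (kernel.condition f) (kernelIsKernel f)⟩⟩
    exact (hE.admMono_of_comp f.unop h.unop this (by simpa using hc.unop)).op
  admMono_of_comp X Y Z f h hk hc := by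
    have : HasKernel f.unop :=
      ⟨⟨_, CokernelCofork.IsColimit.ofπUnop _ (cokernel.condition f) (cokernelIsCokernel f)⟩⟩
    exact (hE.admEpi_of_comp h.unop f.unop this (by simpa using hc.unop)).op

/-- The descent of a map along the second map of an admissible sequence. -/
def IsExactStructure.desc [Preadditive C] {E : SeqClass C} (hE : IsExactStructure E)
    {X Y Z W : C} {f : X ⟶ Y} {g : Y ⟶ Z} (h : E f g) (k : Y ⟶ W) (hk : f ≫ k = 0) : Z ⟶ W :=
  (hE.isCokernel f g h (hE.comp_zero f g h)).some.desc (CokernelCofork.ofπ k hk)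

lemma IsExactStructure.fac [Preadditive C] {E : SeqClass C} (hE : IsExactStructure E)
    {X Y Z W : C} {f : X ⟶ Y} {g : Y ⟶ Z} (h : E f g) (k : Y ⟶ W) (hk : f ≫ k = 0) :
    g ≫ hE.desc h k hk = k :=
  (hE.isCokernel f g h (hE.comp_zero f g h)).some.fac (CokernelCofork.ofπ k hk)
    WalkingParallelPair.one

lemma IsExactStructure.fac_assoc [Preadditive C] {E : SeqClass C} (hE : IsExactStructure E)
    {X Y Z W V : C} {f : X ⟶ Y} {g : Y ⟶ Z} (h : E f g) (k : Y ⟶ W) (hk : f ≫ k = 0)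
    (l : W ⟶ V) : g ≫ hE.desc h k hk ≫ l = k ≫ l := by
  rw [← Category.assoc, hE.fac]

lemma IsExactStructure.epi [Preadditive C] {E : SeqClass C} (hE : IsExactStructure E)
    {X Y Z : C} {f : X ⟶ Y} {g : Y ⟶ Z} (h : E f g) : Epi g :=
  ⟨fun _ _ e => Cofork.IsColimit.hom_ext
    (hE.isCokernel f g h (hE.comp_zero f g h)).some e⟩

/-- The third isomorphism theorem. -/
lemma IsExactStructure.noether [Preadditive C] {E : SeqClass C} (hE : IsExactStructure E)
    {X Y Z P Q R : C} {f : X ⟶ Y} {g : Y ⟶ Z} {fg : X ⟶ Z} {p : Y ⟶ P} {q : Z ⟶ Q} {r : Z ⟶ R}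
    (hfg : f ≫ g = fg) (hp : E f p) (hq : E fg q) (hr : E g r) {s : P ⟶ Q} {t : Q ⟶ R}
    (hs : p ≫ s = g ≫ q) (ht : q ≫ t = r) : E s t := by
  subst hfg
  have ep := hE.epi hp
  have eq := hE.epi hq
  have er := hE.epi hr
  have z₁ := hE.comp_zero _ _ hp
  have z₂ := hE.comp_zero _ _ hr
  have hpo : IsPushout g p q s := by
    have key : ∀ c : PushoutCocone g p, (f ≫ g) ≫ c.inl = 0 := fun c => by
      rw [Category.assoc, c.condition, reassoc_of% z₁, zero_comp]
    refine ⟨⟨hs.symm⟩, ⟨PushoutCocone.IsColimit.mk _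
      (fun c => hE.desc hq c.inl (key c)) (fun c => hE.fac _ _ _) (fun c => ?_)
      (fun c m h₁ _ => ?_)⟩⟩
    · rw [← cancel_epi p, reassoc_of% hs, hE.fac, c.condition]
    · rw [← cancel_epi q, h₁, hE.fac]
  obtain ⟨P', h', f', hpo', D, c, hc⟩ := hE.pushout g p ⟨_, _, hr⟩
  have hsc : E s ((hpo'.isoIsPushout _ _ hpo).inv ≫ c) :=
    hE.of_iso _ _ _ _ (Iso.refl _) (hpo'.isoIsPushout _ _ hpo) (Iso.refl _) (by simp) (by simp) hc
  set d := (hpo'.isoIsPushout _ _ hpo).inv ≫ c with hd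
  have ed := hE.epi hsc
  have z₃ := hE.comp_zero _ _ hsc
  have h0 : s ≫ t = 0 := by
    rw [← cancel_epi p, reassoc_of% hs, ht, z₂, Limits.comp_zero]
  have h1 : g ≫ q ≫ d = 0 := by
    rw [← reassoc_of% hs, z₃, Limits.comp_zero]
  have h2 : t ≫ hE.desc hr (q ≫ d) h1 = d := by
    rw [← cancel_epi q, reassoc_of% ht, hE.fac]
  refine hE.of_iso _ _ _ _ (Iso.refl _) (Iso.refl _)
    ⟨hE.desc hsc t h0, hE.desc hr (q ≫ d) h1, ?_, ?_⟩
    (by simp) (by simp [hE.fac]) hsc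
  · rw [← cancel_epi d, hE.fac_assoc, h2, Category.comp_id]
  · rw [← cancel_epi r, hE.fac_assoc, Category.assoc, hE.fac, ht, Category.comp_id]

/-- If `X` is zero, then `X ⟶ Y ⟶ Y` is admissible. -/
lemma IsExactStructure.of_isZero_left [Preadditive C] {E : SeqClass C}
    (hE : IsExactStructure E) {X Y : C} (hX : IsZero X) (f : X ⟶ Y) : E f (𝟙 Y) := by
  let b : BinaryBicone X Y :=
    { pt := Y, fst := 0, snd := 𝟙 Y, inl := f, inr := 𝟙 Y
      inl_fst := hX.eq_of_src _ _
      inl_snd := hX.eq_of_src _ _ }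
  exact hE.split b (isBinaryBilimitOfTotal b (by simp [b]))

end Exact

/-! ### The Beilinson category -/

/-- The ordered set `Π` of pairs of integers `i ≤ j`, with the order induced from `ℤ × ℤ`. -/
abbrev Pairs : Type := { p : ℤ × ℤ // p.1 ≤ p.2 }

/-- The element `(i, j)` of `Π`. -/
abbrev pr (i j : ℤ) (h : i ≤ j) : Pairs := ⟨(i, j), h⟩

/-- The map `(i, j) ⟶ (i', j')` of `Π`. -/
abbrev prHom {i j i' j' : ℤ} {h : i ≤ j} {h' : i' ≤ j'} (hi : i ≤ i') (hj : j ≤ j') :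
    pr i j h ⟶ pr i' j' h' :=
  homOfLE (Prod.mk_le_mk.2 ⟨hi, hj⟩)

/-- Bicofinal maps `ℤ → ℤ`. -/
structure Bicofinal where
  toFun : ℤ → ℤ
  monotone : Monotone toFun
  tendsto_top : Filter.Tendsto toFun Filter.atTop Filter.atTop
  tendsto_bot : Filter.Tendsto toFun Filter.atBot Filter.atBot

/-- The endofunctor `(i, j) ↦ (φ i, φ j)` of `Π`. -/
def Bicofinal.tilde (φ : Bicofinal) : Pairs ⥤ Pairs where
  obj p := pr (φ.toFun p.1.1) (φ.toFun p.1.2) (φ.monotone p.2)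
  map {_ _} f := prHom (φ.monotone (leOfHom f).1) (φ.monotone (leOfHom f).2)

/-- For `φ ≤ ψ`, the natural map from the endofunctor of `φ` to that of `ψ`. -/
def Bicofinal.tildeMap {φ ψ : Bicofinal} (h : ∀ i, φ.toFun i ≤ ψ.toFun i) : φ.tilde ⟶ ψ.tilde where
  app p := prHom (h p.1.1) (h p.1.2)

section Beilinson

variable {A : Type u} [Category.{v} A]

/-- The admissible functors `X : Π ⥤ A`: for all `i ≤ j ≤ k` the sequence
`X (i, j) ⟶ X (i, k) ⟶ X (j, k)` is admissible. -/
def IsAdmissible (E : SeqClass A) : ObjectProperty (Pairs ⥤ A) := fun X =>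
  ∀ (i j k : ℤ) (hij : i ≤ j) (hjk : j ≤ k),
    E (X.map (prHom le_rfl hjk : pr i j hij ⟶ pr i k (hij.trans hjk)))
      (X.map (prHom hij le_rfl : pr i k (hij.trans hjk) ⟶ pr j k hjk))

/-- The category of admissible functors `Π ⥤ A`. -/
abbrev AdmFun (E : SeqClass A) := (IsAdmissible E).FullSubcategory

/-- The reindexing `X ∘ φ̃` of an admissible functor. -/
def AdmFun.reindex {E : SeqClass A} (X : AdmFun E) (φ : Bicofinal) : AdmFun E :=
  ⟨φ.tilde ⋙ X.obj, fun _ _ _ hij hjk => X.property _ _ _ (φ.monotone hij) (φ.monotone hjk)⟩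

/-- The natural map `X ∘ φ̃ ⟶ X ∘ ψ̃` for `φ ≤ ψ`. -/
def AdmFun.reindexMap {E : SeqClass A} (X : AdmFun E) {φ ψ : Bicofinal}
    (h : ∀ i, φ.toFun i ≤ ψ.toFun i) : X.reindex φ ⟶ X.reindex ψ :=
  ObjectProperty.homMk (Functor.whiskerRight (Bicofinal.tildeMap h) X.obj)

/-- The class of the natural maps `X ∘ φ̃ ⟶ X ∘ ψ̃`, for `φ ≤ ψ` bicofinal. -/
inductive reindexMaps (E : SeqClass A) : MorphismProperty (AdmFun E)
  | mk (X : AdmFun E) {φ ψ : Bicofinal} (h : ∀ i, φ.toFun i ≤ ψ.toFun i) :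
      reindexMaps E (X.reindexMap h)

/-- The Beilinson category `lim A` of `(A, E)`: the localization of the category of admissible
functors at the maps `X ∘ φ̃ ⟶ X ∘ ψ̃`. -/
abbrev Beilinson (E : SeqClass A) := (reindexMaps E).Localization

/-- The localization functor. -/
abbrev toBeilinson (E : SeqClass A) : AdmFun E ⥤ Beilinson E := (reindexMaps E).Q

/-- The admissible short exact sequences of the Beilinson category: those which are isomorphic to
a sequence of admissible functors that is admissible in every component `(i, j)`. -/
def beilinsonSeq (E : SeqClass A) : SeqClass (Beilinson E) := fun X Y Z f g =>
  ∃ (X' Y' Z' : AdmFun E) (f' : X' ⟶ Y') (g' : Y' ⟶ Z')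
    (a : X ≅ (toBeilinson E).obj X') (b : Y ≅ (toBeilinson E).obj Y')
    (c : Z ≅ (toBeilinson E).obj Z'),
    (∀ p : Pairs, E (f'.hom.app p) (g'.hom.app p)) ∧
      f ≫ b.hom = a.hom ≫ (toBeilinson E).map f' ∧ g ≫ c.hom = b.hom ≫ (toBeilinson E).map g'

/-- The essential image of a functor is closed under extensions, with respect to a class of
sequences in its target. -/
def ClosedUnderExtensions {B : Type*} [Category B] {L : Type*} [Category L]
    (E : SeqClass L) (F : B ⥤ L) : Prop :=
  ∀ ⦃X Y Z : L⦄ (f : X ⟶ Y) (g : Y ⟶ Z), E f g →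
    F.essImage X → F.essImage Z → F.essImage Y

/-- The class of sequences of the source of a functor which the functor sends into a given class;
for the embedding of a full subcategory, the induced class. -/
def SeqClass.induced {B : Type*} [Category B] {L : Type*} [Category L]
    (E : SeqClass L) (F : B ⥤ L) : SeqClass B :=
  fun _ _ _ f g => E (F.map f) (F.map g)

end Beilinson

/-! ### Strictly admissible countable ind-objects -/

section Ind

variable {A : Type u} [Category.{v} A]

/-- The strictly admissible countable ind-objects: the objects of `Ind A` which are formal colimits
of systems of admissible monomorphisms, indexed by a countable directed preorder. -/
def IsIndAdm (E : SeqClass A) : ObjectProperty (Ind A) := fun X =>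
  ∃ (I : Type v) (_ : Preorder I) (_ : IsDirectedOrder I) (_ : Nonempty I) (_ : Countable I)
    (D : I ⥤ A), (∀ ⦃i j : I⦄ (f : i ⟶ j), IsAdmMono E (D.map f)) ∧
      Nonempty (X ≅ (Ind.lim I).obj D)

/-- The category `Ind^a_ℵ₀(A)`. -/
abbrev IndAdm (E : SeqClass A) := (IsIndAdm E).FullSubcategory

/-- The category `Pro^a_ℵ₀(A)`, the opposite of `Ind^a_ℵ₀(Aᵒᵖ)`: its objects are the formal limits
of countable systems of admissible epimorphisms of `A`. -/
abbrev ProAdm (E : SeqClass A) := (IndAdm E.op)ᵒᵖ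

/-- The systems `X 0 ⟶ X 1 ⟶ X 2 ⟶ ⋯` of admissible monomorphisms. -/
abbrev IndSys (E : SeqClass A) :=
  ObjectProperty.FullSubcategory (C := ℕ ⥤ A)
    (fun S => ∀ ⦃i j : ℕ⦄ (f : i ⟶ j), IsAdmMono E (S.map f))

/-- The functor `ULift ℕ ⥤ ℕ`. -/
def natDown : ULift.{v} ℕ ⥤ ℕ where
  obj n := n.down
  map {m n} f := homOfLE (show m ≤ n from leOfHom f)

/-- The formal colimit of a system. -/
def indLim (E : SeqClass A) : IndSys E ⥤ IndAdm E :=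
  ObjectProperty.lift _
    (ObjectProperty.ι _ ⋙ (Functor.whiskeringLeft _ _ A).obj natDown ⋙ Ind.lim (ULift.{v} ℕ))
    (fun S => ⟨ULift.{v} ℕ, inferInstance, inferInstance, inferInstance, inferInstance,
      natDown ⋙ S.obj, fun _ _ _ => S.property _, ⟨Iso.refl _⟩⟩)

end Ind

/-! ### The embedding into the Beilinson category -/

section Embedding

variable {A : Type u} [Category.{v} A]

/-- A choice of quotients `T j / T i`, for all `i ≤ j`, for a functor `T` on an ordered set. -/
structure Quotients {K : Type} [Preorder K] (E : SeqClass A) (T : K ⥤ A) where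
  obj : ∀ (i j : K), i ≤ j → A
  proj : ∀ (i j : K) (h : i ≤ j), T.obj j ⟶ obj i j h
  adm : ∀ (i j : K) (h : i ≤ j), E (T.map (homOfLE h)) (proj i j h)

variable [Preadditive A]

section Quot

variable {E : SeqClass A} (hE : IsExactStructure E)

/-- The functor `(i, j) ↦ T j / T i` on `Π`. -/
def quotFunctor {T : ℤ ⥤ A} (q : Quotients E T) : Pairs ⥤ A where
  obj p := q.obj p.1.1 p.1.2 p.2
  map {p p'} f := hE.desc (q.adm p.1.1 p.1.2 p.2)
    (T.map (homOfLE (leOfHom f).2) ≫ q.proj p'.1.1 p'.1.2 p'.2) (by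
      have h := hE.comp_zero _ _ (q.adm p'.1.1 p'.1.2 p'.2)
      have e : T.map (homOfLE p.2) ≫ T.map (homOfLE (leOfHom f).2) =
          T.map (homOfLE (leOfHom f).1) ≫ T.map (homOfLE p'.2) := by
        rw [← T.map_comp, ← T.map_comp]; rfl
      rw [reassoc_of% e, h, comp_zero])
  map_id p := by
    have := hE.epi (q.adm p.1.1 p.1.2 p.2)
    rw [← cancel_epi (q.proj p.1.1 p.1.2 p.2), hE.fac]
    have e : T.map (homOfLE (leOfHom (𝟙 p)).2) = 𝟙 _ := T.map_id _
    rw [e, Category.id_comp, Category.comp_id]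
  map_comp {p p' p''} f g := by
    have := hE.epi (q.adm p.1.1 p.1.2 p.2)
    rw [← cancel_epi (q.proj p.1.1 p.1.2 p.2), hE.fac, hE.fac_assoc, Category.assoc, hE.fac,
      ← Category.assoc, ← T.map_comp]
    rfl

/-- The projection `T j ⟶ T j / T i`. -/
def quotProj {T : ℤ ⥤ A} (q : Quotients E T) (p : Pairs) :
    T.obj p.1.2 ⟶ (quotFunctor hE q).obj p :=
  q.proj p.1.1 p.1.2 p.2

lemma quotProj_epi {T : ℤ ⥤ A} (q : Quotients E T) (p : Pairs) : Epi (quotProj hE q p) :=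
  hE.epi (q.adm p.1.1 p.1.2 p.2)

lemma quotProj_map {T : ℤ ⥤ A} (q : Quotients E T) {p p' : Pairs} (f : p ⟶ p') :
    quotProj hE q p ≫ (quotFunctor hE q).map f =
      T.map (homOfLE (leOfHom f).2) ≫ quotProj hE q p' :=
  hE.fac (q.adm p.1.1 p.1.2 p.2) _ _

lemma quotFunctor_admissible {T : ℤ ⥤ A} (q : Quotients E T) :
    IsAdmissible E (quotFunctor hE q) := by
  intro i j k hij hjk
  have e : T.map (homOfLE (le_refl k)) = 𝟙 _ := T.map_id _
  refine hE.noether (f := T.map (homOfLE hij)) (g := T.map (homOfLE hjk))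
    (fg := T.map (homOfLE (hij.trans hjk))) (p := quotProj hE q (pr i j hij))
    (q := quotProj hE q (pr i k (hij.trans hjk))) (r := quotProj hE q (pr j k hjk))
    ?_ (q.adm i j hij) (q.adm i k _) (q.adm j k hjk) (quotProj_map hE q _) ?_
  · rw [← T.map_comp]; rfl
  · refine (quotProj_map hE q _).trans ?_
    exact (congrArg (· ≫ quotProj hE q (pr j k hjk)) e).trans (Category.id_comp _)

/-- The map of quotients induced by a natural transformation. -/
def quotMapApp {T T' : ℤ ⥤ A} (q : Quotients E T) (q' : Quotients E T') (f : T ⟶ T') (p : Pairs) :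
    (quotFunctor hE q).obj p ⟶ (quotFunctor hE q').obj p :=
  hE.desc (q.adm p.1.1 p.1.2 p.2) (f.app p.1.2 ≫ quotProj hE q' p) (by
    have h := hE.comp_zero _ _ (q'.adm p.1.1 p.1.2 p.2)
    have e : T.map (homOfLE p.2) ≫ f.app p.1.2 = f.app p.1.1 ≫ T'.map (homOfLE p.2) :=
      f.naturality _
    rw [← Category.assoc, e, Category.assoc]
    exact (congrArg (f.app p.1.1 ≫ ·) h).trans comp_zero)

lemma quotProj_mapApp {T T' : ℤ ⥤ A} (q : Quotients E T) (q' : Quotients E T') (f : T ⟶ T')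
    (p : Pairs) :
    quotProj hE q p ≫ quotMapApp hE q q' f p = f.app p.1.2 ≫ quotProj hE q' p :=
  hE.fac (q.adm p.1.1 p.1.2 p.2) _ _

/-- The natural transformation of the functors of quotients induced by a natural
transformation. -/
def quotMap {T T' : ℤ ⥤ A} (q : Quotients E T) (q' : Quotients E T') (f : T ⟶ T') :
    quotFunctor hE q ⟶ quotFunctor hE q' where
  app p := quotMapApp hE q q' f p
  naturality p p' g := by
    have := quotProj_epi hE q p
    have h₁ := quotProj_map hE q g
    have h₂ := quotProj_map hE q' g
    have h₃ := quotProj_mapApp hE q q' f p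
    have h₄ := quotProj_mapApp hE q q' f p'
    rw [← cancel_epi (quotProj hE q p), reassoc_of% h₁, h₄, reassoc_of% h₃, h₂,
      f.naturality_assoc]

lemma quotMap_id {T : ℤ ⥤ A} (q : Quotients E T) : quotMap hE q q (𝟙 T) = 𝟙 _ := by
  ext p
  have := quotProj_epi hE q p
  rw [← cancel_epi (quotProj hE q p)]
  exact (quotProj_mapApp hE q q _ p).trans
    ((Category.id_comp _).trans (Category.comp_id _).symm)

lemma quotMap_comp {T T' T'' : ℤ ⥤ A} (q : Quotients E T) (q' : Quotients E T')
    (q'' : Quotients E T'') (f : T ⟶ T') (g : T' ⟶ T'') :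
    quotMap hE q q'' (f ≫ g) = quotMap hE q q' f ≫ quotMap hE q' q'' g := by
  ext p
  have := quotProj_epi hE q p
  have h₁ := quotProj_mapApp hE q q' f p
  have h₂ := quotProj_mapApp hE q' q'' g p
  have h₃ := quotProj_mapApp hE q q'' (f ≫ g) p
  rw [← cancel_epi (quotProj hE q p), NatTrans.comp_app]
  refine h₃.trans ?_
  change _ = quotProj hE q p ≫ quotMapApp hE q q' f p ≫ quotMapApp hE q' q'' g p
  rw [reassoc_of% h₁, h₂, NatTrans.comp_app, Category.assoc]

end Quot

variable [HasZeroObject A]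

/-- The extension of a system `S : ℕ ⥤ A` to `ℤ` by zero in negative degrees. -/
def extendZero (S : ℕ ⥤ A) : ℤ ⥤ A where
  obj
    | Int.ofNat n => S.obj n
    | Int.negSucc _ => 0
  map {i j} f := match i, j, f with
    | Int.ofNat _, Int.ofNat _, f => S.map (homOfLE (Int.ofNat_le.1 (leOfHom f)))
    | Int.negSucc _, _, _ => 0
    | Int.ofNat _, Int.negSucc _, _ => 0
  map_id i := match i with
    | Int.ofNat n => S.map_id n
    | Int.negSucc _ => (isZero_zero A).eq_of_src _ _
  map_comp {i j k} f g := match i, j, k, f, g with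
    | Int.ofNat _, Int.ofNat _, Int.ofNat _, _, _ => S.map_comp _ _
    | Int.negSucc _, _, _, _, _ => (isZero_zero A).eq_of_src _ _
    | Int.ofNat _, Int.negSucc _, _, f, _ =>
      absurd (leOfHom f) (by have := Int.negSucc_lt_zero; grind)
    | Int.ofNat _, Int.ofNat _, Int.negSucc _, _, g =>
      absurd (leOfHom g) (by have := Int.negSucc_lt_zero; grind)

/-- The extension by zero of a natural transformation. -/
def extendZeroMap {S S' : ℕ ⥤ A} (f : S ⟶ S') : extendZero S ⟶ extendZero S' where
  app
    | Int.ofNat n => f.app n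
    | Int.negSucc _ => 0
  naturality i j g := match i, j, g with
    | Int.ofNat _, Int.ofNat _, _ => f.naturality _
    | Int.negSucc _, _, _ => (isZero_zero A).eq_of_src _ _
    | Int.ofNat _, Int.negSucc _, g =>
      absurd (leOfHom g) (by have := Int.negSucc_lt_zero; grind)

lemma extendZeroMap_id (S : ℕ ⥤ A) : extendZeroMap (𝟙 S) = 𝟙 _ := by
  ext i
  match i with
  | Int.ofNat _ => rfl
  | Int.negSucc _ => exact (isZero_zero A).eq_of_src _ _

lemma extendZeroMap_comp {S S' S'' : ℕ ⥤ A} (f : S ⟶ S') (g : S' ⟶ S'') :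
    extendZeroMap (f ≫ g) = extendZeroMap f ≫ extendZeroMap g := by
  ext i
  match i with
  | Int.ofNat _ => rfl
  | Int.negSucc _ => exact (isZero_zero A).eq_of_src _ _

variable {E : SeqClass A} (hE : IsExactStructure E)

/-- The extension of a choice of quotients `S j / S i`, `0 ≤ i ≤ j`, to all integers `i ≤ j`: for
`i < 0` the quotient is `S j` itself if `0 ≤ j`, and `0` if `j < 0`. -/
def extendQuotients {S : ℕ ⥤ A} (q : Quotients E S) : Quotients E (extendZero S) where
  obj i j h := match i, j, h with
    | Int.ofNat i, Int.ofNat j, h => q.obj i j (Int.ofNat_le.1 h)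
    | Int.negSucc _, j, _ => (extendZero S).obj j
    | Int.ofNat _, Int.negSucc _, _ => 0
  proj i j h := match i, j, h with
    | Int.ofNat i, Int.ofNat j, h => q.proj i j (Int.ofNat_le.1 h)
    | Int.negSucc _, j, _ => 𝟙 ((extendZero S).obj j)
    | Int.ofNat _, Int.negSucc _, _ => 0
  adm i j h := match i, j, h with
    | Int.ofNat i, Int.ofNat j, h => q.adm i j (Int.ofNat_le.1 h)
    | Int.negSucc _, _, _ => hE.of_isZero_left (isZero_zero A) _
    | Int.ofNat _, Int.negSucc _, h => absurd h (by have := Int.negSucc_lt_zero; grind)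

/-- The functor from systems of admissible monomorphisms to admissible functors on `Π`, for chosen
quotients `S j / S i`: on objects,
`X (i, j) = S j / S i` for `0 ≤ i ≤ j`, `X (i, j) = S j` for `i < 0 ≤ j`, and
`X (i, j) = 0` for `i ≤ j < 0`. -/
def indSysToAdmFun (q : ∀ S : IndSys E, Quotients E S.obj) : IndSys E ⥤ AdmFun E where
  obj S := ⟨quotFunctor hE (extendQuotients hE (q S)), quotFunctor_admissible hE _⟩
  map f := ObjectProperty.homMk (quotMap hE _ _ (extendZeroMap f.hom))
  map_id S := by
    ext1
    exact (congrArg _ (extendZeroMap_id _)).trans (quotMap_id hE _)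
  map_comp f g := by
    ext1
    exact (congrArg _ (extendZeroMap_comp _ _)).trans (quotMap_comp hE _ _ _ _ _)

/-- The object of the Beilinson category attached to a system of admissible monomorphisms. -/
def indSysToBeilinson (q : ∀ S : IndSys E, Quotients E S.obj) : IndSys E ⥤ Beilinson E :=
  indSysToAdmFun hE q ⋙ toBeilinson E

/-- The order reversing involution `(i, j) ↦ (-j, -i)` of `Π`. -/
def pairsNeg : Pairs ⥤ Pairsᵒᵖ where
  obj p := op (pr (-p.1.2) (-p.1.1) (neg_le_neg p.2))
  map {_ _} f := (prHom (neg_le_neg (leOfHom f).2) (neg_le_neg (leOfHom f).1)).op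

/-- The duality which sends an admissible functor `X` on `Π` with values in `Aᵒᵖ` to the
admissible functor `(i, j) ↦ X (-j, -i)` with values in `A`. -/
def dualize (E : SeqClass A) : (AdmFun E.op)ᵒᵖ ⥤ AdmFun E where
  obj X := ⟨pairsNeg ⋙ X.unop.obj.leftOp,
    fun i j k hij hjk => X.unop.property (-k) (-j) (-i) (neg_le_neg hjk) (neg_le_neg hij)⟩
  map f := ObjectProperty.homMk (Functor.whiskerLeft pairsNeg (NatTrans.leftOp f.unop.hom))

/-- The object of the Beilinson category attached to a system of admissible epimorphisms
`⋯ ⟶ P 2 ⟶ P 1 ⟶ P 0` of `A`, i.e. a system of admissible monomorphisms of `Aᵒᵖ`, for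
chosen kernels of the maps `P j ⟶ P i`, i.e. chosen quotients in `Aᵒᵖ`: it is the functor with
`X (i, j) = ker (P (-i) ⟶ P (-j))` for `i ≤ j ≤ 0`, `X (i, j) = P (-i)` for `i ≤ 0 < j`, and
`X (i, j) = 0` for `0 < i ≤ j`. -/
def proSysToBeilinson (q : ∀ S : IndSys E.op, Quotients E.op S.obj) :
    (IndSys E.op)ᵒᵖ ⥤ Beilinson E :=
  (indSysToAdmFun hE.op q).op ⋙ dualize E ⋙ toBeilinson E

end Embedding

end TateExact

end

/-! The localization is controlled by endofunctors instead of arbitrary zigzags. For bicofinal `φ ≥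
id` the reindexing `X ∘ φ̃` receives a natural map from `X`, and these endofunctors are closed under
composition. Every reindexing map is invertible up to them, because `ψ ≤ φ ∘ θ` for some `θ ≥ id`.
This yields a calculus of left fractions: a map `X ⟶ Y` of the Beilinson category is represented by
a map `X ⟶ Y ∘ φ̃` of admissible functors, and two maps of admissible functors become equal exactly
if they agree after a further reindexing (`Reindexing`, `reindexMaps_le_W`). In the same way,
countable strict ind-objects are the localization of the category of sequences at the maps `S ⟶ S ∘
φ` (`isLocalization_indLim`).

Exactness: an extension of admissible functors is admissible by a form of the 3×3 lemma
(`IsExactStructure.middle_column`). Hence pushouts and composites of admissible monomorphisms can be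
formed componentwise, and left fractions carry them to the Beilinson category. The involution `(i,
j) ↦ (-j, -i)` identifies the Beilinson category of `Aᵒᵖ` with the opposite of that of `A`, which
gives the axioms for admissible epimorphisms. The obscure axioms follow from the others by Keller's
argument.

Embedding: a system extended by zero satisfies `S j / S i = S j` for `i < 0`, so a map between
functors of quotients comes from a map of systems (`exists_quotAdmMap`); this gives fullness, and
monomorphy of the transition maps gives faithfulness. The essential image consists of the functors
with `X (i, j) = 0` for all small `j` (`essImage_indSysToBeilinson_iff`), a condition stable under
extensions. An extension-closed full subcategory with a zero object inherits an exact structure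
(`isExactCategory_induced`). The pro case is the ind case for `Aᵒᵖ`, seen through the duality. -/

noncomputable section

namespace TateExact

/-! ### Quillen exact categories: the short five lemma, the obscure axioms, the 3×3 lemma. -/

section Core

variable {C : Type u} [Category.{v} C]

/-- Quillen's axioms without the two redundant ones (see `IsQuillenExact.isExactStructure`). -/
structure IsQuillenExact [Preadditive C] (E : SeqClass C) : Prop where
  comp_zero : ∀ ⦃X Y Z : C⦄ (f : X ⟶ Y) (g : Y ⟶ Z), E f g → f ≫ g = 0
  isKernel : ∀ ⦃X Y Z : C⦄ (f : X ⟶ Y) (g : Y ⟶ Z) (_ : E f g) (w : f ≫ g = 0),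
    Nonempty (IsLimit (KernelFork.ofι f w))
  isCokernel : ∀ ⦃X Y Z : C⦄ (f : X ⟶ Y) (g : Y ⟶ Z) (_ : E f g) (w : f ≫ g = 0),
    Nonempty (IsColimit (CokernelCofork.ofπ g w))
  of_iso : ∀ ⦃X Y Z X' Y' Z' : C⦄ (f : X ⟶ Y) (g : Y ⟶ Z) (f' : X' ⟶ Y') (g' : Y' ⟶ Z')
    (a : X ≅ X') (b : Y ≅ Y') (c : Z ≅ Z'),
    f ≫ b.hom = a.hom ≫ f' → g ≫ c.hom = b.hom ≫ g' → E f g → E f' g'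
  split : ∀ ⦃X Z : C⦄ (b : BinaryBicone X Z), b.IsBilimit → E b.inl b.snd
  admMono_comp : ∀ ⦃X Y Z : C⦄ (f : X ⟶ Y) (g : Y ⟶ Z),
    IsAdmMono E f → IsAdmMono E g → IsAdmMono E (f ≫ g)
  admEpi_comp : ∀ ⦃X Y Z : C⦄ (f : X ⟶ Y) (g : Y ⟶ Z),
    IsAdmEpi E f → IsAdmEpi E g → IsAdmEpi E (f ≫ g)
  pullback : ∀ ⦃Y Z W : C⦄ (g : Y ⟶ Z) (h : W ⟶ Z), IsAdmEpi E g →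
    ∃ (P : C) (h' : P ⟶ Y) (g' : P ⟶ W), IsPullback h' g' g h ∧ IsAdmEpi E g'
  pushout : ∀ ⦃X Y W : C⦄ (f : X ⟶ Y) (h : X ⟶ W), IsAdmMono E f →
    ∃ (P : C) (h' : Y ⟶ P) (f' : W ⟶ P), IsPushout f h h' f' ∧ IsAdmMono E f'

lemma IsExactStructure.isQuillenExact [Preadditive C] {E : SeqClass C}
    (hE : IsExactStructure E) : IsQuillenExact E where
  comp_zero := hE.comp_zero
  isKernel := hE.isKernel
  isCokernel := hE.isCokernel
  of_iso := hE.of_iso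
  split := hE.split
  admMono_comp := hE.admMono_comp
  admEpi_comp := hE.admEpi_comp
  pullback := hE.pullback
  pushout := hE.pushout

namespace IsQuillenExact

variable [Preadditive C] {E : SeqClass C} (hE : IsQuillenExact E)

include hE

lemma epi {X Y Z : C} {f : X ⟶ Y} {g : Y ⟶ Z} (h : E f g) : Epi g :=
  ⟨fun _ _ e => Cofork.IsColimit.hom_ext (hE.isCokernel f g h (hE.comp_zero f g h)).some e⟩

lemma mono {X Y Z : C} {f : X ⟶ Y} {g : Y ⟶ Z} (h : E f g) : Mono f :=
  ⟨fun _ _ e => Fork.IsLimit.hom_ext (hE.isKernel f g h (hE.comp_zero f g h)).some e⟩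

lemma exists_desc {X Y Z W : C} {f : X ⟶ Y} {g : Y ⟶ Z} (h : E f g) (k : Y ⟶ W)
    (hk : f ≫ k = 0) : ∃ l : Z ⟶ W, g ≫ l = k :=
  ⟨_, (hE.isCokernel f g h (hE.comp_zero f g h)).some.fac (CokernelCofork.ofπ k hk)
    WalkingParallelPair.one⟩

lemma exists_lift {X Y Z W : C} {f : X ⟶ Y} {g : Y ⟶ Z} (h : E f g) (k : W ⟶ Y)
    (hk : k ≫ g = 0) : ∃ l : W ⟶ X, l ≫ f = k :=
  ⟨_, (hE.isKernel f g h (hE.comp_zero f g h)).some.fac (KernelFork.ofι k hk)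
    WalkingParallelPair.zero⟩

/-- An admissible monomorphism is part of an admissible sequence with any of its cokernels. -/
lemma of_isCokernel {X Y Z : C} {f : X ⟶ Y} {g : Y ⟶ Z} (hf : IsAdmMono E f) (w : f ≫ g = 0)
    [Epi g] (hg : ∀ ⦃W : C⦄ (k : Y ⟶ W), f ≫ k = 0 → ∃ l : Z ⟶ W, g ≫ l = k) : E f g := by
  obtain ⟨Q, q, hq⟩ := hf
  have := hE.epi hq
  obtain ⟨a, ha⟩ := hE.exists_desc hq g w
  obtain ⟨b, hb⟩ := hg q (hE.comp_zero _ _ hq)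
  refine hE.of_iso f q f g (Iso.refl _) (Iso.refl _)
    ⟨a, b, ?_, ?_⟩ (by simp) (by simpa using ha) hq
  · rw [← cancel_epi q, reassoc_of% ha, hb, Category.comp_id]
  · rw [← cancel_epi g, reassoc_of% hb, ha, Category.comp_id]

/-- An admissible epimorphism is part of an admissible sequence with any of its kernels. -/
lemma of_isKernel {X Y Z : C} {f : X ⟶ Y} {g : Y ⟶ Z} (hg : IsAdmEpi E g) (w : f ≫ g = 0)
    [Mono f] (hf : ∀ ⦃W : C⦄ (k : W ⟶ Y), k ≫ g = 0 → ∃ l : W ⟶ X, l ≫ f = k) : E f g := by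
  obtain ⟨K, k, hk⟩ := hg
  have := hE.mono hk
  obtain ⟨a, ha⟩ := hE.exists_lift hk f w
  obtain ⟨b, hb⟩ := hf k (hE.comp_zero _ _ hk)
  refine hE.of_iso k g f g ⟨b, a, ?_, ?_⟩ (Iso.refl _) (Iso.refl _)
     (by simpa using hb.symm) (by simp) hk
  · rw [← cancel_mono k, Category.assoc, ha, hb, Category.id_comp]
  · rw [← cancel_mono f, Category.assoc, hb, ha, Category.id_comp]

lemma of_iso_mid {X Y Z Y' : C} {f : X ⟶ Y} {g : Y ⟶ Z} {f' : X ⟶ Y'} {g' : Y' ⟶ Z}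
    (b : Y ≅ Y') (hf : f ≫ b.hom = f') (hg : g = b.hom ≫ g') (h : E f g) : E f' g' :=
  hE.of_iso f g f' g' (Iso.refl _) b (Iso.refl _) (by simpa using hf) (by simpa using hg) h

/-- The kernel sequence of a pullback of an admissible epimorphism. -/
lemma pullback_seq {X Y Z P W : C} {f : X ⟶ Y} {g : Y ⟶ Z} (h : E f g) {h' : P ⟶ Y} {g' : P ⟶ W}
    {t : W ⟶ Z} (sq : IsPullback h' g' g t) :
    ∃ k : X ⟶ P, k ≫ h' = f ∧ k ≫ g' = 0 ∧ E k g' := by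
  have := hE.mono h
  obtain ⟨P₀, h₀, g₀, sq₀, K, k, hk⟩ := hE.pullback g t ⟨_, _, h⟩
  have hg' : IsAdmEpi E g' := ⟨K, k ≫ (sq₀.isoIsPullback _ _ sq).hom,
    hE.of_iso_mid (sq₀.isoIsPullback _ _ sq) rfl (by simp) hk⟩
  have w : f ≫ g = 0 ≫ t := by rw [hE.comp_zero _ _ h, zero_comp]
  refine ⟨sq.lift f 0 w, by simp, by simp, ?_⟩
  have : Mono (sq.lift f 0 w) := by
    have : Mono (sq.lift f 0 w ≫ h') := by rw [sq.lift_fst]; infer_instance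
    exact mono_of_mono _ h'
  refine hE.of_isKernel hg' (by simp) fun V v hv => ?_
  obtain ⟨l, hl⟩ := hE.exists_lift h (v ≫ h') (by rw [Category.assoc, sq.w, reassoc_of% hv,
    zero_comp])
  exact ⟨l, sq.hom_ext (by simpa using hl) (by simpa using hv.symm)⟩

/-- The cokernel sequence of a pushout of an admissible monomorphism. -/
lemma pushout_seq {X Y Z P W : C} {f : X ⟶ Y} {g : Y ⟶ Z} (h : E f g) {h' : Y ⟶ P} {f' : W ⟶ P}
    {t : X ⟶ W} (sq : IsPushout f t h' f') :
    ∃ k : P ⟶ Z, h' ≫ k = g ∧ f' ≫ k = 0 ∧ E f' k := by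
  have := hE.epi h
  obtain ⟨P₀, h₀, f₀, sq₀, K, k, hk⟩ := hE.pushout f t ⟨_, _, h⟩
  have hf' : IsAdmMono E f' := ⟨K, (sq₀.isoIsPushout _ _ sq).inv ≫ k,
    hE.of_iso_mid (sq₀.isoIsPushout _ _ sq) (by simp) (by simp) hk⟩
  have w : f ≫ g = t ≫ 0 := by rw [hE.comp_zero _ _ h, Limits.comp_zero]
  refine ⟨sq.desc g 0 w, by simp, by simp, ?_⟩
  have : Epi (sq.desc g 0 w) := by
    have : Epi (h' ≫ sq.desc g 0 w) := by rw [sq.inl_desc]; infer_instance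
    exact epi_of_epi h' _
  refine hE.of_isCokernel hf' (by simp) fun V v hv => ?_
  obtain ⟨l, hl⟩ := hE.exists_desc h (h' ≫ v) (by rw [← Category.assoc, sq.w, Category.assoc, hv,
    Limits.comp_zero])
  exact ⟨l, sq.hom_ext (by simpa using hl) (by simpa using hv.symm)⟩

/-- The short five lemma. -/
lemma isIso_mid {X Y Z Y' : C} {i : X ⟶ Y} {p : Y ⟶ Z} {i' : X ⟶ Y'} {p' : Y' ⟶ Z}
    (h : E i p) (h' : E i' p') (f : Y ⟶ Y') (hi : i ≫ f = i') (hp : f ≫ p' = p) : IsIso f := by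
  -- In terms of elements, `D` consists of the pairs `(y, y')` over the same point of `Z`, and the
  -- inverse of `f` sends `y'` to `y + i x`, where `i' x = y' - f y`.
  obtain ⟨D, d₁, d₂, sq, -⟩ := hE.pullback p p' ⟨_, _, h⟩
  obtain ⟨k, hk₁, hk₂, hk⟩ := hE.pullback_seq h sq
  obtain ⟨k', hk'₂, hk'₁, hk'⟩ := hE.pullback_seq h' sq.flip
  have := hE.mono hk'
  have := hE.mono h'
  have := hE.epi hk
  let σ := sq.lift (𝟙 Y) f (by simp [hp])
  have hσ₁ : σ ≫ d₁ = 𝟙 Y := sq.lift_fst _ _ _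
  have hσ₂ : σ ≫ d₂ = f := sq.lift_snd _ _ _
  -- `e (y, y')` is the difference `y' - f y`, read in `X`.
  obtain ⟨e, he⟩ := hE.exists_lift hk' (𝟙 D - d₁ ≫ σ) (by simp [hσ₁])
  have hke : k ≫ e = -𝟙 X := by
    rw [← cancel_mono i', Category.assoc, ← hk'₂, reassoc_of% he, hk'₂]
    simp [hk₂, reassoc_of% hk₁, hσ₂, hi]
  have hσe : σ ≫ e = 0 := by
    rw [← cancel_mono k', Category.assoc, he]
    simp [reassoc_of% hσ₁]
  -- The formula `y + i x` does not depend on `y`: on the kernel `k` of `d₂` the two summands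
  -- cancel.
  obtain ⟨g, hg⟩ := hE.exists_desc hk (d₁ + e ≫ i) (by simp [hk₁, reassoc_of% hke])
  refine ⟨g, ?_, ?_⟩
  · rw [← hσ₂, Category.assoc, hg]
    simp [hσ₁, reassoc_of% hσe]
  · rw [← cancel_epi d₂, reassoc_of% hg, Preadditive.add_comp, Category.assoc, hi, ← hk'₂,
      reassoc_of% he]
    simp [hσ₂]

/-- The obscure axiom for admissible monomorphisms follows from the others. -/
lemma admMono_of_comp [HasBinaryBiproducts C] {X Y Z : C} (f : X ⟶ Y) (h : Y ⟶ Z)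
    (hc : HasCokernel f) (hfh : IsAdmMono E (f ≫ h)) : IsAdmMono E f := by
  -- Keller's argument: `(f, f ≫ h) : X ⟶ Y ⊞ Z` is admissible, being the split map `(f, 𝟙)`
  -- followed by a pushout of `f ≫ h`. A shear turns it into `(f, 0)`, from which `f` is recovered
  -- by a pullback.
  have h₁ : IsAdmMono E (biprod.lift f (𝟙 X)) := by
    let b : BinaryBicone X Y :=
      { pt := Y ⊞ X, inl := biprod.lift f (𝟙 X), inr := biprod.inl
        fst := biprod.snd, snd := biprod.desc (𝟙 Y) (-f) }
    exact ⟨_, _, hE.split b (isBinaryBilimitOfTotal b (by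
      ext <;> simp [b]))⟩
  have sq : IsPushout (f ≫ h) (biprod.inr : X ⟶ Y ⊞ X) (biprod.inr : Z ⟶ Y ⊞ Z)
      (biprod.map (𝟙 Y) (f ≫ h)) := by
    refine ⟨⟨by simp⟩, ⟨PushoutCocone.IsColimit.mk _
      (fun s => biprod.desc (biprod.inl ≫ s.inr) s.inl) (fun s => by simp) (fun s => ?_)
      (fun s m h₁ h₂ => ?_)⟩⟩
    · ext
      · simp
      · simpa using s.condition
    · ext
      · simp [← h₂]
      · simpa using h₁
  obtain ⟨W, g, hg⟩ := hfh
  obtain ⟨k, -, -, hk⟩ := hE.pushout_seq hg sq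
  obtain ⟨Q, q, hq⟩ := hE.admMono_comp _ _ h₁ ⟨_, _, hk⟩
  -- The shear `(y, z) ↦ (y, z - h y)`.
  let e : Y ⊞ Z ≅ Y ⊞ Z :=
    { hom := biprod.desc (biprod.lift (𝟙 Y) (-h)) biprod.inr
      inv := biprod.desc (biprod.lift (𝟙 Y) h) biprod.inr
      hom_inv_id := by ext <;> simp
      inv_hom_id := by ext <;> simp }
  have h₂ : IsAdmMono E (biprod.lift f (0 : X ⟶ Z)) :=
    ⟨Q, e.inv ≫ q, hE.of_iso_mid e (by ext <;> simp [e, biprod.lift_eq]) (by simp) hq⟩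
  have h₃ : E (biprod.lift f (0 : X ⟶ Z)) (biprod.map (cokernel.π f) (𝟙 Z)) := by
    refine hE.of_isCokernel h₂ (by ext <;> simp) fun V v hv => ?_
    refine ⟨biprod.desc (cokernel.desc f (biprod.inl ≫ v) ?_) (biprod.inr ≫ v), ?_⟩
    · simpa [biprod.lift_eq] using hv
    · ext <;> simp
  -- Restricting the cokernel `Y ⊞ Z ⟶ cokernel f ⊞ Z` to the first summand of its target leaves
  -- `cokernel.π f`, with the same kernel.
  have sq' : IsPullback (biprod.inl : Y ⟶ Y ⊞ Z) (cokernel.π f)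
      (biprod.map (cokernel.π f) (𝟙 Z)) biprod.inl := by
    refine ⟨⟨by simp⟩, ⟨PullbackCone.IsLimit.mk _
      (fun s => s.fst ≫ biprod.fst) (fun s => ?_) (fun s => ?_) (fun s m h₁ h₂ => ?_)⟩⟩
    · ext
      · simp
      · simpa using (s.condition =≫ biprod.snd).symm
    · simpa using s.condition =≫ biprod.fst
    · simp [← h₁]
  obtain ⟨k, hk, -, hk'⟩ := hE.pullback_seq h₃ sq'
  obtain rfl : k = f := by simpa using hk =≫ biprod.fst
  exact ⟨_, _, hk'⟩

/-- The obscure axiom for admissible epimorphisms follows from the others. -/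
lemma admEpi_of_comp [HasBinaryBiproducts C] {X Y Z : C} (h : X ⟶ Y) (f : Y ⟶ Z)
    (hc : HasKernel f) (hfh : IsAdmEpi E (h ≫ f)) : IsAdmEpi E f := by
  -- The dual argument: a pullback of `h ≫ f` followed by a split epimorphism gives `(f, h ≫ f)` on
  -- `Y ⊞ X`, a shear turns it into `(f, 0)`, and `f` is recovered by a pushout.
  have h₁ : IsAdmEpi E (biprod.desc f (𝟙 Z)) := by
    let b : BinaryBicone Y Z :=
      { pt := Y ⊞ Z, inr := biprod.inr, inl := biprod.lift (𝟙 Y) (-f)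
        fst := biprod.fst, snd := biprod.desc f (𝟙 Z) }
    exact ⟨_, _, hE.split b (isBinaryBilimitOfTotal b (by
      ext <;> simp [b]))⟩
  have sq : IsPullback (biprod.snd : Y ⊞ X ⟶ X) (biprod.map (𝟙 Y) (h ≫ f)) (h ≫ f)
      (biprod.snd : Y ⊞ Z ⟶ Z) := by
    refine ⟨⟨by simp⟩, ⟨PullbackCone.IsLimit.mk _
      (fun s => biprod.lift (s.snd ≫ biprod.fst) s.fst) (fun s => by simp) (fun s => ?_)
      (fun s m h₁ h₂ => ?_)⟩⟩
    · ext
      · simp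
      · simpa using s.condition
    · ext
      · simp [← h₂]
      · simpa using h₁
  obtain ⟨W, g, hg⟩ := hfh
  obtain ⟨k, -, -, hk⟩ := hE.pullback_seq hg sq
  obtain ⟨Q, q, hq⟩ := hE.admEpi_comp _ _ ⟨_, _, hk⟩ h₁
  let e : Y ⊞ X ≅ Y ⊞ X :=
    { hom := biprod.desc biprod.inl (biprod.lift h (𝟙 X))
      inv := biprod.desc biprod.inl (biprod.lift (-h) (𝟙 X))
      hom_inv_id := by ext <;> simp
      inv_hom_id := by ext <;> simp }
  have h₂ : IsAdmEpi E (biprod.desc f (0 : X ⟶ Z)) :=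
    ⟨Q, q ≫ e.hom, hE.of_iso_mid e (by simp) (by ext <;> simp [e]) hq⟩
  have h₃ : E (biprod.map (kernel.ι f) (𝟙 X)) (biprod.desc f (0 : X ⟶ Z)) := by
    refine hE.of_isKernel h₂ (by ext <;> simp) fun V v hv => ?_
    refine ⟨biprod.lift (kernel.lift f (v ≫ biprod.fst) ?_) (v ≫ biprod.snd), ?_⟩
    · simpa [biprod.desc_eq] using hv
    · ext <;> simp
  have sq' : IsPushout (biprod.map (kernel.ι f) (𝟙 X)) biprod.fst (biprod.fst : Y ⊞ X ⟶ Y)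
      (kernel.ι f) := by
    refine ⟨⟨by simp⟩, ⟨PushoutCocone.IsColimit.mk _
      (fun s => biprod.inl ≫ s.inl) (fun s => ?_) (fun s => ?_) (fun s m h₁ h₂ => ?_)⟩⟩
    · ext
      · simp
      · simpa using (biprod.inr ≫= s.condition).symm
    · simpa using biprod.inl ≫= s.condition
    · simp [← h₁]
  obtain ⟨k, hk, -, hk'⟩ := hE.pushout_seq h₃ sq'
  obtain rfl : k = f := by simpa using biprod.inl ≫= hk
  exact ⟨_, _, hk'⟩

theorem isExactStructure [HasBinaryBiproducts C] : IsExactStructure E where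
  comp_zero := hE.comp_zero
  isKernel := hE.isKernel
  isCokernel := hE.isCokernel
  of_iso := hE.of_iso
  split := hE.split
  admMono_comp := hE.admMono_comp
  admEpi_comp := hE.admEpi_comp
  pullback := hE.pullback
  pushout := hE.pushout
  admEpi_of_comp _ _ _ h f := hE.admEpi_of_comp h f
  admMono_of_comp _ _ _ f h := hE.admMono_of_comp f h

end IsQuillenExact

/-- The middle column of a diagram with admissible rows is admissible if the outer columns are and
the composite of its maps is zero. -/
lemma IsExactStructure.middle_column [Preadditive C] {E : SeqClass C} (hE : IsExactStructure E)
    {X₁ X₂ X₃ Y₁ Y₂ Y₃ Z₁ Z₂ Z₃ : C}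
    {a₁ : X₁ ⟶ Y₁} {b₁ : Y₁ ⟶ Z₁} {a₂ : X₂ ⟶ Y₂} {b₂ : Y₂ ⟶ Z₂} {a₃ : X₃ ⟶ Y₃} {b₃ : Y₃ ⟶ Z₃}
    (h₁ : E a₁ b₁) (h₂ : E a₂ b₂) (h₃ : E a₃ b₃)
    {x : X₁ ⟶ X₂} {x' : X₂ ⟶ X₃} {y : Y₁ ⟶ Y₂} {y' : Y₂ ⟶ Y₃} {z : Z₁ ⟶ Z₂} {z' : Z₂ ⟶ Z₃}
    (hx : E x x') (hz : E z z') (hy : y ≫ y' = 0)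
    (ha : a₁ ≫ y = x ≫ a₂) (hb : b₁ ≫ z = y ≫ b₂)
    (ha' : a₂ ≫ y' = x' ≫ a₃) (hb' : b₂ ≫ z' = y' ≫ b₃) : E y y' := by
  have hE' := hE.isQuillenExact
  obtain ⟨P, p₁, p₂, sq, -⟩ := hE.pullback b₂ z ⟨_, _, h₂⟩
  obtain ⟨k, hk₁, hk₂, hk⟩ := hE'.pullback_seq h₂ sq
  -- `P` is the preimage of `Z₁` in `Y₂`, so `Y₂ / P = Z₃`.
  have hp : E p₁ (b₂ ≫ z') := by
    have := hE'.mono hz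
    have : Mono p₁ := ⟨fun u v e => sq.hom_ext e (by
      rw [← cancel_mono z, Category.assoc, Category.assoc, ← sq.w, reassoc_of% e])⟩
    refine hE'.of_isKernel (hE.admEpi_comp _ _ ⟨_, _, h₂⟩ ⟨_, _, hz⟩)
      (by rw [reassoc_of% sq.w, hE.comp_zero _ _ hz, Limits.comp_zero]) fun V v hv => ?_
    obtain ⟨l, hl⟩ := hE'.exists_lift hz (v ≫ b₂) (by simpa using hv)
    exact ⟨sq.lift v l hl.symm, sq.lift_fst _ _ _⟩
  obtain ⟨u, hu₁, hu₂⟩ : ∃ u : Y₁ ⟶ P, u ≫ p₁ = y ∧ u ≫ p₂ = b₁ :=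
    ⟨sq.lift y b₁ hb.symm, sq.lift_fst _ _ _, sq.lift_snd _ _ _⟩
  have hau : a₁ ≫ u = x ≫ k := sq.hom_ext (by simp [hu₁, hk₁, ha])
    (by simp [hu₂, hk₂, hE.comp_zero _ _ h₁])
  -- `P` and the pushout of `a₁` and `x` are both extensions of `Z₁` by `X₂`, so the short five
  -- lemma identifies them. It follows that `P / Y₁ = X₃`.
  have sq' : IsPushout a₁ x u k := by
    obtain ⟨P₀, u₀, k₀, sq₀, -⟩ := hE.pushout a₁ x ⟨_, _, h₁⟩
    obtain ⟨c, hc₁, hc₂, hc⟩ := hE'.pushout_seq h₁ sq₀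
    have := hE'.isIso_mid hc hk (sq₀.desc u k hau) (by simp)
      (sq₀.hom_ext (by simp [hu₂, hc₁]) (by simp [hk₂, hc₂]))
    exact sq₀.of_iso (Iso.refl _) (Iso.refl _) (Iso.refl _) (asIso (sq₀.desc u k hau))
      (by simp) (by simp) (by simp) (by simp)
  obtain ⟨r, hr₁, hr₂, hr⟩ := hE'.pushout_seq hx sq'.flip
  obtain ⟨C, c, hc⟩ : IsAdmMono E y := hu₁ ▸ hE.admMono_comp _ _ ⟨_, _, hr⟩ ⟨_, _, hp⟩
  have := hE'.epi hr
  have := hE'.epi hc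
  obtain ⟨s, hs⟩ := hE'.exists_desc hr (p₁ ≫ c) (by
    rw [reassoc_of% hu₁, hE.comp_zero _ _ hc])
  obtain ⟨t, ht⟩ := hE'.exists_desc hc (b₂ ≫ z') (by
    rw [← reassoc_of% hb, hE.comp_zero _ _ hz, Limits.comp_zero])
  obtain ⟨l, hl⟩ := hE'.exists_desc hc y' hy
  -- The sequence `P / Y₁ ⟶ Y₂ / Y₁ ⟶ Y₂ / P` has the same ends as `X₃ ⟶ Y₃ ⟶ Z₃`, to which the
  -- short five lemma compares it.
  have hst : E s t := hE.noether hu₁ hr hc hp hs ht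
  have hpy : p₁ ≫ y' = r ≫ a₃ := sq'.hom_ext
    (by rw [reassoc_of% hu₁, hy, reassoc_of% hr₂, zero_comp])
    (by rw [reassoc_of% hk₁, reassoc_of% hr₁, ha'])
  have := hE'.isIso_mid hst h₃ l
    (by rw [← cancel_epi r, reassoc_of% hs, hl, hpy])
    (by rw [← cancel_epi c, reassoc_of% hl, ht, hb'])
  exact hE.of_iso y c y y' (Iso.refl _) (Iso.refl _) (asIso l) (by simp) (by simpa using hl) hc

end Core

/-! ### Localization at a family of well-pointed endofunctors. -/

/-- A family of well-pointed endofunctors which is closed under composition. -/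
structure Reindexing (C : Type u) [Category.{v} C] where
  /-- the index type -/
  ι : Type
  nonempty : Nonempty ι
  /-- the endofunctors -/
  T : ι → C ⥤ C
  /-- the points -/
  η : ∀ φ, 𝟭 C ⟶ T φ
  map_η : ∀ φ X, (T φ).map ((η φ).app X) = (η φ).app ((T φ).obj X)
  comp : ∀ φ ψ, ∃ (χ : ι) (m : T φ ⋙ T ψ ⟶ T χ),
    ∀ X, (η φ).app X ≫ (η ψ).app ((T φ).obj X) ≫ m.app X = (η χ).app X

namespace Reindexing

variable {C : Type u} [Category.{v} C] (R : Reindexing C)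

/-- The maps which are invertible up to the maps `X ⟶ T φ X`. -/
def W : MorphismProperty C := fun X Y s =>
  ∃ (φ : R.ι) (t : Y ⟶ (R.T φ).obj X), s ≫ t = (R.η φ).app X ∧ t ≫ (R.T φ).map s = (R.η φ).app Y

variable {R} in
lemma η_naturality {X Y : C} (φ : R.ι) (f : X ⟶ Y) :
    (R.η φ).app X ≫ (R.T φ).map f = f ≫ (R.η φ).app Y :=
  ((R.η φ).naturality f).symm

/-- Well-pointedness is what is needed here: for `t = 𝟙` the second condition in `W` reads `T φ (η
X) = η (T φ X)`. -/
lemma W_η (φ : R.ι) (X : C) : R.W ((R.η φ).app X) :=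
  ⟨φ, 𝟙 _, Category.comp_id _, by rw [Category.id_comp]; exact R.map_η φ X⟩

/-- All denominators may be taken among the maps `η`. If `t` inverts `s` up to `T φ`, then `t ≫ T φ
f` over `η` completes the square of `f` and `s`; and `s` can be cancelled because `f ≫ η = η ≫ T φ f
= t ≫ T φ s ≫ T φ f`. -/
instance : R.W.HasLeftCalculusOfFractions where
  id_mem X := by
    obtain ⟨φ⟩ := R.nonempty
    exact ⟨φ, (R.η φ).app X, Category.id_comp _, by simp⟩
  comp_mem {X Y Z} s s' := by
    rintro ⟨φ, t, h₁, h₂⟩ ⟨φ', t', h₁', h₂'⟩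
    obtain ⟨χ, m, hm⟩ := R.comp φ φ'
    refine ⟨χ, t' ≫ (R.T φ').map t ≫ m.app X, ?_, ?_⟩
    · have e := η_naturality φ' t
      rw [← hm, Category.assoc, reassoc_of% h₁', ← h₁, reassoc_of% e, Category.assoc]
    · have e : (R.T φ').map t ≫ m.app X ≫ (R.T χ).map (s ≫ s') =
          (R.T φ').map (t ≫ (R.T φ).map s ≫ (R.T φ).map s') ≫ m.app Z := by
        have e := m.naturality (s ≫ s')
        rw [Functor.comp_map] at e
        rw [← e]
        simp
      rw [← hm, Category.assoc, Category.assoc, e, reassoc_of% h₂, η_naturality]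
      rw [Functor.map_comp, Category.assoc, reassoc_of% h₂', ← Category.assoc, η_naturality]
      exact Category.assoc _ _ _
  exists_leftFraction X Y f := by
    obtain ⟨φ, t, h₁, h₂⟩ := f.hs
    exact ⟨⟨t ≫ (R.T φ).map f.f, (R.η φ).app Y, R.W_η φ Y⟩, by
      simp [reassoc_of% h₁, η_naturality]⟩
  ext X' X Y f g s := by
    rintro ⟨φ, t, h₁, h₂⟩ e
    refine ⟨_, (R.η φ).app Y, R.W_η φ Y, ?_⟩
    rw [← η_naturality, ← η_naturality, ← h₂, Category.assoc, Category.assoc, ← Functor.map_comp,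
      e, Functor.map_comp]

section Localization

variable {D : Type*} [Category D] (L : C ⥤ D) [L.IsLocalization R.W]

instance isIso_map_η (φ : R.ι) (X : C) : IsIso (L.map ((R.η φ).app X)) :=
  Localization.inverts L R.W _ (R.W_η φ X)

lemma map_eq_iff {X Y : C} (a b : X ⟶ Y) :
    L.map a = L.map b ↔ ∃ φ, a ≫ (R.η φ).app Y = b ≫ (R.η φ).app Y := by
  rw [MorphismProperty.map_eq_iff_postcomp L R.W]
  constructor
  · rintro ⟨Z, s, ⟨φ, t, h₁, -⟩, e⟩
    exact ⟨φ, by rw [← h₁, reassoc_of% e]⟩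
  · rintro ⟨φ, e⟩
    exact ⟨_, _, R.W_η φ Y, e⟩

/-- In a left fraction with denominator `s`, composing with an inverse of `s` up to `T φ` replaces
the denominator by `η`. -/
lemma exists_map {X Y : C} (f : L.obj X ⟶ L.obj Y) :
    ∃ (φ : R.ι) (a : X ⟶ (R.T φ).obj Y), L.map a = f ≫ L.map ((R.η φ).app Y) := by
  obtain ⟨ψ, rfl⟩ := Localization.exists_leftFraction L R.W f
  obtain ⟨φ, t, h₁, -⟩ := ψ.hs
  exact ⟨φ, ψ.f ≫ t, by simp [← h₁]⟩

/-- A common denominator: the second map is represented over the reindexing already chosen for the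
first, and both are then pushed into `T χ`. -/
lemma exists_map₂ {X X' Y : C} (f : L.obj X ⟶ L.obj Y) (f' : L.obj X' ⟶ L.obj Y) :
    ∃ (φ : R.ι) (a : X ⟶ (R.T φ).obj Y) (a' : X' ⟶ (R.T φ).obj Y),
      L.map a = f ≫ L.map ((R.η φ).app Y) ∧ L.map a' = f' ≫ L.map ((R.η φ).app Y) := by
  obtain ⟨φ, a, ha⟩ := R.exists_map L f
  obtain ⟨ψ, a', ha'⟩ := R.exists_map L (f' ≫ L.map ((R.η φ).app Y))
  obtain ⟨χ, m, hm⟩ := R.comp φ ψ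
  refine ⟨χ, a ≫ (R.η ψ).app _ ≫ m.app Y, a' ≫ m.app Y, ?_, ?_⟩
  · rw [← hm, Functor.map_comp, ha, Functor.map_comp _ ((R.η φ).app Y), Category.assoc]
  · rw [← hm, Functor.map_comp, ha', Functor.map_comp _ ((R.η φ).app Y), Functor.map_comp,
      Category.assoc, Category.assoc]

/-- To show that a functor out of a localization is faithful, it suffices to consider maps that
come from the source. -/
lemma faithful_of_iso {B : Type*} [Category B] {F : C ⥤ B} {G : D ⥤ B} (e : L ⋙ G ≅ F)
    (h : ∀ ⦃X Y : C⦄ (a b : X ⟶ Y), F.map a = F.map b →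
      ∃ φ, a ≫ (R.η φ).app Y = b ≫ (R.η φ).app Y) : G.Faithful :=
  Functor.faithful_of_comp_of_hasLeftCalculusOfFractions L R.W G fun X Y a b hab => by
    rw [R.map_eq_iff]
    refine h a b ?_
    have ha := e.hom.naturality a
    have hb := e.hom.naturality b
    simp only [Functor.comp_map] at ha hb
    rw [← cancel_epi (e.hom.app X), ← ha, ← hb, hab]

/-- To show that a functor out of a localization is full, it suffices to consider maps between
objects that come from the source. -/
lemma full_of_iso {B : Type*} [Category B] {F : C ⥤ B} {G : D ⥤ B} (e : L ⋙ G ≅ F)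
    (h : ∀ ⦃X Y : C⦄ (f : F.obj X ⟶ F.obj Y),
      ∃ (φ : R.ι) (a : X ⟶ (R.T φ).obj Y), F.map a = f ≫ F.map ((R.η φ).app Y)) : G.Full := by
  have key : ∀ ⦃X Y : C⦄ (g : G.obj (L.obj X) ⟶ G.obj (L.obj Y)), ∃ f, G.map f = g := by
    intro X Y g
    obtain ⟨φ, a, ha⟩ := h (e.inv.app X ≫ g ≫ e.hom.app Y)
    have h₁ : G.map (L.map a) = e.hom.app X ≫ F.map a ≫ e.inv.app _ := by
      simp
    have h₂ : F.map ((R.η φ).app Y) ≫ e.inv.app _ =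
        e.inv.app Y ≫ G.map (L.map ((R.η φ).app Y)) := e.inv.naturality _
    refine ⟨L.map a ≫ inv (L.map ((R.η φ).app Y)), ?_⟩
    rw [Functor.map_comp, Functor.map_inv, IsIso.comp_inv_eq, h₁, ha]
    simp [h₂]
  have := Localization.essSurj L R.W
  refine ⟨fun {X Y} g => ?_⟩
  let eX := L.objObjPreimageIso X
  let eY := L.objObjPreimageIso Y
  obtain ⟨f, hf⟩ := key (G.map eX.hom ≫ g ≫ G.map eY.inv)
  exact ⟨eX.inv ≫ f ≫ eY.hom, by simp [hf]⟩

end Localization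

/-- Two out of six: `F` inverts `s ≫ t` and `t ≫ T φ s`, both of which are maps `η`, so `F t` is a
monomorphism and a split epimorphism. -/
lemma isInvertedBy {B : Type*} [Category B] (F : C ⥤ B)
    (h : ∀ φ X, IsIso (F.map ((R.η φ).app X))) : R.W.IsInvertedBy F := by
  rintro X Y s ⟨φ, t, h₁, h₂⟩
  have i₁ : IsIso (F.map s ≫ F.map t) := by rw [← F.map_comp, h₁]; exact h φ X
  have i₂ : IsIso (F.map t ≫ F.map ((R.T φ).map s)) := by
    rw [← F.map_comp, h₂]; exact h φ Y
  have : Mono (F.map t) := mono_of_mono _ (F.map ((R.T φ).map s))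
  have : IsSplitEpi (F.map t) := ⟨⟨inv (F.map s ≫ F.map t) ≫ F.map s, by simp⟩⟩
  have : IsIso (F.map t) := isIso_of_mono_of_isSplitEpi _
  exact IsIso.of_isIso_comp_right _ (F.map t)

/-- A criterion for a functor to be a localization functor. -/
lemma isLocalization {B : Type*} [Category B] (F : C ⥤ B) [F.EssSurj]
    (h : ∀ φ X, IsIso (F.map ((R.η φ).app X)))
    (h' : ∀ ⦃X Y : C⦄ (a b : X ⟶ Y), F.map a = F.map b →
      ∃ φ, a ≫ (R.η φ).app Y = b ≫ (R.η φ).app Y)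
    (h'' : ∀ ⦃X Y : C⦄ (f : F.obj X ⟶ F.obj Y),
      ∃ (φ : R.ι) (a : X ⟶ (R.T φ).obj Y), F.map a = f ≫ F.map ((R.η φ).app Y)) :
    F.IsLocalization R.W := by
  have hF := R.isInvertedBy F h
  let G := Localization.lift F hF R.W.Q
  let e : R.W.Q ⋙ G ≅ F := Localization.fac F hF R.W.Q
  have := R.faithful_of_iso R.W.Q e h'
  have := R.full_of_iso R.W.Q e h''
  have : G.EssSurj := ⟨fun Y => ⟨R.W.Q.obj (F.objPreimage Y),
    ⟨e.app _ ≪≫ F.objObjPreimageIso Y⟩⟩⟩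
  have : G.IsEquivalence := {}
  exact Functor.IsLocalization.of_iso R.W e

end Reindexing

/-! ### Bicofinal reindexing and componentwise exact sequences of admissible functors. -/

section AdmFun

/-- The identity of `ℤ`. -/
def Bicofinal.id : Bicofinal := ⟨fun i => i, monotone_id, Filter.tendsto_id, Filter.tendsto_id⟩

/-- The composition of bicofinal maps. -/
def Bicofinal.comp (φ ψ : Bicofinal) : Bicofinal :=
  ⟨fun i => φ.toFun (ψ.toFun i), φ.monotone.comp ψ.monotone, φ.tendsto_top.comp ψ.tendsto_top,
    φ.tendsto_bot.comp ψ.tendsto_bot⟩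

/-- The maximum of bicofinal maps. -/
def Bicofinal.max (φ ψ : Bicofinal) : Bicofinal where
  toFun i := Max.max (φ.toFun i) (ψ.toFun i)
  monotone _ _ h := max_le_max (φ.monotone h) (ψ.monotone h)
  tendsto_top := Filter.tendsto_atTop_mono (fun _ => le_max_left _ _) φ.tendsto_top
  tendsto_bot := by
    rw [Filter.tendsto_atBot]
    intro b
    filter_upwards [Filter.tendsto_atBot.1 φ.tendsto_bot b, Filter.tendsto_atBot.1 ψ.tendsto_bot b]
      with i h₁ h₂ using max_le h₁ h₂

lemma Bicofinal.exists_le (φ : Bicofinal) (b : ℤ) : ∃ i, φ.toFun i ≤ b :=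
  ((Filter.tendsto_atBot.1 φ.tendsto_bot b).exists)

lemma Bicofinal.exists_ge (φ : Bicofinal) (b : ℤ) : ∃ i, b ≤ φ.toFun i :=
  ((Filter.tendsto_atTop.1 φ.tendsto_top b).exists)

/-- Any bicofinal map is dominated by a composite with a given one. -/
lemma Bicofinal.exists_le_comp (φ ψ : Bicofinal) :
    ∃ θ : Bicofinal, (∀ i, i ≤ θ.toFun i) ∧ ∀ i, ψ.toFun i ≤ φ.toFun (θ.toFun i) := by
  -- `k i` is the least index with `ψ i ≤ φ k`; it exists because `φ` is unbounded in both
  -- directions. Minimality makes `k` monotone and gives `k i ≤ b` as soon as `ψ i ≤ φ b`. Taking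
  -- the maximum with `i` then forces `θ ≥ id`.
  have hb : ∀ i, ∃ k, ψ.toFun i ≤ φ.toFun k ∧ ∀ l, ψ.toFun i ≤ φ.toFun l → k ≤ l := by
    intro i
    obtain ⟨n, hn⟩ := φ.exists_le (ψ.toFun i - 1)
    exact Int.exists_least_of_bdd ⟨n, fun z hz => by
      by_contra hc
      have := φ.monotone (le_of_lt (not_le.1 hc))
      omega⟩ (φ.exists_ge _)
  choose k hk hk' using hb
  have hmono : Monotone k := fun i j h => hk' _ _ ((ψ.monotone h).trans (hk j))
  refine ⟨⟨fun i => Max.max i (k i), fun i j h => max_le_max h (hmono h),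
    Filter.tendsto_atTop_mono (fun _ => le_max_left _ _) Filter.tendsto_id, ?_⟩,
    fun _ => le_max_left _ _, fun i => (hk i).trans (φ.monotone (le_max_right _ _))⟩
  rw [Filter.tendsto_atBot]
  intro b
  filter_upwards [Filter.eventually_le_atBot b,
    Filter.tendsto_atBot.1 ψ.tendsto_bot (φ.toFun b)] with i h₁ h₂ using max_le h₁ (hk' _ _ h₂)

variable {A : Type u} [Category.{v} A] (E : SeqClass A)

/-- Reindexing, as an endofunctor of the category of admissible functors. -/
def reindexFunctor (φ : Bicofinal) : AdmFun E ⥤ AdmFun E where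
  obj X := X.reindex φ
  map f := ObjectProperty.homMk (Functor.whiskerLeft φ.tilde f.hom)

/-- The endofunctors `X ↦ X ∘ φ̃` of the category of admissible functors, for `φ ≥ id`. -/
def admReindexing : Reindexing (AdmFun E) where
  ι := { φ : Bicofinal // ∀ i, i ≤ φ.toFun i }
  nonempty := ⟨⟨Bicofinal.id, fun _ => le_rfl⟩⟩
  T φ := reindexFunctor E φ.1
  η φ :=
    { app X := X.reindexMap (φ := Bicofinal.id) φ.2
      naturality X Y f := by
        ext p
        exact (f.hom.naturality _).symm }
  map_η φ X := by
    ext p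
    rfl
  comp φ ψ := ⟨⟨φ.1.comp ψ.1, fun i => (ψ.2 i).trans (φ.2 _)⟩, 𝟙 (reindexFunctor E (φ.1.comp ψ.1)),
    fun X => by
      ext p
      exact (congrArg _ (Category.comp_id _)).trans (X.obj.map_comp _ _).symm⟩

/-- With `ψ ≤ φ ∘ θ`, the natural map from `X ∘ ψ̃` to the reindexing of `X ∘ φ̃` by `θ` is an
inverse up to `θ`. -/
lemma reindexMaps_le_W : reindexMaps E ≤ (admReindexing E).W := by
  rintro _ _ _ ⟨X, h⟩
  rename_i φ ψ
  obtain ⟨θ, h₁, h₂⟩ := φ.exists_le_comp ψ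
  refine ⟨⟨θ, h₁⟩, X.reindexMap (φ := ψ) (ψ := φ.comp θ) h₂, ?_, ?_⟩
  · ext p
    exact (X.obj.map_comp _ _).symm
  · ext p
    exact (X.obj.map_comp _ _).symm

/-- Inverting the defining class inverts the maps `η`, hence all of `W` by two out of six; the
converse is `reindexMaps_le_W`. This makes left fractions available. -/
instance isLocalization_toBeilinson : (toBeilinson E).IsLocalization (admReindexing E).W :=
  Functor.IsLocalization.of_equivalence_source (toBeilinson E) (reindexMaps E) (toBeilinson E)
    (admReindexing E).W CategoryTheory.Equivalence.refl
    (fun _ _ _ hf => (admReindexing E).W.le_isoClosure _ (reindexMaps_le_W E _ hf))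
    ((admReindexing E).isInvertedBy _ fun φ X =>
      Localization.inverts (toBeilinson E) (reindexMaps E) _
        (reindexMaps.mk X (φ := Bicofinal.id) φ.2))
    (Functor.leftUnitor _)

instance isIso_toBeilinson_reindexMap {X : AdmFun E} {φ ψ : Bicofinal}
    (h : ∀ i, φ.toFun i ≤ ψ.toFun i) : IsIso ((toBeilinson E).map (X.reindexMap h)) :=
  Localization.inverts (toBeilinson E) (reindexMaps E) _ (reindexMaps.mk X h)

/-- In the Beilinson category, a reindexing of `X` is isomorphic to `X`. -/
def reindexIso (X : AdmFun E) (φ : Bicofinal) :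
    (toBeilinson E).obj (X.reindex φ) ≅ (toBeilinson E).obj X :=
  Localization.isoOfHom (toBeilinson E) (reindexMaps E) _
    (reindexMaps.mk X (φ := φ) (ψ := φ.max Bicofinal.id) fun _ => le_max_left _ _) ≪≫
  (Localization.isoOfHom (toBeilinson E) (reindexMaps E) _
    (reindexMaps.mk X (φ := Bicofinal.id) (ψ := φ.max Bicofinal.id)
      fun _ => le_max_right _ _)).symm

/-- The sequences of admissible functors which are admissible in every component. -/
def levelSeq : SeqClass (AdmFun E) := fun _ _ _ f g => ∀ p, E (f.hom.app p) (g.hom.app p)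

section Level

variable {E} [Preadditive A] (hE : IsExactStructure E)

include hE

lemma IsExactStructure.isZero_mid {X Y Z : A} {f : X ⟶ Y} {g : Y ⟶ Z} (h : E f g)
    (hX : IsZero X) (hZ : IsZero Z) : IsZero Y := by
  obtain ⟨l, hl⟩ := hE.isQuillenExact.exists_lift h (𝟙 Y) (hZ.eq_of_tgt _ _)
  rw [IsZero.iff_id_eq_zero, ← hl, hX.eq_of_tgt l 0, zero_comp]

/-- The sequence for `i ≤ i ≤ i` consists of identities, and its composite is zero. -/
lemma IsAdmissible.isZero_diag {X : Pairs ⥤ A} (hX : IsAdmissible E X) (i : ℤ) :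
    IsZero (X.obj (pr i i le_rfl)) := by
  have h := hE.comp_zero _ _ (hX i i i le_rfl le_rfl)
  rw [← X.map_comp] at h
  rw [IsZero.iff_id_eq_zero, ← X.map_id]
  exact h

/-- An extension of admissible functors is admissible. -/
lemma IsAdmissible.of_extension {X Y Z : Pairs ⥤ A} (f : X ⟶ Y) (g : Y ⟶ Z)
    (h : ∀ p, E (f.app p) (g.app p)) (hX : IsAdmissible E X) (hZ : IsAdmissible E Z) :
    IsAdmissible E Y := by
  intro i j k hij hjk
  refine hE.middle_column (h _) (h _) (h _) (hX i j k hij hjk) (hZ i j k hij hjk) ?_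
    (f.naturality _).symm (g.naturality _).symm (f.naturality _).symm (g.naturality _).symm
  -- The composite factors through `Y (j, j)`, an extension of zero by zero.
  have h0 : IsZero (Y.obj (pr j j le_rfl)) :=
    hE.isZero_mid (h _) (hX.isZero_diag hE j) (hZ.isZero_diag hE j)
  have e : Y.map (prHom le_rfl hjk : pr i j hij ⟶ pr i k (hij.trans hjk)) ≫
      Y.map (prHom hij le_rfl : pr i k (hij.trans hjk) ⟶ pr j k hjk) =
      Y.map (prHom hij le_rfl : pr i j hij ⟶ pr j j le_rfl) ≫
      Y.map (prHom le_rfl hjk : pr j j le_rfl ⟶ pr j k hjk) := by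
    rw [← Y.map_comp, ← Y.map_comp]; rfl
  rw [e, h0.eq_of_tgt (Y.map _) 0, zero_comp]

namespace levelSeq

variable {X Y Z : AdmFun E} {f : X ⟶ Y} {g : Y ⟶ Z} (h : levelSeq E f g)

include h

lemma comp_zero : f ≫ g = 0 := by
  ext p
  exact hE.comp_zero _ _ (h p)

lemma mono : Mono f := ⟨fun a b e => by
  ext p
  have := hE.isQuillenExact.mono (h p)
  rw [← cancel_mono (f.hom.app p)]
  exact congrArg (fun t : _ ⟶ Y => t.hom.app p) e⟩

lemma epi : Epi g := ⟨fun a b e => by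
  ext p
  have := hE.isQuillenExact.epi (h p)
  rw [← cancel_epi (g.hom.app p)]
  exact congrArg (fun t : Y ⟶ _ => t.hom.app p) e⟩

lemma exists_lift {W : AdmFun E} (k : W ⟶ Y) (hk : k ≫ g = 0) : ∃ l : W ⟶ X, l ≫ f = k := by
  choose l hl using fun p => hE.isQuillenExact.exists_lift (h p) (k.hom.app p)
    (congrArg (fun t : W ⟶ Z => t.hom.app p) hk)
  refine ⟨ObjectProperty.homMk { app := l, naturality := fun p q a => ?_ }, ?_⟩
  · have := hE.isQuillenExact.mono (h q)
    rw [← cancel_mono (f.hom.app q), Category.assoc, Category.assoc, hl, f.hom.naturality,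
      reassoc_of% hl p, k.hom.naturality]
  · ext p
    exact hl p

lemma exists_desc {W : AdmFun E} (k : Y ⟶ W) (hk : f ≫ k = 0) : ∃ l : Z ⟶ W, g ≫ l = k := by
  choose l hl using fun p => hE.isQuillenExact.exists_desc (h p) (k.hom.app p)
    (congrArg (fun t : X ⟶ W => t.hom.app p) hk)
  refine ⟨ObjectProperty.homMk { app := l, naturality := fun p q a => ?_ }, ?_⟩
  · have := hE.isQuillenExact.epi (h p)
    rw [← cancel_epi (g.hom.app p), ← g.hom.naturality_assoc, hl, reassoc_of% hl p,
      k.hom.naturality]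
  · ext p
    exact hl p

/-- Admissible monomorphisms of admissible functors have pushouts. -/
lemma exists_pushout {W : AdmFun E} (t : X ⟶ W) :
    ∃ (P : AdmFun E) (h' : Y ⟶ P) (f' : W ⟶ P) (c : P ⟶ Z), IsPushout f t h' f' ∧
      levelSeq E f' c ∧
      ∀ p, IsPushout (f.hom.app p) (t.hom.app p) (h'.hom.app p) (f'.hom.app p) := by
  choose P h' f' sq _ using fun p => hE.pushout (f.hom.app p) (t.hom.app p) ⟨_, _, h p⟩
  choose c hc₁ hc₂ hc using fun p => hE.isQuillenExact.pushout_seq (h p) (sq p)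
  have w : ∀ {p q : Pairs} (a : p ⟶ q), f.hom.app p ≫ Y.obj.map a ≫ h' q =
      t.hom.app p ≫ W.obj.map a ≫ f' q := fun {p q} a => by
    rw [← f.hom.naturality_assoc, ← t.hom.naturality_assoc, (sq q).w]
  let F : Pairs ⥤ A :=
    { obj := P
      map {p q} a := (sq p).desc (Y.obj.map a ≫ h' q) (W.obj.map a ≫ f' q) (w a)
      map_id p := (sq p).hom_ext (by simp) (by simp)
      map_comp {p q r} a b := (sq p).hom_ext (by simp) (by simp) }
  let H : Y.obj ⟶ F := { app := h', naturality := fun p q a => ((sq p).inl_desc _ _ (w a)).symm }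
  let G : W.obj ⟶ F := { app := f', naturality := fun p q a => ((sq p).inr_desc _ _ (w a)).symm }
  let K : F ⟶ Z.obj :=
    { app := c
      naturality p q a := (sq p).hom_ext (by simp [F, hc₁, reassoc_of% hc₁ p])
        (by simp [F, hc₂, reassoc_of% hc₂ p]) }
  -- The componentwise pushout is admissible as an extension of `Z` by `W`.
  let P' : AdmFun E := ⟨F, IsAdmissible.of_extension hE G K hc W.property Z.property⟩
  refine ⟨P', ObjectProperty.homMk H, ObjectProperty.homMk G, ObjectProperty.homMk K, ?_, hc, sq⟩
  have w' : f ≫ (ObjectProperty.homMk H : Y ⟶ P') = t ≫ ObjectProperty.homMk G := by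
    ext p
    exact (sq p).w
  have ws : ∀ (s : PushoutCocone f t) (p : Pairs), f.hom.app p ≫ s.inl.hom.app p =
      t.hom.app p ≫ s.inr.hom.app p :=
    fun s p => congrArg (fun t : X ⟶ _ => t.hom.app p) s.condition
  let D (s : PushoutCocone f t) : F ⟶ s.pt.obj :=
    { app p := (sq p).desc (s.inl.hom.app p) (s.inr.hom.app p) (ws s p)
      naturality p q a := (sq p).hom_ext (by simp [F]) (by simp [F]) }
  refine ⟨⟨w'⟩, ⟨PushoutCocone.IsColimit.mk _ (fun s => ObjectProperty.homMk (D s)) (fun s => ?_)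
    (fun s => ?_) (fun s m h₁ h₂ => ?_)⟩⟩
  · ext p
    exact (sq p).inl_desc _ _ _
  · ext p
    exact (sq p).inr_desc _ _ _
  · ext p
    refine (sq p).hom_ext ?_ ?_
    · refine Eq.trans ?_ ((sq p).inl_desc _ _ _).symm
      exact congrArg (fun t : Y ⟶ _ => t.hom.app p) h₁
    · refine Eq.trans ?_ ((sq p).inr_desc _ _ _).symm
      exact congrArg (fun t : W ⟶ _ => t.hom.app p) h₂

/-- Admissible monomorphisms of admissible functors can be composed. -/
lemma admMono_comp {Z' W : AdmFun E} {g' : Y ⟶ Z'} {d : Z' ⟶ W} (h' : levelSeq E g' d) :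
    IsAdmMono (levelSeq E) (f ≫ g') := by
  -- The cokernel of `f ≫ g'` has to be an admissible functor; it is obtained by pushing `g'` out
  -- along `g`.
  obtain ⟨P, q, r, -, -, -, sq⟩ := h'.exists_pushout hE g
  refine ⟨P, q, fun p => ?_⟩
  have hE' := hE.isQuillenExact
  have := hE'.epi (h p)
  have : Epi (q.hom.app p) := ⟨fun a b e => (sq p).hom_ext e (by
    rw [← cancel_epi (g.hom.app p), ← (sq p).w_assoc, e, (sq p).w_assoc])⟩
  refine hE'.of_isCokernel (hE.admMono_comp _ _ ⟨_, _, h p⟩ ⟨_, _, h' p⟩) ?_ fun V v hv => ?_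
  · change (f.hom.app p ≫ g'.hom.app p) ≫ _ = 0
    rw [Category.assoc, (sq p).w, ← Category.assoc, hE.comp_zero _ _ (h p), zero_comp]
  · obtain ⟨w, hw⟩ := hE'.exists_desc (h p) (g'.hom.app p ≫ v)
      ((Category.assoc _ _ _).symm.trans hv)
    exact ⟨(sq p).desc v w hw.symm, (sq p).inl_desc _ _ _⟩

omit h

end levelSeq

lemma isAdmissible_of_isZero {X : Pairs ⥤ A} (hX : ∀ p, IsZero (X.obj p)) :
    IsAdmissible E X := fun i j k hij _ =>
  hE.of_iso _ _ _ _ (Iso.refl _) (Iso.refl _) ((hX _).iso (hX _)) ((hX _).eq_of_src _ _)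
    ((hX _).eq_of_src _ _) (hE.of_isZero_left (hX (pr i j hij)) (Y := X.obj (pr i k _)) 0)

lemma hasZeroObject_admFun [HasZeroObject A] : HasZeroObject (AdmFun E) :=
  ⟨⟨(0 : Pairs ⥤ A), isAdmissible_of_isZero hE fun p => (isZero_zero _).obj p⟩,
    IsZero.of_full_of_faithful_of_isZero (IsAdmissible E).ι _ (isZero_zero _)⟩

/-- The direct sum of admissible functors. -/
lemma exists_bicone [HasFiniteBiproducts A] (X Y : AdmFun E) :
    ∃ b : BinaryBicone X Y, Nonempty b.IsBilimit ∧ levelSeq E b.inl b.snd := by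
  have : HasFiniteBiproducts (Pairs ⥤ A) := HasFiniteBiproducts.of_hasFiniteProducts
  have := hasBinaryBiproducts_of_finite_biproducts (Pairs ⥤ A)
  have h : ∀ p, E ((biprod.inl : X.obj ⟶ X.obj ⊞ Y.obj).app p)
      ((biprod.snd : X.obj ⊞ Y.obj ⟶ Y.obj).app p) := fun p => by
    have e : ∀ {U V : Pairs ⥤ A} {f g : U ⟶ V}, f = g → f.app p = g.app p :=
      fun e => congrArg (fun t => t.app p) e
    let b : BinaryBicone (X.obj.obj p) (Y.obj.obj p) :=
      { pt := (X.obj ⊞ Y.obj).obj p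
        fst := (biprod.fst : X.obj ⊞ Y.obj ⟶ _).app p
        snd := (biprod.snd : X.obj ⊞ Y.obj ⟶ _).app p
        inl := (biprod.inl : _ ⟶ X.obj ⊞ Y.obj).app p
        inr := (biprod.inr : _ ⟶ X.obj ⊞ Y.obj).app p
        inl_fst := e biprod.inl_fst
        inl_snd := e biprod.inl_snd
        inr_fst := e biprod.inr_fst
        inr_snd := e biprod.inr_snd }
    exact hE.split b (isBinaryBilimitOfTotal b (e biprod.total))
  let b : BinaryBicone X Y :=
    { pt := ⟨X.obj ⊞ Y.obj, IsAdmissible.of_extension hE _ _ h X.property Y.property⟩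
      fst := ObjectProperty.homMk biprod.fst
      snd := ObjectProperty.homMk biprod.snd
      inl := ObjectProperty.homMk biprod.inl
      inr := ObjectProperty.homMk biprod.inr
      inl_fst := by ext1; exact biprod.inl_fst
      inl_snd := by ext1; exact biprod.inl_snd
      inr_fst := by ext1; exact biprod.inr_fst
      inr_snd := by ext1; exact biprod.inr_snd }
  exact ⟨b, ⟨isBinaryBilimitOfTotal b (by ext1; exact biprod.total)⟩, h⟩

end Level

end AdmFun

/-! ### Transport of pushouts, kernels and cokernels to the localization. -/

/-- A localization at the class of a reindexing preserves pushouts. -/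
lemma Reindexing.map_isPushout {C : Type u} [Category.{v} C] (R : Reindexing C) {D : Type*}
    [Category D] (L : C ⥤ D) [L.IsLocalization R.W] {X Y W P : C} {f : X ⟶ Y} {t : X ⟶ W}
    {h : Y ⟶ P} {k : W ⟶ P} (sq : IsPushout f t h k) :
    IsPushout (L.map f) (L.map t) (L.map h) (L.map k) := by
  have := Localization.essSurj L R.W
  -- Both legs are represented over one reindexing of `T`; a second reindexing makes them agree on
  -- `X`, and the pushout in `C` applies.
  have hd : ∀ (T : C) (a : L.obj Y ⟶ L.obj T) (b : L.obj W ⟶ L.obj T),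
      L.map f ≫ a = L.map t ≫ b → ∃ l, L.map h ≫ l = a ∧ L.map k ≫ l = b := by
    intro T a b e
    obtain ⟨φ, a', b', ha, hb⟩ := R.exists_map₂ L a b
    have e' : L.map (f ≫ a') = L.map (t ≫ b') := by
      rw [Functor.map_comp, Functor.map_comp, ha, hb, reassoc_of% e]
    obtain ⟨ψ, hψ⟩ := (R.map_eq_iff L _ _).1 e'
    rw [Category.assoc, Category.assoc] at hψ
    refine ⟨L.map (sq.desc _ _ hψ) ≫ inv (L.map ((R.η ψ).app _)) ≫
      inv (L.map ((R.η φ).app _)), ?_, ?_⟩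
    · rw [← Functor.map_comp_assoc, sq.inl_desc, Functor.map_comp, ha]
      simp
    · rw [← Functor.map_comp_assoc, sq.inr_desc, Functor.map_comp, hb]
      simp
  have hu : ∀ (T : C) (a b : L.obj P ⟶ L.obj T),
      L.map h ≫ a = L.map h ≫ b → L.map k ≫ a = L.map k ≫ b → a = b := by
    intro T a b e₁ e₂
    obtain ⟨φ, a', b', ha, hb⟩ := R.exists_map₂ L a b
    rw [← cancel_mono (L.map ((R.η φ).app T)), ← ha, ← hb]
    -- Agreement on `Y` and on `W` costs one reindexing each, `ψ` and then `χ`.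
    obtain ⟨ψ, hψ⟩ := (R.map_eq_iff L (h ≫ a') (h ≫ b')).1 (by
      rw [Functor.map_comp, Functor.map_comp, ha, hb, reassoc_of% e₁])
    obtain ⟨χ, hχ⟩ := (R.map_eq_iff L (k ≫ a' ≫ (R.η ψ).app _) (k ≫ b' ≫ (R.η ψ).app _)).1 (by
      simp only [Functor.map_comp, ha, hb, Category.assoc, reassoc_of% e₂])
    have e : a' ≫ (R.η ψ).app _ ≫ (R.η χ).app _ = b' ≫ (R.η ψ).app _ ≫ (R.η χ).app _ :=
      sq.hom_ext (by simpa using hψ =≫ (R.η χ).app _) (by simpa using hχ)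
    rw [← cancel_mono (L.map ((R.η ψ).app ((R.T φ).obj T))), ← Functor.map_comp, ← Functor.map_comp,
      R.map_eq_iff]
    exact ⟨χ, by simpa using e⟩
  refine ⟨⟨by rw [← Functor.map_comp, sq.w, Functor.map_comp]⟩, ⟨?_⟩⟩
  have hs : ∀ s : PushoutCocone (L.map f) (L.map t), ∃ l : L.obj P ⟶ s.pt,
      L.map h ≫ l = s.inl ∧ L.map k ≫ l = s.inr := by
    intro s
    let i := L.objObjPreimageIso s.pt
    obtain ⟨l, h₁, h₂⟩ := hd (L.objPreimage s.pt) (s.inl ≫ i.inv) (s.inr ≫ i.inv)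
      (by rw [reassoc_of% s.condition])
    exact ⟨l ≫ i.hom, by rw [reassoc_of% h₁]; simp, by rw [reassoc_of% h₂]; simp⟩
  choose l h₁ h₂ using hs
  refine PushoutCocone.IsColimit.mk _ l h₁ h₂ fun s m e₁ e₂ => ?_
  rw [← cancel_mono (L.objObjPreimageIso s.pt).inv]
  exact hu _ _ _ (by rw [reassoc_of% e₁, reassoc_of% h₁]) (by rw [reassoc_of% e₂, reassoc_of% h₂])

namespace Reindexing

variable {C : Type u} [Category.{v} C] (R : Reindexing C) {D : Type*} [Category D] (L : C ⥤ D)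

lemma map_η_naturality {X Y : C} (φ : R.ι) (f : X ⟶ Y) :
    L.map ((R.η φ).app X) ≫ L.map ((R.T φ).map f) = L.map f ≫ L.map ((R.η φ).app Y) := by
  rw [← Functor.map_comp, η_naturality, Functor.map_comp]

variable [L.IsLocalization R.W]

lemma exists_map_from {T : D} {Y : C} (f : T ⟶ L.obj Y) :
    ∃ (X : C) (e : L.obj X ≅ T) (φ : R.ι) (a : X ⟶ (R.T φ).obj Y),
      L.map a = e.hom ≫ f ≫ L.map ((R.η φ).app Y) := by
  have := Localization.essSurj L R.W
  obtain ⟨φ, a, ha⟩ := R.exists_map L ((L.objObjPreimageIso T).hom ≫ f)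
  exact ⟨_, _, φ, a, by rw [ha, Category.assoc]⟩

lemma exists_map_to {T : D} {X : C} (f : L.obj X ⟶ T) :
    ∃ (Y : C) (e : T ≅ L.obj Y) (φ : R.ι) (a : X ⟶ (R.T φ).obj Y),
      L.map a = f ≫ e.hom ≫ L.map ((R.η φ).app Y) := by
  have := Localization.essSurj L R.W
  obtain ⟨φ, a, ha⟩ := R.exists_map L (f ≫ (L.objObjPreimageIso T).inv)
  exact ⟨_, (L.objObjPreimageIso T).symm, φ, a, by rw [ha, Category.assoc]; rfl⟩

variable [Preadditive C] [Preadditive D] [L.Additive]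

lemma map_eq_zero_iff {X Y : C} (a : X ⟶ Y) : L.map a = 0 ↔ ∃ φ, a ≫ (R.η φ).app Y = 0 := by
  simpa using R.map_eq_iff L a 0

include R

/-- A map into `L X` is represented by `a : W ⟶ T φ X`, and the vanishing of `L (a ≫ T φ f)` costs a
further `η ψ`. Naturality moves both reindexings onto `f`, which is why it must remain a
monomorphism after two of them. -/
lemma mono_map {X Y : C} {f : X ⟶ Y} (hf : ∀ φ ψ, Mono ((R.T ψ).map ((R.T φ).map f))) :
    Mono (L.map f) := by
  refine Preadditive.mono_of_cancel_zero _ fun {T} b hb => ?_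
  obtain ⟨W, e, φ, a, ha⟩ := R.exists_map_from L b
  obtain ⟨ψ, hψ⟩ := (R.map_eq_zero_iff L (a ≫ (R.T φ).map f)).1 (by
    rw [Functor.map_comp, ha, Category.assoc, Category.assoc, map_η_naturality, reassoc_of% hb]
    simp)
  have h₀ : L.map a = 0 := (R.map_eq_zero_iff L a).2 ⟨ψ, by
    have := hf φ ψ
    rw [← cancel_mono ((R.T ψ).map ((R.T φ).map f)), Category.assoc, η_naturality,
      ← Category.assoc, hψ, zero_comp]⟩
  rw [← cancel_epi e.hom, ← cancel_mono (L.map ((R.η φ).app X)), Category.assoc, ← ha, h₀]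
  simp

/-- A map out of `L Z` is represented by reindexing its target only, so nothing is asked of the
reindexings of `g`. -/
lemma epi_map {Y Z : C} (g : Y ⟶ Z) [Epi g] : Epi (L.map g) := by
  refine Preadditive.epi_of_cancel_zero _ fun {T} b hb => ?_
  obtain ⟨W, e, φ, a, ha⟩ := R.exists_map_to L b
  obtain ⟨ψ, hψ⟩ := (R.map_eq_zero_iff L (g ≫ a)).1 (by
    rw [Functor.map_comp, ha, reassoc_of% hb, zero_comp])
  have h₀ : L.map a = 0 := (R.map_eq_zero_iff L a).2 ⟨ψ, by
    rw [← cancel_epi g, ← Category.assoc, hψ, Limits.comp_zero]⟩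
  rw [← cancel_mono e.hom, ← cancel_mono (L.map ((R.η φ).app W)), Category.assoc, ← ha, h₀]
  simp

/-- As for `mono_map`, the lift is found after two reindexings; it is brought back by inverting `η
φ` and `η ψ`. -/
lemma exists_lift_map {X Y Z : C} {f : X ⟶ Y} {g : Y ⟶ Z}
    (h : ∀ φ ψ (W : C) (k : W ⟶ (R.T ψ).obj ((R.T φ).obj Y)), k ≫ (R.T ψ).map ((R.T φ).map g) = 0 →
      ∃ l, l ≫ (R.T ψ).map ((R.T φ).map f) = k) {T : D} (k : T ⟶ L.obj Y) (hk : k ≫ L.map g = 0) :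
    ∃ l, l ≫ L.map f = k := by
  obtain ⟨W, e, φ, a, ha⟩ := R.exists_map_from L k
  obtain ⟨ψ, hψ⟩ := (R.map_eq_zero_iff L (a ≫ (R.T φ).map g)).1 (by
    rw [Functor.map_comp, ha, Category.assoc, Category.assoc, map_η_naturality, reassoc_of% hk]
    simp)
  obtain ⟨l, hl⟩ := h φ ψ _ (a ≫ (R.η ψ).app _) (by
    rw [Category.assoc, η_naturality, ← Category.assoc, hψ])
  have hl' := congrArg L.map hl
  rw [Functor.map_comp, Functor.map_comp, ha] at hl'
  refine ⟨e.inv ≫ L.map l ≫ inv (L.map ((R.η ψ).app _)) ≫ inv (L.map ((R.η φ).app _)), ?_⟩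
  have e₁ := R.map_η_naturality L φ f
  have e₂ := R.map_η_naturality L ψ ((R.T φ).map f)
  simp only [Category.assoc]
  rw [← cancel_mono (L.map ((R.η φ).app Y)), ← cancel_mono (L.map ((R.η ψ).app _)),
    ← cancel_epi e.hom]
  simp only [Category.assoc, Iso.hom_inv_id_assoc] at hl' ⊢
  rw [← hl', ← reassoc_of% e₁, ← e₂]
  simp

lemma exists_desc_map {X Y Z : C} {f : X ⟶ Y} {g : Y ⟶ Z}
    (h : ∀ (W : C) (k : Y ⟶ W), f ≫ k = 0 → ∃ l, g ≫ l = k) {T : D} (k : L.obj Y ⟶ T)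
    (hk : L.map f ≫ k = 0) : ∃ l, L.map g ≫ l = k := by
  obtain ⟨W, e, φ, a, ha⟩ := R.exists_map_to L k
  obtain ⟨ψ, hψ⟩ := (R.map_eq_zero_iff L (f ≫ a)).1 (by
    rw [Functor.map_comp, ha, reassoc_of% hk, zero_comp])
  obtain ⟨l, hl⟩ := h _ (a ≫ (R.η ψ).app _) (by rw [← Category.assoc, hψ])
  refine ⟨L.map l ≫ inv (L.map ((R.η ψ).app _)) ≫ inv (L.map ((R.η φ).app _)) ≫ e.inv, ?_⟩
  rw [← Functor.map_comp_assoc, hl, Functor.map_comp, ha]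
  simp

end Reindexing

/-! ### The Beilinson category: kernels, cokernels, and the axioms for admissible monomorphisms. -/

section

variable {A : Type u} [Category.{v} A] {E : SeqClass A}

lemma beilinsonSeq.of_iso {X Y Z X' Y' Z' : Beilinson E} {f : X ⟶ Y} {g : Y ⟶ Z} {f' : X' ⟶ Y'}
    {g' : Y' ⟶ Z'} (a : X ≅ X') (b : Y ≅ Y') (c : Z ≅ Z') (h₁ : f ≫ b.hom = a.hom ≫ f')
    (h₂ : g ≫ c.hom = b.hom ≫ g') (h : beilinsonSeq E f g) : beilinsonSeq E f' g' := by
  obtain ⟨U, V, W, i, p, a', b', c', hip, e₁, e₂⟩ := h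
  refine ⟨U, V, W, i, p, a.symm ≪≫ a', b.symm ≪≫ b', c.symm ≪≫ c', hip, ?_, ?_⟩
  · rw [← cancel_epi a.hom]
    simp [← reassoc_of% h₁, e₁]
  · rw [← cancel_epi b.hom]
    simp [← reassoc_of% h₂, e₂]

lemma levelSeq.beilinsonSeq {X Y Z : AdmFun E} {f : X ⟶ Y} {g : Y ⟶ Z} (h : levelSeq E f g) :
    beilinsonSeq E ((toBeilinson E).map f) ((toBeilinson E).map g) :=
  ⟨X, Y, Z, f, g, Iso.refl _, Iso.refl _, Iso.refl _, h, by simp, by simp⟩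

lemma levelSeq.map_T {X Y Z : AdmFun E} {f : X ⟶ Y} {g : Y ⟶ Z} (h : levelSeq E f g)
    (φ : (admReindexing E).ι) :
    levelSeq E (((admReindexing E).T φ).map f) (((admReindexing E).T φ).map g) :=
  fun _ => h _

lemma IsAdmMono.of_iso_beilinson {X Y X' Y' : Beilinson E} {f : X ⟶ Y} {f' : X' ⟶ Y'}
    (a : X ≅ X') (b : Y ≅ Y') (h₁ : f ≫ b.hom = a.hom ≫ f')
    (h : IsAdmMono (beilinsonSeq E) f) : IsAdmMono (beilinsonSeq E) f' := by
  obtain ⟨Z, g, h⟩ := h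
  exact ⟨Z, b.inv ≫ g, h.of_iso a b (Iso.refl _) h₁ (by simp)⟩

end

section

variable {A : Type u} [Category.{v} A] [Preadditive A] {E : SeqClass A}

instance : Preadditive (Beilinson E) :=
  Localization.preadditive (toBeilinson E) (admReindexing E).W

instance : (toBeilinson E).Additive :=
  Localization.functor_additive (toBeilinson E) (admReindexing E).W

instance : (toBeilinson E).EssSurj :=
  Localization.essSurj (toBeilinson E) (admReindexing E).W

variable (hE : IsExactStructure E)

section

variable {X Y Z : AdmFun E} {f : X ⟶ Y} {g : Y ⟶ Z} (h : levelSeq E f g)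

include hE h

lemma levelSeq.mono_map : Mono ((toBeilinson E).map f) :=
  (admReindexing E).mono_map _ fun φ ψ => ((h.map_T φ).map_T ψ).mono hE

lemma levelSeq.epi_map : Epi ((toBeilinson E).map g) :=
  have := h.epi hE
  (admReindexing E).epi_map _ g

lemma levelSeq.exists_lift_map {T : Beilinson E} (k : T ⟶ (toBeilinson E).obj Y)
    (hk : k ≫ (toBeilinson E).map g = 0) : ∃ l, l ≫ (toBeilinson E).map f = k :=
  (admReindexing E).exists_lift_map _ (fun φ ψ _ k hk => ((h.map_T φ).map_T ψ).exists_lift hE k hk)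
    k hk

lemma levelSeq.exists_desc_map {T : Beilinson E} (k : (toBeilinson E).obj Y ⟶ T)
    (hk : (toBeilinson E).map f ≫ k = 0) : ∃ l, (toBeilinson E).map g ≫ l = k :=
  (admReindexing E).exists_desc_map _ (fun _ k hk => h.exists_desc hE k hk) k hk

end

namespace beilinsonSeq

include hE

lemma comp_zero {X Y Z : Beilinson E} {f : X ⟶ Y} {g : Y ⟶ Z} (h : beilinsonSeq E f g) :
    f ≫ g = 0 := by
  obtain ⟨U, V, W, i, p, a, b, c, hip, e₁, e₂⟩ := h
  rw [← cancel_mono c.hom, Category.assoc, e₂, reassoc_of% e₁, ← Functor.map_comp,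
    levelSeq.comp_zero hE hip]
  simp

lemma isKernel {X Y Z : Beilinson E} {f : X ⟶ Y} {g : Y ⟶ Z} (h : beilinsonSeq E f g)
    (w : f ≫ g = 0) : Nonempty (IsLimit (KernelFork.ofι f w)) := by
  obtain ⟨U, V, W, i, p, a, b, c, hip, e₁, e₂⟩ := h
  have := levelSeq.mono_map hE hip
  have : Mono f := by
    have : Mono (f ≫ b.hom) := by rw [e₁]; infer_instance
    exact mono_of_mono f b.hom
  have key : ∀ {T : Beilinson E} (k : T ⟶ Y) (_ : k ≫ g = 0), ∃ l, l ≫ f = k := by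
    intro T k hk
    obtain ⟨l, hl⟩ := levelSeq.exists_lift_map hE hip (k ≫ b.hom)
      (by rw [Category.assoc, ← e₂, reassoc_of% hk, zero_comp])
    exact ⟨l ≫ a.inv, by rw [← cancel_mono b.hom]; simp [e₁, hl]⟩
  exact ⟨KernelFork.IsLimit.ofι' f w fun k hk => ⟨_, (key k hk).choose_spec⟩⟩

lemma isCokernel {X Y Z : Beilinson E} {f : X ⟶ Y} {g : Y ⟶ Z} (h : beilinsonSeq E f g)
    (w : f ≫ g = 0) : Nonempty (IsColimit (CokernelCofork.ofπ g w)) := by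
  obtain ⟨U, V, W, i, p, a, b, c, hip, e₁, e₂⟩ := h
  have := levelSeq.epi_map hE hip
  have : Epi g := by
    have : Epi (g ≫ c.hom) := by rw [e₂]; infer_instance
    have e : g = (g ≫ c.hom) ≫ c.inv := by simp
    rw [e]
    infer_instance
  have key : ∀ {T : Beilinson E} (k : Y ⟶ T) (_ : f ≫ k = 0), ∃ l, g ≫ l = k := by
    intro T k hk
    obtain ⟨l, hl⟩ := levelSeq.exists_desc_map hE hip (b.inv ≫ k)
      (by rw [← cancel_epi a.hom, ← reassoc_of% e₁]; simp [hk])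
    exact ⟨c.hom ≫ l, by rw [reassoc_of% e₂, hl]; simp⟩
  exact ⟨CokernelCofork.IsColimit.ofπ' g w fun k hk => ⟨_, (key k hk).choose_spec⟩⟩

/-- Admissible monomorphisms of the Beilinson category have pushouts. -/
lemma pushout {X Y W : Beilinson E} (f : X ⟶ Y) (h : X ⟶ W)
    (hf : IsAdmMono (beilinsonSeq E) f) :
    ∃ (P : Beilinson E) (h' : Y ⟶ P) (f' : W ⟶ P), IsPushout f h h' f' ∧
      IsAdmMono (beilinsonSeq E) f' := by
  obtain ⟨Z, g, U, V, Z', i, p, a, b, c, hip, e₁, e₂⟩ := hf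
  let w := (toBeilinson E).objObjPreimageIso W
  -- `h` is realized by a map `t` of admissible functors into a reindexing of a preimage of `W`,
  -- which is still a model of `W`.
  obtain ⟨φ, t, ht⟩ := (admReindexing E).exists_map _ (a.inv ≫ h ≫ w.inv)
  obtain ⟨P, h', f', c', sq, hc', -⟩ := levelSeq.exists_pushout hE hip t
  let e : W ≅ (toBeilinson E).obj (((admReindexing E).T φ).obj ((toBeilinson E).objPreimage W)) :=
    w.symm ≪≫ asIso ((toBeilinson E).map
      (((admReindexing E).η φ).app ((toBeilinson E).objPreimage W)))
  refine ⟨(toBeilinson E).obj P, b.hom ≫ (toBeilinson E).map h',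
    e.hom ≫ (toBeilinson E).map f', ?_, ?_⟩
  · refine ((admReindexing E).map_isPushout (toBeilinson E) sq).of_iso a.symm b.symm e.symm
      (Iso.refl _) ?_ ?_ ?_ ?_
    · rw [← cancel_epi a.hom, ← cancel_mono b.hom]
      simp [e₁]
    · rw [← cancel_mono e.hom]
      simp [ht, e]
    · simp
    · simp
  · exact IsAdmMono.of_iso_beilinson e.symm (Iso.refl _) (by simp) ⟨_, _, hc'.beilinsonSeq⟩

/-- Admissible monomorphisms of the Beilinson category can be composed. -/
lemma admMono_comp {X Y Z : Beilinson E} (f : X ⟶ Y) (g : Y ⟶ Z)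
    (hf : IsAdmMono (beilinsonSeq E) f) (hg : IsAdmMono (beilinsonSeq E) g) :
    IsAdmMono (beilinsonSeq E) (f ≫ g) := by
  obtain ⟨-, -, U, V, _, i, p, a, b, -, hip, e₁, -⟩ := hf
  obtain ⟨-, -, V', W, _, j, q, b', c, -, hjq, e₂, -⟩ := hg
  -- The two sequences may use different models `V` and `V'` of `Y`. Their comparison is realized by
  -- `t : V' ⟶ T φ V`, and pushing `j` out along `t` gives an isomorphic monomorphism that starts at
  -- `T φ V` and can be composed with `T φ i`.
  obtain ⟨φ, t, ht⟩ := (admReindexing E).exists_map (toBeilinson E) (b'.inv ≫ b.hom)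
  obtain ⟨P, k, j', c', sq, hc', -⟩ := levelSeq.exists_pushout hE hjq t
  have : IsIso ((toBeilinson E).map t) := by rw [ht]; infer_instance
  have hk : IsIso ((toBeilinson E).map k) :=
    ((admReindexing E).map_isPushout (toBeilinson E) sq).flip.isIso_inr_of_isIso
  obtain ⟨Q, r, hr⟩ := levelSeq.admMono_comp hE (levelSeq.map_T hip φ) hc'
  have e₃ := congrArg (toBeilinson E).map sq.w
  simp only [Functor.map_comp] at e₃
  refine IsAdmMono.of_iso_beilinson
    (a ≪≫ asIso ((toBeilinson E).map (((admReindexing E).η φ).app _))).symm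
    (c ≪≫ asIso ((toBeilinson E).map k)).symm ?_ ⟨_, _, hr.beilinsonSeq⟩
  rw [← cancel_epi (a ≪≫ asIso ((toBeilinson E).map (((admReindexing E).η φ).app _))).hom,
    ← cancel_mono (c ≪≫ asIso ((toBeilinson E).map k)).hom]
  have e₄ : (toBeilinson E).map (((admReindexing E).η φ).app U) ≫
      (toBeilinson E).map (((admReindexing E).T φ).map i) =
      (toBeilinson E).map i ≫ (toBeilinson E).map (((admReindexing E).η φ).app V) := by
    rw [← Functor.map_comp, Reindexing.η_naturality, Functor.map_comp]
  simp [reassoc_of% e₄, ← reassoc_of% e₁, reassoc_of% e₂, e₃, ht]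

/-- The split sequences of the Beilinson category are admissible. -/
lemma split [HasFiniteBiproducts A] {X Z : Beilinson E} (b : BinaryBicone X Z)
    (hb : b.IsBilimit) : beilinsonSeq E b.inl b.snd := by
  let i := (toBeilinson E).objObjPreimageIso X
  let j := (toBeilinson E).objObjPreimageIso Z
  obtain ⟨b', ⟨hb'⟩, h⟩ := exists_bicone hE ((toBeilinson E).objPreimage X)
    ((toBeilinson E).objPreimage Z)
  have t' := congrArg (toBeilinson E).map (IsBilimit.binary_total hb')
  have t := IsBilimit.binary_total hb
  have h₁ := congrArg (toBeilinson E).map b'.inl_fst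
  have h₂ := congrArg (toBeilinson E).map b'.inl_snd
  have h₃ := congrArg (toBeilinson E).map b'.inr_fst
  have h₄ := congrArg (toBeilinson E).map b'.inr_snd
  simp only [Functor.map_add, Functor.map_comp, Functor.map_zero] at t' h₁ h₂ h₃ h₄
  -- `b` and the image of the componentwise direct sum are biproducts of the same two objects, up to
  -- `i` and `j`.
  let e : (toBeilinson E).obj b'.pt ≅ b.pt :=
    { hom := (toBeilinson E).map b'.fst ≫ i.hom ≫ b.inl + (toBeilinson E).map b'.snd ≫ j.hom ≫ b.inr
      inv := b.fst ≫ i.inv ≫ (toBeilinson E).map b'.inl + b.snd ≫ j.inv ≫ (toBeilinson E).map b'.inr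
      hom_inv_id := by simpa using t'.trans ((toBeilinson E).map_id _)
      inv_hom_id := by
        simp [← t, reassoc_of% h₁, reassoc_of% h₂, reassoc_of% h₃, reassoc_of% h₄] }
  refine h.beilinsonSeq.of_iso i e j ?_ ?_
  · simp [e, reassoc_of% h₁, reassoc_of% h₂]
  · simp [e]

end beilinsonSeq

lemma hasFiniteBiproducts_beilinson [HasFiniteBiproducts A] (hE : IsExactStructure E) :
    HasFiniteBiproducts (Beilinson E) := by
  have := hasZeroObject_admFun hE
  have : HasZeroObject (Beilinson E) := (toBeilinson E).hasZeroObject_of_additive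
  have : HasBinaryBiproducts (Beilinson E) := ⟨fun X Z => by
    let i := (toBeilinson E).objObjPreimageIso X
    let j := (toBeilinson E).objObjPreimageIso Z
    obtain ⟨b', ⟨hb'⟩, -⟩ := exists_bicone hE ((toBeilinson E).objPreimage X)
      ((toBeilinson E).objPreimage Z)
    have t' := congrArg (toBeilinson E).map (IsBilimit.binary_total hb')
    have h₁ := congrArg (toBeilinson E).map b'.inl_fst
    have h₂ := congrArg (toBeilinson E).map b'.inl_snd
    have h₃ := congrArg (toBeilinson E).map b'.inr_fst
    have h₄ := congrArg (toBeilinson E).map b'.inr_snd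
    simp only [Functor.map_add, Functor.map_comp, Functor.map_zero]
      at t' h₁ h₂ h₃ h₄
    let b : BinaryBicone X Z :=
      { pt := (toBeilinson E).obj b'.pt
        fst := (toBeilinson E).map b'.fst ≫ i.hom
        snd := (toBeilinson E).map b'.snd ≫ j.hom
        inl := i.inv ≫ (toBeilinson E).map b'.inl
        inr := j.inv ≫ (toBeilinson E).map b'.inr
        inl_fst := by simp [reassoc_of% h₁]
        inl_snd := by simp [reassoc_of% h₂]
        inr_fst := by simp [reassoc_of% h₃]
        inr_snd := by simp [reassoc_of% h₄] }
    exact HasBinaryBiproduct.mk ⟨b, isBinaryBilimitOfTotal b (by simp [b, t'])⟩⟩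
  have : HasFiniteProducts (Beilinson E) := hasFiniteProducts_of_has_binary_and_terminal
  exact HasFiniteBiproducts.of_hasFiniteProducts

end

/-! ### The duality `(i, j) ↦ (-j, -i)`. -/

section Duality

variable {A : Type u} [Category.{v} A] {E : SeqClass A}

/-- The involution `(i, j) ↦ (-j, -i)` of `Π`. -/
def Pairs.neg (p : Pairs) : Pairs := (pairsNeg.obj p).unop

lemma Pairs.neg_neg (p : Pairs) : p.neg.neg = p :=
  Subtype.ext (Prod.ext (_root_.neg_neg _) (_root_.neg_neg _))

lemma Pairs.neg_le_neg {p q : Pairs} (h : p ≤ q) : q.neg ≤ p.neg := leOfHom (pairsNeg.map h.hom).unop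

/-- The map of `Π` given by an equality. -/
abbrev Pairs.eqHom {p q : Pairs} (h : p = q) : p ⟶ q := homOfLE h.le

lemma isIso_map_eqHom {B : Type*} [Category B] (X : Pairs ⥤ B) {p q : Pairs} (h : p = q) :
    IsIso (X.map (Pairs.eqHom h)) :=
  ⟨X.map (Pairs.eqHom h.symm), by rw [← X.map_comp]; exact X.map_id _,
    by rw [← X.map_comp]; exact X.map_id _⟩

lemma map_comp_eq {B : Type*} [Category B] (X : Pairs ⥤ B) {p q q' r : Pairs} (a : p ⟶ q)
    (b : q ⟶ r) (a' : p ⟶ q') (b' : q' ⟶ r) : X.map a ≫ X.map b = X.map a' ≫ X.map b' := by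
  rw [← X.map_comp, ← X.map_comp]; rfl

lemma unop_map_comp_eq {B : Type*} [Category B] (X : Pairs ⥤ Bᵒᵖ) {p q q' r : Pairs} (a : p ⟶ q)
    (b : q ⟶ r) (a' : p ⟶ q') (b' : q' ⟶ r) :
    (X.map b).unop ≫ (X.map a).unop = (X.map b').unop ≫ (X.map a').unop := by
  rw [← unop_comp, ← unop_comp, map_comp_eq X a b a' b']

instance : (dualize E).Faithful where
  map_injective {X Y f g} h := by
    apply Quiver.Hom.unop_inj
    ext q
    rw [← q.neg_neg]
    exact Quiver.Hom.unop_inj (congrArg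
      (fun t : (dualize E).obj X ⟶ (dualize E).obj Y => t.hom.app q.neg) h)

instance : (dualize E).Full where
  map_surjective {X Y} g := by
    -- `q.neg.neg` and `q` are only provably equal, so the preimage is built from components at
    -- `q.neg.neg`, moved along `Pairs.eqHom`.
    let γ : ∀ q : Pairs, Y.unop.obj.obj q.neg.neg ⟶ X.unop.obj.obj q.neg.neg :=
      fun q => (g.hom.app q.neg).op
    have hγ : ∀ {p q : Pairs} (a : p.neg.neg ⟶ q.neg.neg),
        Y.unop.obj.map a ≫ γ q = γ p ≫ X.unop.obj.map a := fun {p q} a =>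
      (congrArg Quiver.Hom.op (g.hom.naturality (show q.neg ⟶ p.neg from
        homOfLE (by rw [← p.neg.neg_neg, ← q.neg.neg_neg]; exact Pairs.neg_le_neg (leOfHom a))))).symm
    let F : Y.unop.obj ⟶ X.unop.obj :=
      { app q := Y.unop.obj.map (Pairs.eqHom q.neg_neg.symm) ≫ γ q ≫
          X.unop.obj.map (Pairs.eqHom q.neg_neg)
        naturality p q a := by
          have e : p.neg.neg ⟶ q.neg.neg := homOfLE (Pairs.neg_le_neg (Pairs.neg_le_neg (leOfHom a)))
          rw [Category.assoc, Category.assoc, map_comp_eq X.unop.obj (Pairs.eqHom p.neg_neg) a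
            e (Pairs.eqHom q.neg_neg), ← reassoc_of% hγ e, ← Category.assoc, ← Category.assoc,
            map_comp_eq Y.unop.obj a (Pairs.eqHom q.neg_neg.symm) (Pairs.eqHom p.neg_neg.symm) e]
          simp only [Category.assoc] }
    refine ⟨(ObjectProperty.homMk F).op, ?_⟩
    ext p
    let e : p.neg.neg ⟶ p := Pairs.eqHom p.neg_neg
    let s : ((dualize E).obj X).obj.obj p ⟶ ((dualize E).obj X).obj.obj p.neg.neg :=
      (X.unop.obj.map (Pairs.eqHom p.neg.neg_neg)).unop
    have h : s ≫ ((dualize E).obj X).obj.map e = 𝟙 _ :=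
      (congrArg Quiver.Hom.unop (X.unop.obj.map_comp _ _)).symm.trans
        (congrArg Quiver.Hom.unop (X.unop.obj.map_id _))
    change (s ≫ g.hom.app p.neg.neg) ≫ ((dualize E).obj Y).obj.map e = g.hom.app p
    rw [Category.assoc, ← g.hom.naturality e, reassoc_of% h]

instance : (dualize E).EssSurj where
  mem_essImage Y := by
    let X : AdmFun E.op := ⟨pairsNeg ⋙ Y.obj.op, fun i j k hij hjk =>
      Y.property (-k) (-j) (-i) (neg_le_neg hjk) (neg_le_neg hij)⟩
    let i : ((dualize E).obj (op X)).obj ≅ Y.obj := NatIso.ofComponents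
      (fun p => @asIso _ _ _ _ (Y.obj.map (Pairs.eqHom p.neg_neg)) (isIso_map_eqHom _ _))
      fun a => map_comp_eq Y.obj _ _ _ _
    exact ⟨op X, ⟨ObjectProperty.isoMk _ i⟩⟩

instance : (dualize E).IsEquivalence where

/-- The bicofinal map `i ↦ -φ (-i)`. -/
def Bicofinal.neg (φ : Bicofinal) : Bicofinal where
  toFun i := -φ.toFun (-i)
  monotone _ _ h := neg_le_neg (φ.monotone (neg_le_neg h))
  tendsto_top := Filter.tendsto_neg_atBot_atTop.comp
    (φ.tendsto_bot.comp Filter.tendsto_neg_atTop_atBot)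
  tendsto_bot := Filter.tendsto_neg_atTop_atBot.comp
    (φ.tendsto_top.comp Filter.tendsto_neg_atBot_atTop)

/-- Negation reverses inequalities between bicofinal maps. `φ'` and `ψ'` are tied to `φ` and `ψ` by
equations, instead of being `φ.neg` and `ψ.neg`, so that the lemma also applies when `φ` and `ψ` are
the negated maps. -/
lemma dualize_reindexMap (X : AdmFun E.op) {φ ψ φ' ψ' : Bicofinal}
    (hφ : ∀ i, φ'.toFun i = -φ.toFun (-i)) (hψ : ∀ i, ψ'.toFun i = -ψ.toFun (-i))
    (h : ∀ i, φ.toFun i ≤ ψ.toFun i) (h' : ∀ i, ψ'.toFun i ≤ φ'.toFun i) :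
    Nonempty (Arrow.mk ((dualize E).map (X.reindexMap h).op) ≅
      Arrow.mk (((dualize E).obj (op X)).reindexMap h')) := by
  have e : ∀ {θ θ' : Bicofinal} (_ : ∀ i, θ'.toFun i = -θ.toFun (-i)) (p : Pairs),
      (θ'.tilde.obj p).neg = θ.tilde.obj p.neg := fun {θ θ'} hθ p =>
    Subtype.ext (Prod.ext ((congrArg Neg.neg (hθ _)).trans (_root_.neg_neg _))
      ((congrArg Neg.neg (hθ _)).trans (_root_.neg_neg _)))
  have i : ∀ {θ θ' : Bicofinal} (hθ : ∀ i, θ'.toFun i = -θ.toFun (-i)) (p : Pairs),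
      IsIso (X.obj.map (Pairs.eqHom (e hθ p))).unop := fun hθ p =>
    have := isIso_map_eqHom X.obj (e hθ p)
    inferInstance
  let I {θ θ' : Bicofinal} (hθ : ∀ i, θ'.toFun i = -θ.toFun (-i)) :
      (dualize E).obj (op (X.reindex θ)) ≅ ((dualize E).obj (op X)).reindex θ' :=
    ObjectProperty.isoMk _ (NatIso.ofComponents
      (fun p => @asIso _ _ _ _ (X.obj.map (Pairs.eqHom (e hθ p))).unop (i hθ p))
      fun a => unop_map_comp_eq X.obj _ _ _ _)
  refine ⟨Arrow.isoMk (I hψ) (I hφ) ?_⟩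
  ext p
  exact unop_map_comp_eq X.obj _ _ _ _

lemma nonempty_reindexMap_iso {Y Y' : AdmFun E} (e : Y ≅ Y') {φ ψ : Bicofinal}
    (h : ∀ i, φ.toFun i ≤ ψ.toFun i) :
    Nonempty (Arrow.mk (Y.reindexMap h) ≅ Arrow.mk (Y'.reindexMap h)) := by
  refine ⟨Arrow.isoMk ((reindexFunctor E φ).mapIso e) ((reindexFunctor E ψ).mapIso e) ?_⟩
  ext p
  exact (e.hom.hom.naturality _).symm

/-- The equivalence `dualize` matches the two classes of reindexing maps up to isomorphism of
arrows; each direction uses `dualize_reindexMap`. -/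
instance : (dualize E ⋙ toBeilinson E).IsLocalization (reindexMaps E.op).op := by
  refine Functor.IsLocalization.of_equivalence_source (toBeilinson E) (reindexMaps E)
    (dualize E ⋙ toBeilinson E) (reindexMaps E.op).op (dualize E).asEquivalence.symm ?_ ?_
    (Functor.isoWhiskerRight (dualize E).asEquivalence.counitIso (toBeilinson E) ≪≫
      Functor.leftUnitor _)
  · rintro _ _ _ ⟨Y, h⟩
    rename_i φ ψ
    let X := ((dualize E).objPreimage Y).unop
    let e : (dualize E).obj (op X) ≅ Y := (dualize E).objObjPreimageIso Y
    have h' : ∀ i, ψ.neg.toFun i ≤ φ.neg.toFun i := fun i => neg_le_neg (h _)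
    obtain ⟨i₁⟩ := nonempty_reindexMap_iso e h
    obtain ⟨i₂⟩ := dualize_reindexMap X (φ := ψ.neg) (ψ := φ.neg) (φ' := ψ) (ψ' := φ)
      (fun i => by simp [Bicofinal.neg]) (fun i => by simp [Bicofinal.neg]) h' h
    let D := (dualize E).asEquivalence
    let i₃ : Arrow.mk (X.reindexMap h').op ≅
        Arrow.mk (D.inverse.map (D.functor.map (X.reindexMap h').op)) :=
      Arrow.isoMk (D.unitIso.app _) (D.unitIso.app _) (D.unitIso.hom.naturality _).symm
    exact ((reindexMaps E.op).op.isoClosure.arrow_mk_iso_iff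
      (i₃ ≪≫ D.inverse.mapArrow.mapIso (i₂ ≪≫ i₁))).1
        ((reindexMaps E.op).op.le_isoClosure _ (reindexMaps.mk X h'))
  · have key : ∀ {U V : AdmFun E.op} (f : U ⟶ V), reindexMaps E.op f →
        IsIso ((toBeilinson E).map ((dualize E).map f.op)) := by
      rintro _ _ _ ⟨X, h⟩
      rename_i φ ψ
      obtain ⟨i⟩ := dualize_reindexMap X (φ' := φ.neg) (ψ' := ψ.neg) (fun _ => rfl) (fun _ => rfl)
        h (fun i => neg_le_neg (h _))
      exact ((MorphismProperty.isomorphisms _).arrow_mk_iso_iff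
        ((toBeilinson E).mapArrow.mapIso i)).2 (isIso_toBeilinson_reindexMap E _)
    exact fun _ _ f hf => key f.unop hf

variable (E) in
/-- The duality of Beilinson categories. -/
def beilinsonDuality : (Beilinson E.op)ᵒᵖ ≌ Beilinson E :=
  Localization.uniq (toBeilinson E.op).op (dualize E ⋙ toBeilinson E) (reindexMaps E.op).op

variable (E) in
/-- The duality of Beilinson categories is induced by the duality of admissible functors. -/
def beilinsonDualityIso : (toBeilinson E.op).op ⋙ (beilinsonDuality E).functor ≅
    dualize E ⋙ toBeilinson E :=
  Localization.compUniqFunctor _ _ _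

/-- A componentwise admissible model over `Aᵒᵖ` dualizes to one over `A`, with its two maps
interchanged. -/
lemma beilinsonSeq.dual {X Y Z : Beilinson E.op} {f : X ⟶ Y} {g : Y ⟶ Z}
    (h : beilinsonSeq E.op f g) :
    beilinsonSeq E ((beilinsonDuality E).functor.map g.op)
      ((beilinsonDuality E).functor.map f.op) := by
  obtain ⟨U, V, W, i, p, a, b, c, hip, e₁, e₂⟩ := h
  refine ⟨_, _, _, (dualize E).map p.op, (dualize E).map i.op,
    (beilinsonDuality E).functor.mapIso c.symm.op ≪≫ (beilinsonDualityIso E).app (op W),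
    (beilinsonDuality E).functor.mapIso b.symm.op ≪≫ (beilinsonDualityIso E).app (op V),
    (beilinsonDuality E).functor.mapIso a.symm.op ≪≫ (beilinsonDualityIso E).app (op U),
    fun q => hip q.neg, ?_, ?_⟩
  · have n := (beilinsonDualityIso E).hom.naturality p.op
    have e : g.op ≫ b.inv.op = c.inv.op ≫ ((toBeilinson E.op).map p).op := by
      have e₃ : b.inv ≫ g = (toBeilinson E.op).map p ≫ c.inv := by
        rw [Iso.inv_comp_eq, ← reassoc_of% e₂, Iso.hom_inv_id, Category.comp_id]
      rw [← op_comp, ← op_comp, e₃]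
    have e' := congrArg (beilinsonDuality E).functor.map e
    simp only [Functor.map_comp, Functor.comp_map, Functor.op_map, Quiver.Hom.unop_op] at e' n
    simp [reassoc_of% e', n]
  · have n := (beilinsonDualityIso E).hom.naturality i.op
    have e : f.op ≫ a.inv.op = b.inv.op ≫ ((toBeilinson E.op).map i).op := by
      have e₃ : a.inv ≫ f = (toBeilinson E.op).map i ≫ b.inv := by
        rw [Iso.inv_comp_eq, ← reassoc_of% e₁, Iso.hom_inv_id, Category.comp_id]
      rw [← op_comp, ← op_comp, e₃]
    have e' := congrArg (beilinsonDuality E).functor.map e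
    simp only [Functor.map_comp, Functor.comp_map, Functor.op_map, Quiver.Hom.unop_op] at e' n
    simp [reassoc_of% e', n]

variable [Preadditive A] (hE : IsExactStructure E)

include hE

/-- A model over `A` is carried back along the equivalence `dualize`, and `κ` carries back the
isomorphisms with it. -/
lemma beilinsonSeq.of_dual {X Y Z : Beilinson E.op} {f : X ⟶ Y} {g : Y ⟶ Z}
    (h : beilinsonSeq E ((beilinsonDuality E).functor.map g.op)
      ((beilinsonDuality E).functor.map f.op)) : beilinsonSeq E.op f g := by
  obtain ⟨U, V, W, i, p, a, b, c, hip, e₁, e₂⟩ := h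
  let δ (T : AdmFun E) := (dualize E).objObjPreimageIso T
  let i' := (dualize E).preimage ((δ U).hom ≫ i ≫ (δ V).inv)
  let p' := (dualize E).preimage ((δ V).hom ≫ p ≫ (δ W).inv)
  have hi' : (dualize E).map i' = _ := (dualize E).map_preimage _
  have hp' : (dualize E).map p' = _ := (dualize E).map_preimage _
  let ev (q : Pairs) : AdmFun E ⥤ A := (IsAdmissible E).ι ⋙ (evaluation Pairs A).obj q
  have hlev : ∀ q, E (((dualize E).map i').hom.app q) (((dualize E).map p').hom.app q) := fun q => by
    refine hE.of_iso _ _ _ _ ((ev q).mapIso (δ U).symm) ((ev q).mapIso (δ V).symm)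
      ((ev q).mapIso (δ W).symm) ?_ ?_ (hip q)
    · change (ev q).map i ≫ (ev q).map (δ V).inv = (ev q).map (δ U).inv ≫ (ev q).map ((dualize E).map i')
      rw [← Functor.map_comp, ← Functor.map_comp, hi', Iso.inv_hom_id_assoc]
    · change (ev q).map p ≫ (ev q).map (δ W).inv = (ev q).map (δ V).inv ≫ (ev q).map ((dualize E).map p')
      rw [← Functor.map_comp, ← Functor.map_comp, hp', Iso.inv_hom_id_assoc]
  let κ {T : Beilinson E.op} {S : AdmFun E} (t : (beilinsonDuality E).functor.obj (op T) ≅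
      (toBeilinson E).obj S) : op T ≅ (toBeilinson E.op).op.obj ((dualize E).objPreimage S) :=
    (beilinsonDuality E).functor.preimageIso (t ≪≫ (toBeilinson E).mapIso (δ S).symm ≪≫
      ((beilinsonDualityIso E).app _).symm)
  have hκ : ∀ {T : Beilinson E.op} {S : AdmFun E} (t : (beilinsonDuality E).functor.obj (op T) ≅
      (toBeilinson E).obj S), (beilinsonDuality E).functor.map (κ t).inv =
        (beilinsonDualityIso E).hom.app _ ≫ (toBeilinson E).map (δ S).hom ≫ t.inv := fun t => by
    simp [κ]
  have ni := (beilinsonDualityIso E).hom.naturality i'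
  have np := (beilinsonDualityIso E).hom.naturality p'
  simp only [Functor.comp_map] at ni np
  refine ⟨_, _, _, p'.unop, i'.unop, (κ c).unop.symm, (κ b).unop.symm, (κ a).unop.symm, ?_, ?_, ?_⟩
  · intro q
    rw [← q.neg_neg]
    exact hlev q.neg
  · apply Quiver.Hom.op_inj
    apply (beilinsonDuality E).functor.map_injective
    change (beilinsonDuality E).functor.map ((κ b).inv ≫ f.op) =
      (beilinsonDuality E).functor.map ((toBeilinson E.op).op.map p' ≫ (κ c).inv)
    rw [Functor.map_comp, Functor.map_comp, hκ, hκ, reassoc_of% np, hp']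
    have e₃ : b.inv ≫ (beilinsonDuality E).functor.map f.op = (toBeilinson E).map p ≫ c.inv := by
      rw [Iso.inv_comp_eq, ← reassoc_of% e₂, Iso.hom_inv_id, Category.comp_id]
    simp [e₃]
  · apply Quiver.Hom.op_inj
    apply (beilinsonDuality E).functor.map_injective
    change (beilinsonDuality E).functor.map ((κ a).inv ≫ g.op) =
      (beilinsonDuality E).functor.map ((toBeilinson E.op).op.map i' ≫ (κ b).inv)
    rw [Functor.map_comp, Functor.map_comp, hκ, hκ, reassoc_of% ni, hi']
    have e₃ : a.inv ≫ (beilinsonDuality E).functor.map g.op = (toBeilinson E).map i ≫ b.inv := by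
      rw [Iso.inv_comp_eq, ← reassoc_of% e₁, Iso.hom_inv_id, Category.comp_id]
    simp [e₃]

lemma beilinsonSeq.dual_inverse {X Y Z : Beilinson E} {f : X ⟶ Y} {g : Y ⟶ Z}
    (h : beilinsonSeq E f g) :
    beilinsonSeq E.op ((beilinsonDuality E).inverse.map g).unop
      ((beilinsonDuality E).inverse.map f).unop := by
  refine beilinsonSeq.of_dual hE (h.of_iso ((beilinsonDuality E).counitIso.symm.app X)
    ((beilinsonDuality E).counitIso.symm.app Y) ((beilinsonDuality E).counitIso.symm.app Z) ?_ ?_)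
  · exact (beilinsonDuality E).counitIso.inv.naturality f
  · exact (beilinsonDuality E).counitIso.inv.naturality g

lemma isAdmMono_dual {Y Z : Beilinson E} {g : Y ⟶ Z} (hg : IsAdmEpi (beilinsonSeq E) g) :
    IsAdmMono (beilinsonSeq E.op) ((beilinsonDuality E).inverse.map g).unop := by
  obtain ⟨X, f, h⟩ := hg
  exact ⟨_, _, h.dual_inverse hE⟩

omit hE [Preadditive A]

lemma isAdmEpi_dual {Y Z : Beilinson E} {V W : Beilinson E.op} {g : W ⟶ V} {g' : Y ⟶ Z}
    (a : (beilinsonDuality E).functor.obj (op V) ≅ Y)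
    (b : (beilinsonDuality E).functor.obj (op W) ≅ Z)
    (e : (beilinsonDuality E).functor.map g.op ≫ b.hom = a.hom ≫ g')
    (hg : IsAdmMono (beilinsonSeq E.op) g) : IsAdmEpi (beilinsonSeq E) g' := by
  obtain ⟨X, f, h⟩ := hg
  exact ⟨_, (beilinsonDuality E).functor.map f.op ≫ a.hom,
    h.dual.of_iso (Iso.refl _) a b (Category.id_comp _).symm e⟩

end Duality

/-! ### The Beilinson category is exact. -/

section Exactness

variable {A : Type u} [Category.{v} A] [Preadditive A] {E : SeqClass A}

/-- Left fractions handle composites and pushouts of admissible monomorphisms directly; composites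
and pullbacks of admissible epimorphisms are the same statements for `Aᵒᵖ`, read through the
duality. -/
theorem isQuillenExact_beilinsonSeq [HasFiniteBiproducts A] (hE : IsExactStructure E) :
    IsQuillenExact (beilinsonSeq E) where
  comp_zero _ _ _ _ _ h := beilinsonSeq.comp_zero hE h
  isKernel _ _ _ _ _ h w := beilinsonSeq.isKernel hE h w
  isCokernel _ _ _ _ _ h w := beilinsonSeq.isCokernel hE h w
  of_iso _ _ _ _ _ _ _ _ _ _ a b c h₁ h₂ h := h.of_iso a b c h₁ h₂
  split _ _ b hb := beilinsonSeq.split hE b hb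
  admMono_comp _ _ _ f g hf hg := beilinsonSeq.admMono_comp hE f g hf hg
  admEpi_comp X Y Z f g hf hg := by
    have h := beilinsonSeq.admMono_comp hE.op _ _ (isAdmMono_dual hE hg) (isAdmMono_dual hE hf)
    rw [← unop_comp, ← Functor.map_comp] at h
    exact isAdmEpi_dual ((beilinsonDuality E).counitIso.app X)
      ((beilinsonDuality E).counitIso.app Z)
      ((beilinsonDuality E).counitIso.hom.naturality (f ≫ g)) h
  pullback Y Z W g h hg := by
    let D := beilinsonDuality E
    obtain ⟨P, h', g', sq, hg'⟩ := beilinsonSeq.pushout hE.op (D.inverse.map g).unop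
      (D.inverse.map h).unop (isAdmMono_dual hE hg)
    have sq' : IsPullback (D.functor.map h'.op) (D.functor.map g'.op)
      (D.functor.map (D.inverse.map g)) (D.functor.map (D.inverse.map h)) :=
      (sq.op.flip).map D.functor
    refine ⟨_, D.functor.map h'.op ≫ (D.counitIso.app Y).hom,
      D.functor.map g'.op ≫ (D.counitIso.app W).hom, ?_, ?_⟩
    · exact sq'.of_iso (Iso.refl _) (D.counitIso.app Y) (D.counitIso.app W) (D.counitIso.app Z)
        (by simp) (by simp) (D.counitIso.hom.naturality g) (D.counitIso.hom.naturality h)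
    · exact isAdmEpi_dual (Iso.refl _) (D.counitIso.app W) (Category.id_comp _).symm hg'
  pushout _ _ _ f h hf := beilinsonSeq.pushout hE f h hf

theorem isExactStructure_beilinsonSeq [HasFiniteBiproducts A] (hE : IsExactStructure E) :
    IsExactStructure (beilinsonSeq E) :=
  have := hasFiniteBiproducts_beilinson hE
  have := hasBinaryBiproducts_of_finite_biproducts (Beilinson E)
  (isQuillenExact_beilinsonSeq hE).isExactStructure

theorem isExactCategory_beilinsonSeq [HasFiniteBiproducts A] (hE : IsExactStructure E) :
    IsExactCategory (beilinsonSeq E) :=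
  ⟨inferInstance, hasFiniteBiproducts_beilinson hE, isExactStructure_beilinsonSeq hE⟩

end Exactness

/-! ### Countable strict ind-objects as a localization of the category of sequences. -/

section IndLim

variable {A : Type u} [Category.{v} A]

/-- In `Ind A`, the objects of `A` are finitely presentable. -/
instance preservesColimitsOfShape_coyoneda_indYoneda (X : A) (I : Type v) [SmallCategory I]
    [IsFiltered I] :
    PreservesColimitsOfShape I (coyoneda.obj (op ((Ind.yoneda (C := A)).obj X))) := by
  let e : coyoneda.obj (op ((Ind.yoneda (C := A)).obj X)) ≅
      Ind.inclusion A ⋙ (evaluation _ _).obj (op X) :=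
    NatIso.ofComponents (fun P => (((Ind.inclusion.fullyFaithful (C := A)).homEquiv).trans
      (((Ind.yonedaCompInclusion.app X).homFromEquiv).trans yonedaEquiv)).toIso)
      (fun {P Q} f => by
        ext g
        simp [yonedaEquiv, Iso.homFromEquiv])
  exact preservesColimitsOfShape_of_natIso e.symm

instance : (natDown.{v}).IsEquivalence where
  faithful := ⟨fun _ => Subsingleton.elim _ _⟩
  full := ⟨fun {n m} f => ⟨homOfLE (show n.down ≤ m.down from leOfHom f), Subsingleton.elim _ _⟩⟩
  essSurj := ⟨fun n => ⟨⟨n⟩, ⟨Iso.refl _⟩⟩⟩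

variable {E : SeqClass A}

/-- The map from a term of a system to the formal colimit. -/
def indι (S : IndSys E) (n : ℕ) :
    Ind.yoneda.obj (S.obj.obj n) ⟶ ((indLim E).obj S).obj :=
  colimit.ι ((natDown ⋙ S.obj) ⋙ Ind.yoneda) ⟨n⟩

lemma indι_w (S : IndSys E) {n m : ℕ} (f : n ⟶ m) :
    Ind.yoneda.map (S.obj.map f) ≫ indι S m = indι S n :=
  colimit.w ((natDown ⋙ S.obj) ⋙ Ind.yoneda) (j := ⟨m⟩) (j' := ⟨n⟩)
    (homOfLE (show n ≤ m from leOfHom f))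

lemma indι_map {S S' : IndSys E} (a : S ⟶ S') (n : ℕ) :
    indι S n ≫ ((indLim E).map a).hom = Ind.yoneda.map (a.hom.app n) ≫ indι S' n :=
  ι_colimMap (Functor.whiskerRight (Functor.whiskerLeft natDown a.hom) Ind.yoneda) ⟨n⟩

lemma indLim_hom_ext {S : IndSys E} {P : IndAdm E} {f g : (indLim E).obj S ⟶ P}
    (h : ∀ n, indι S n ≫ f.hom = indι S n ≫ g.hom) : f = g := by
  ext1
  exact colimit.hom_ext fun n => h n.down

lemma exists_indLim_desc (S : IndSys E) {P : IndAdm E}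
    (f : ∀ n, Ind.yoneda.obj (S.obj.obj n) ⟶ P.obj)
    (hf : ∀ {n m} (a : n ⟶ m), Ind.yoneda.map (S.obj.map a) ≫ f m = f n) :
    ∃ g : (indLim E).obj S ⟶ P, ∀ n, indι S n ≫ g.hom = f n :=
  ⟨ObjectProperty.homMk (colimit.desc ((natDown ⋙ S.obj) ⋙ Ind.yoneda)
    { pt := P.obj
      ι := { app := fun n => f n.down
             naturality := fun _ _ a => (hf (natDown.map a)).trans (Category.comp_id _).symm } }),
    fun _ => colimit.ι_desc _ _⟩

/-- Representable objects are finitely presentable in `Ind A`. -/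
lemma exists_fac_indι {X : A} (S : IndSys E)
    (f : Ind.yoneda.obj X ⟶ ((indLim E).obj S).obj) :
    ∃ (n : ℕ) (g : X ⟶ S.obj.obj n), f = Ind.yoneda.map g ≫ indι S n := by
  obtain ⟨n, g, hg⟩ := Types.jointly_surjective_of_isColimit
    (isColimitOfPreserves (coyoneda.obj (op (Ind.yoneda.obj X)))
      (colimit.isColimit ((natDown ⋙ S.obj) ⋙ Ind.yoneda))) f
  obtain ⟨g, rfl⟩ := Ind.yoneda.map_surjective g
  exact ⟨n.down, g, hg.symm⟩

/-- Finite presentability makes `a` and `b` agree at a later stage, and the transition maps are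
monomorphisms. -/
lemma indι_cancel (hE : ∀ ⦃X Y : A⦄ (f : X ⟶ Y), IsAdmMono E f → Mono f)
    {X : A} (S : IndSys E) {n : ℕ} {a b : X ⟶ S.obj.obj n}
    (h : Ind.yoneda.map a ≫ indι S n = Ind.yoneda.map b ≫ indι S n) : a = b := by
  obtain ⟨k, f, g, e⟩ := (Types.FilteredColimit.isColimit_eq_iff _
    (isColimitOfPreserves (coyoneda.obj (op (Ind.yoneda.obj X)))
      (colimit.isColimit ((natDown ⋙ S.obj) ⋙ Ind.yoneda)))
      (i := ⟨n⟩) (j := ⟨n⟩) (xi := Ind.yoneda.map a) (xj := Ind.yoneda.map b)).1 h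
  obtain rfl : f = g := Subsingleton.elim _ _
  have := hE _ (S.property (natDown.map f))
  refine (cancel_mono (S.obj.map (natDown.map f))).1 ?_
  apply Ind.yoneda.map_injective
  exact (Ind.yoneda.map_comp _ _).trans (Eq.trans e (Ind.yoneda.map_comp _ _).symm)


/-- The reindexing of a system along a monotone map. -/
def IndSys.reindex (S : IndSys E) (φ : ℕ →o ℕ) : IndSys E :=
  ⟨φ.monotone.functor ⋙ S.obj, fun _ _ _ => S.property _⟩

variable (E)

/-- Reindexing, as an endofunctor of the category of systems. -/
def indReindexFunctor (φ : ℕ →o ℕ) : IndSys E ⥤ IndSys E where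
  obj S := S.reindex φ
  map f := ObjectProperty.homMk (Functor.whiskerLeft φ.monotone.functor f.hom)

/-- The natural map `S ⟶ S ∘ φ`, for `φ ≥ id`. -/
def IndSys.toReindex {E : SeqClass A} (S : IndSys E) (φ : ℕ →o ℕ) (h : ∀ n, n ≤ φ n) :
    S ⟶ S.reindex φ :=
  ObjectProperty.homMk
    { app n := S.obj.map (homOfLE (h n))
      naturality n m f := (S.obj.map_comp f (homOfLE (h m))).symm.trans
        (S.obj.map_comp (homOfLE (h n)) (homOfLE (φ.monotone (leOfHom f)))) }

/-- The endofunctors `S ↦ S ∘ φ` of the category of systems, for `φ ≥ id`. -/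
def indReindexing : Reindexing (IndSys E) where
  ι := { φ : ℕ →o ℕ // ∀ n, n ≤ φ n }
  nonempty := ⟨⟨OrderHom.id, fun _ => le_rfl⟩⟩
  T φ := indReindexFunctor E φ.1
  η φ :=
    { app S := S.toReindex φ.1 φ.2
      naturality S S' f := by
        ext n
        exact (f.hom.naturality _).symm }
  map_η φ S := by
    ext n
    rfl
  comp φ ψ := ⟨⟨φ.1.comp ψ.1, fun i => (ψ.2 i).trans (φ.2 _)⟩,
    𝟙 (indReindexFunctor E (φ.1.comp ψ.1)),
    fun S => by
      ext n
      exact (congrArg _ (Category.comp_id _)).trans (S.obj.map_comp _ _).symm⟩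

variable {E}

/-- The stages `S (φ n)` are cofinal among the `S n`, so reindexing does not change the formal
colimit. -/
lemma exists_inverse_indLim (φ : ℕ →o ℕ) (h : ∀ n, n ≤ φ n) (S : IndSys E) :
    ∃ r : (indLim E).obj (S.reindex φ) ⟶ (indLim E).obj S,
      (indLim E).map (S.toReindex φ h) ≫ r = 𝟙 _ ∧ r ≫ (indLim E).map (S.toReindex φ h) = 𝟙 _ ∧
      ∀ n, indι (S.reindex φ) n ≫ r.hom = indι S (φ n) := by
  obtain ⟨r, hr⟩ := exists_indLim_desc (S.reindex φ) (P := (indLim E).obj S)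
    (fun n => indι S (φ n)) (fun {n m} a => indι_w S (homOfLE (φ.monotone (leOfHom a))))
  refine ⟨r, indLim_hom_ext fun n => ?_, indLim_hom_ext fun n => ?_, hr⟩
  · refine (Category.assoc _ _ _).symm.trans ((congrArg (· ≫ r.hom) (indι_map _ n)).trans ?_)
    refine (Category.assoc _ _ _).trans ((congrArg _ (hr n)).trans ?_)
    exact (indι_w S (homOfLE (h n))).trans (Category.comp_id _).symm
  · refine (Category.assoc _ _ _).symm.trans ((congrArg (· ≫ _) (hr n)).trans ?_)
    refine (indι_map _ (φ n)).trans ?_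
    exact (indι_w (S.reindex φ) (homOfLE (h n))).trans (Category.comp_id _).symm

/-- A countable directed preorder contains a cofinal sequence, and restriction along a final functor
preserves colimits. -/
instance : (indLim E).EssSurj where
  mem_essImage := by
    rintro ⟨X, I, _, _, _, _, D, hD, ⟨i⟩⟩
    let s := IsFiltered.sequentialFunctor I
    refine ⟨⟨s ⋙ D, fun _ _ _ => hD _⟩, ⟨ObjectProperty.isoMk _
      (Functor.Final.colimitIso (natDown.{v} ⋙ s) (D ⋙ Ind.yoneda) ≪≫ i.symm)⟩⟩

variable (hE : ∀ ⦃X Y : A⦄ (f : X ⟶ Y), IsAdmMono E f → Mono f)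

include hE

/-- The formal colimit functor is a localization functor. -/
lemma isLocalization_indLim : (indLim E).IsLocalization (indReindexing E).W := by
  refine (indReindexing E).isLocalization (indLim E) (fun φ S => ?_) (fun S S' a b h => ?_)
    (fun S S' f => ?_)
  · obtain ⟨r, h₁, h₂, -⟩ := exists_inverse_indLim φ.1 φ.2 S
    exact ⟨r, h₁, h₂⟩
  -- By `indι_cancel` the two maps of systems are already equal, so any `φ` will do.
  · obtain ⟨φ⟩ := (indReindexing E).nonempty
    refine ⟨φ, ?_⟩
    congr 1
    ext n
    apply indι_cancel hE
    rw [← indι_map, ← indι_map, h]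
  · choose k g hg using fun n => exists_fac_indι S' (indι S n ≫ f.hom)
    -- The partial sums make `φ` monotone with `k n ≤ φ n`, and the summand `n` gives `φ ≥ id`.
    let φ : ℕ →o ℕ := ⟨fun n => n + ∑ i ∈ Finset.range (n + 1), k i, fun n m h =>
      add_le_add h (Finset.sum_le_sum_of_subset (Finset.range_mono (by omega)))⟩
    have hφ' (n) : n ≤ φ n := Nat.le_add_right _ _
    have hφ (n) : k n ≤ φ n := (Finset.single_le_sum (fun _ _ => Nat.zero_le _)
      (Finset.mem_range.2 n.lt_succ_self)).trans (Nat.le_add_left _ _)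
    have hw (n) : Ind.yoneda.map (g n ≫ S'.obj.map (homOfLE (hφ n))) ≫ indι S' (φ n) =
        indι S n ≫ f.hom := by
      rw [Functor.map_comp, Category.assoc, indι_w, hg]
    -- Compatibility of the chosen factorizations can be tested in the formal colimit.
    have hn {n m} (t : n ⟶ m) : S.obj.map t ≫ g m ≫ S'.obj.map (homOfLE (hφ m)) =
        (g n ≫ S'.obj.map (homOfLE (hφ n))) ≫ S'.obj.map (homOfLE (φ.monotone (leOfHom t))) := by
      apply indι_cancel hE
      have h₂ := indι_w S t
      rw [Functor.map_comp, Category.assoc, hw, reassoc_of% h₂, Functor.map_comp, Category.assoc,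
        indι_w, hw]
    let a : S ⟶ S'.reindex φ := ObjectProperty.homMk
      { app n := g n ≫ S'.obj.map (homOfLE (hφ n))
        naturality n m t := hn t }
    obtain ⟨r, h₁, h₂, h₃⟩ := exists_inverse_indLim φ hφ' S'
    have hr : IsIso r := ⟨_, h₂, h₁⟩
    have e : (indLim E).map a = f ≫ (indLim E).map (S'.toReindex φ hφ') := by
      rw [← cancel_mono r, Category.assoc, h₁, Category.comp_id]
      refine indLim_hom_ext fun n => ?_
      refine (Category.assoc _ _ _).symm.trans ?_
      rw [indι_map, Category.assoc, h₃]
      exact hw n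
    exact ⟨⟨φ, hφ'⟩, a, e⟩

end IndLim

/-! ### Maps between functors of quotients. -/

section Quot

variable {A : Type u} [Category.{v} A] [Preadditive A] {E : SeqClass A} (hE : IsExactStructure E)

/-- The quotients of `T ∘ φ`. -/
def Quotients.reindex {T : ℤ ⥤ A} (q : Quotients E T) (φ : Bicofinal) :
    Quotients E (φ.monotone.functor ⋙ T) where
  obj i j h := q.obj (φ.toFun i) (φ.toFun j) (φ.monotone h)
  proj i j h := q.proj (φ.toFun i) (φ.toFun j) (φ.monotone h)
  adm i j h := q.adm (φ.toFun i) (φ.toFun j) (φ.monotone h)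

/-- The admissible functor `(i, j) ↦ T j / T i`. -/
def quotAdm {T : ℤ ⥤ A} (q : Quotients E T) : AdmFun E :=
  ⟨quotFunctor hE q, quotFunctor_admissible hE q⟩

/-- The map of the functors of quotients induced by a natural transformation. -/
def quotAdmMap {T T' : ℤ ⥤ A} (q : Quotients E T) (q' : Quotients E T') (f : T ⟶ T') :
    quotAdm hE q ⟶ quotAdm hE q' :=
  ObjectProperty.homMk (quotMap hE q q' f)

lemma quotAdmMap_comp {T T' T'' : ℤ ⥤ A} (q : Quotients E T) (q' : Quotients E T')
    (q'' : Quotients E T'') (f : T ⟶ T') (g : T' ⟶ T'') :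
    quotAdmMap hE q q' f ≫ quotAdmMap hE q' q'' g = quotAdmMap hE q q'' (f ≫ g) := by
  ext1
  exact (quotMap_comp hE q q' q'' f g).symm

lemma quotAdmMap_id {T : ℤ ⥤ A} (q : Quotients E T) : quotAdmMap hE q q (𝟙 T) = 𝟙 _ := by
  ext1
  exact quotMap_id hE q

lemma isIso_quotAdmMap {T T' : ℤ ⥤ A} (q : Quotients E T) (q' : Quotients E T') (f : T ⟶ T')
    [IsIso f] : IsIso (quotAdmMap hE q q' f) :=
  ⟨quotAdmMap hE q' q (inv f), by rw [quotAdmMap_comp, IsIso.hom_inv_id, quotAdmMap_id],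
    by rw [quotAdmMap_comp, IsIso.inv_hom_id, quotAdmMap_id]⟩

lemma quotAdm_hom_ext {T : ℤ ⥤ A} {q : Quotients E T} {X : AdmFun E} {f g : quotAdm hE q ⟶ X}
    (h : ∀ p, quotProj hE q p ≫ f.hom.app p = quotProj hE q p ≫ g.hom.app p) : f = g := by
  ext p
  have := quotProj_epi hE q p
  exact (cancel_epi (quotProj hE q p)).1 (h p)

/-- The natural map `T ∘ φ ⟶ T ∘ ψ` for `φ ≤ ψ`. -/
def precompMap (T : ℤ ⥤ A) {φ ψ : Bicofinal} (h : ∀ i, φ.toFun i ≤ ψ.toFun i) :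
    φ.monotone.functor ⋙ T ⟶ ψ.monotone.functor ⋙ T :=
  Functor.whiskerRight { app i := homOfLE (h i) } T

/-- Turns reindexing of functors of quotients into reindexing of systems, so that comparisons can be
made on systems. -/
lemma quotAdmMap_precompMap {T : ℤ ⥤ A} (q : Quotients E T) {φ ψ : Bicofinal}
    (h : ∀ i, φ.toFun i ≤ ψ.toFun i) :
    quotAdmMap hE (q.reindex φ) (q.reindex ψ) (precompMap T h) = (quotAdm hE q).reindexMap h := by
  refine quotAdm_hom_ext hE fun p => ?_
  refine (quotProj_mapApp hE (q.reindex φ) (q.reindex ψ) (precompMap T h) p).trans ?_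
  exact (quotProj_map hE q ((Bicofinal.tildeMap h).app p)).symm

lemma Quotients.mono_map {T : ℤ ⥤ A} (q : Quotients E T) (hE : IsExactStructure E) {i j : ℤ}
    (f : i ⟶ j) : Mono (T.map f) :=
  hE.isQuillenExact.mono (q.adm i j (leOfHom f))

lemma isIso_quotProj {T : ℤ ⥤ A} (q : Quotients E T) (p : Pairs) (h : IsZero (T.obj p.1.1)) :
    IsIso (quotProj hE q p) := by
  have he := quotProj_epi hE q p
  obtain ⟨r, hr⟩ := hE.isQuillenExact.exists_desc (q.adm p.1.1 p.1.2 p.2) (𝟙 _) (h.eq_of_src _ _)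
  exact ⟨r, hr, by
    rw [← cancel_epi (quotProj hE q p)]
    exact (Category.assoc _ _ _).symm.trans ((congrArg (· ≫ _) hr).trans
      ((Category.id_comp _).trans (Category.comp_id _).symm))⟩

/-- If `T₁ i = 0` for `i ≤ i₀`, then a map of functors of quotients comes from a map of the
systems. -/
lemma exists_quotAdmMap {T T₁ : ℤ ⥤ A} (q : Quotients E T) (q₁ : Quotients E T₁)
    (i₀ : ℤ) (hT₁ : ∀ i ≤ i₀, IsZero (T₁.obj i)) (u : quotAdm hE q ⟶ quotAdm hE q₁) :
    ∃ f : T ⟶ T₁, quotAdmMap hE q q₁ f = u := by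
  let v (p : Pairs) : (quotFunctor hE q).obj p ⟶ (quotFunctor hE q₁).obj p := u.hom.app p
  -- `N h a` expresses compatibility of `a` with `u` at `(k, j)`. It propagates to larger `k`, and
  -- to smaller `k` within the range `k ≤ i₀`, where `T₁ j ⟶ T₁ j / T₁ k` is invertible. So a single
  -- `k ≤ i₀` determines `a` and suffices for all `k`.
  let N {k j : ℤ} (h : k ≤ j) (a : T.obj j ⟶ T₁.obj j) : Prop :=
    a ≫ quotProj hE q₁ (pr k j h) = quotProj hE q (pr k j h) ≫ v (pr k j h)
  have iso {k j : ℤ} (h : k ≤ j) (hk : k ≤ i₀) : IsIso (quotProj hE q₁ (pr k j h)) :=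
    isIso_quotProj hE _ _ (hT₁ k hk)
  have w {k l j : ℤ} (hkl : k ≤ l) (h : l ≤ j) :
      quotProj hE q (pr k j (hkl.trans h)) ≫ (quotFunctor hE q).map (prHom hkl le_rfl) =
        quotProj hE q (pr l j h) :=
    (quotProj_map hE q _).trans
      ((congrArg (· ≫ quotProj hE q (pr l j h)) (T.map_id j)).trans (Category.id_comp _))
  have w₁ {k l j : ℤ} (hkl : k ≤ l) (h : l ≤ j) :
      quotProj hE q₁ (pr k j (hkl.trans h)) ≫ (quotFunctor hE q₁).map (prHom hkl le_rfl) =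
        quotProj hE q₁ (pr l j h) :=
    (quotProj_map hE q₁ _).trans
      ((congrArg (· ≫ quotProj hE q₁ (pr l j h)) (T₁.map_id j)).trans
        (Category.id_comp _))
  have nat {p p' : Pairs} (g : p ⟶ p') : (quotFunctor hE q).map g ≫ v p' =
      v p ≫ (quotFunctor hE q₁).map g := u.hom.naturality g
  have up {k l j : ℤ} (hkl : k ≤ l) (h : l ≤ j) (a) (ha : N (hkl.trans h) a) : N h a := by
    change a ≫ _ = _ ≫ _
    rw [← w₁ hkl h, ← w hkl h, Category.assoc, nat]
    exact (Category.assoc _ _ _).symm.trans ((congrArg (· ≫ _) ha).trans (Category.assoc _ _ _))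
  have down {k l j : ℤ} (hkl : k ≤ l) (h : l ≤ j) (hl : l ≤ i₀) (a) (ha : N h a) :
      N (hkl.trans h) a := by
    have i₁ := iso (hkl.trans h) (hkl.trans hl)
    have i₂ := iso h hl
    rw [← w₁ hkl h] at i₂
    have : IsIso ((quotFunctor hE q₁).map
      (prHom hkl le_rfl : pr k j (hkl.trans h) ⟶ pr l j h)) := 
        IsIso.of_isIso_comp_left (quotProj hE q₁ (pr k j (hkl.trans h))) _
    change a ≫ _ = _ ≫ _
    rw [← cancel_mono ((quotFunctor hE q₁).map
      (prHom hkl le_rfl : pr k j (hkl.trans h) ⟶ pr l j h))]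
    refine (Category.assoc _ _ _).trans ?_
    rw [w₁ hkl h]
    refine Eq.trans ha ?_
    rw [← w hkl h]
    exact (Category.assoc _ _ _).trans ((congrArg _ (nat _)).trans (Category.assoc _ _ _).symm)
  have ex (j : ℤ) : ∃ a, N (min_le_right i₀ j) a := by
    have := iso (min_le_right i₀ j) (min_le_left i₀ j)
    refine ⟨quotProj hE q (pr (min i₀ j) j (min_le_right i₀ j)) ≫ v _ ≫
      inv (quotProj hE q₁ (pr (min i₀ j) j (min_le_right i₀ j))), ?_⟩
    exact (Category.assoc _ _ _).trans (congrArg _ ((Category.assoc _ _ _).trans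
      ((congrArg _ (IsIso.inv_hom_id _)).trans (Category.comp_id _))))
  choose a ha using ex
  -- Down from `min i₀ j` to `min k (min i₀ j)`, then up to `k`.
  have ha' {k j : ℤ} (h : k ≤ j) : N h (a j) :=
    up (min_le_left k (min i₀ j)) h _
      (down (min_le_right k (min i₀ j)) (min_le_right i₀ j) (min_le_left i₀ j) _ (ha j))
  refine ⟨{ app := a, naturality := fun j j' f => ?_ }, quotAdm_hom_ext hE fun p => ?_⟩
  -- Naturality is tested after the invertible projection from `T₁ j'` to its quotient by `T₁ (min
  -- i₀ j) = 0`.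
  · have hk : min i₀ j ≤ j' := (min_le_right i₀ j).trans (leOfHom f)
    have := iso hk (min_le_left i₀ j)
    rw [← cancel_mono (quotProj hE q₁ (pr (min i₀ j) j' hk))]
    have h₁ := quotProj_map hE q (prHom le_rfl (leOfHom f) : pr _ j (min_le_right i₀ j) ⟶ pr _ j' hk)
    have h₂ := quotProj_map hE q₁
      (prHom le_rfl (leOfHom f) : pr _ j (min_le_right i₀ j) ⟶ pr _ j' hk)
    refine (Category.assoc _ _ _).trans ((congrArg _ (ha' hk)).trans ?_)
    refine Eq.trans ?_ ((Category.assoc _ _ _).trans (congrArg (a j ≫ ·) h₂.symm)).symm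
    refine Eq.trans ?_ (Category.assoc _ _ _)
    refine Eq.trans ?_ (congrArg (· ≫ _) (ha j)).symm
    refine (Category.assoc _ _ _).symm.trans ((congrArg (· ≫ _) h₁.symm).trans ?_)
    exact (Category.assoc _ _ _).trans ((congrArg _ (nat _)).trans (Category.assoc _ _ _).symm)
  · exact (quotProj_mapApp hE q q₁ _ p).trans (ha' p.2)

end Quot

/-! ### From systems to the Beilinson category: full faithfulness. -/

section Ind

variable {A : Type u} [Category.{v} A] [Preadditive A] [HasZeroObject A] {E : SeqClass A}
  (hE : IsExactStructure E)

/-- The extension of a map `φ ≥ id` of `ℕ` to a bicofinal map, by the identity in negative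
degrees. -/
def extendNat (φ : ℕ →o ℕ) (h : ∀ n, n ≤ φ n) : Bicofinal where
  toFun
    | Int.ofNat n => Int.ofNat (φ n)
    | Int.negSucc n => Int.negSucc n
  monotone i j hij := by
    match i, j with
    | Int.ofNat n, Int.ofNat m => exact Int.ofNat_le.2 (φ.monotone (Int.ofNat_le.1 hij))
    | Int.negSucc n, Int.negSucc m => exact hij
    | Int.negSucc n, Int.ofNat m =>
      exact (Int.negSucc_lt_zero n).le.trans (Int.natCast_nonneg _)
    | Int.ofNat n, Int.negSucc m =>
      exact absurd (hij.trans_lt (Int.negSucc_lt_zero m)) (Int.natCast_nonneg n).not_gt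
  tendsto_top := Filter.tendsto_atTop_mono (fun
    | Int.ofNat n => Int.ofNat_le.2 (h n)
    | Int.negSucc n => le_rfl) Filter.tendsto_id
  tendsto_bot := by
    refine Filter.tendsto_id.congr' ?_
    filter_upwards [Filter.eventually_lt_atBot (0 : ℤ)] with i hi
    match i with
    | Int.ofNat n => exact absurd hi (Int.natCast_nonneg n).not_gt
    | Int.negSucc n => rfl

lemma le_extendNat (φ : ℕ →o ℕ) (h : ∀ n, n ≤ φ n) : ∀ i, i ≤ (extendNat φ h).toFun i
  | Int.ofNat n => Int.ofNat_le.2 (h n)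
  | Int.negSucc _ => le_rfl

/-- The extension by zero of a reindexed system. -/
def extendZeroReindex (S : IndSys E) (φ : ℕ →o ℕ) (h : ∀ n, n ≤ φ n) :
    extendZero (S.reindex φ).obj ≅ (extendNat φ h).monotone.functor ⋙ extendZero S.obj :=
  NatIso.ofComponents (fun
    | Int.ofNat n => Iso.refl (S.obj.obj (φ n))
    | Int.negSucc _ => Iso.refl 0) (fun {i j} f => match i, j, f with
    | Int.ofNat _, Int.ofNat _, _ => (Category.comp_id _).trans (Category.id_comp _).symm
    | Int.negSucc _, _, _ => (isZero_zero A).eq_of_src _ _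
    | Int.ofNat _, Int.negSucc _, g =>
      absurd (leOfHom g) (by have := Int.negSucc_lt_zero; grind))

lemma extendZeroMap_toReindex (S : IndSys E) (φ : ℕ →o ℕ) (h : ∀ n, n ≤ φ n) :
    extendZeroMap (S.toReindex φ h).hom ≫ (extendZeroReindex S φ h).hom =
      precompMap (extendZero S.obj) (φ := Bicofinal.id) (le_extendNat φ h) := by
  ext i
  match i with
  | Int.ofNat n => exact Category.comp_id _
  | Int.negSucc _ => exact (isZero_zero A).eq_of_src _ _

lemma isZero_extendZero (S : ℕ ⥤ A) {i : ℤ} (h : i < 0) : IsZero ((extendZero S).obj i) :=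
  match i with
  | Int.ofNat n => absurd h (Int.natCast_nonneg n).not_gt
  | Int.negSucc _ => isZero_zero A

variable (q : ∀ S : IndSys E, Quotients E S.obj)

/-- The functor from systems to admissible functors is compatible with reindexing. -/
def indSysToAdmFunReindex (S : IndSys E) (φ : ℕ →o ℕ) (h : ∀ n, n ≤ φ n) :
    (indSysToAdmFun hE q).obj (S.reindex φ) ⟶
      ((indSysToAdmFun hE q).obj S).reindex (extendNat φ h) :=
  quotAdmMap hE (extendQuotients hE (q (S.reindex φ)))
    ((extendQuotients hE (q S)).reindex (extendNat φ h)) (extendZeroReindex S φ h).hom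

instance (S : IndSys E) (φ : ℕ →o ℕ) (h : ∀ n, n ≤ φ n) :
    IsIso (indSysToAdmFunReindex hE q S φ h) :=
  isIso_quotAdmMap hE _ _ _

lemma indSysToAdmFun_map_toReindex (S : IndSys E) (φ : ℕ →o ℕ) (h : ∀ n, n ≤ φ n) :
    (indSysToAdmFun hE q).map (S.toReindex φ h) ≫ indSysToAdmFunReindex hE q S φ h =
      ((indSysToAdmFun hE q).obj S).reindexMap (φ := Bicofinal.id) (le_extendNat φ h) :=
  (quotAdmMap_comp hE _ _ _ _ _).trans ((congrArg _ (extendZeroMap_toReindex S φ h)).trans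
    (quotAdmMap_precompMap hE _ _))

/-- Up to the isomorphism `indSysToAdmFunReindex`, the map is the reindexing map along `extendNat
φ`. -/
lemma isIso_indSysToBeilinson_toReindex (S : IndSys E) (φ : ℕ →o ℕ) (h : ∀ n, n ≤ φ n) :
    IsIso ((indSysToBeilinson hE q).map (S.toReindex φ h)) := by
  have h₁ : IsIso ((toBeilinson E).map ((indSysToAdmFun hE q).map (S.toReindex φ h) ≫
      indSysToAdmFunReindex hE q S φ h)) := by
    rw [indSysToAdmFun_map_toReindex]
    exact isIso_toBeilinson_reindexMap E _
  rw [Functor.map_comp] at h₁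
  have h₂ : IsIso ((toBeilinson E).map (indSysToAdmFunReindex hE q S φ h)) := inferInstance
  exact @IsIso.of_isIso_comp_right _ _ _ _ _ _ _ h₂ h₁

/-- After a reindexing `φ`, evaluate at `(i₀, n)` with `φ i₀ < 0`. The target is then the term of
`S'` in degree `φ n`, and the transition map from degree `n` to it is a monomorphism, so `a` can be
read off in degree `n`. -/
lemma map_injective_indSysToBeilinson {S S' : IndSys E} {a b : S ⟶ S'}
    (e : (indSysToBeilinson hE q).map a = (indSysToBeilinson hE q).map b) : a = b := by
  obtain ⟨⟨φ, hφ⟩, h⟩ := ((admReindexing E).map_eq_iff (toBeilinson E) _ _).1 e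
  ext n
  obtain ⟨i₀, hi₀⟩ := φ.exists_le (-1)
  have hi : i₀ < 0 := by have := hφ i₀; omega
  have hin : i₀ ≤ Int.ofNat n := hi.le.trans (Int.natCast_nonneg n)
  let T' := extendZero S'.obj
  let Q := extendQuotients hE (q S)
  let Q' := extendQuotients hE (q S')
  have key (c : S ⟶ S') : quotProj hE Q (pr i₀ (Int.ofNat n) hin) ≫
      (((indSysToAdmFun hE q).map c ≫
        ((admReindexing E).η ⟨φ, hφ⟩).app ((indSysToAdmFun hE q).obj S')).hom.app
          (pr i₀ (Int.ofNat n) hin)) = c.hom.app n ≫ T'.map (homOfLE (hφ (Int.ofNat n))) ≫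
        quotProj hE Q' (pr (φ.toFun i₀) (φ.toFun (Int.ofNat n)) (φ.monotone hin)) := by
    have h₁ := quotProj_mapApp hE Q Q' (extendZeroMap c.hom) (pr i₀ (Int.ofNat n) hin)
    have h₂ := quotProj_map hE Q' (prHom (hφ i₀) (hφ (Int.ofNat n)) :
      pr i₀ (Int.ofNat n) hin ⟶ pr (φ.toFun i₀) (φ.toFun (Int.ofNat n)) (φ.monotone hin))
    refine (Category.assoc _ _ _).symm.trans ((congrArg (· ≫ _) h₁).trans ?_)
    exact (Category.assoc _ _ _).trans (congrArg _ h₂)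
  have i₁ := isIso_quotProj hE Q' (pr (φ.toFun i₀) (φ.toFun (Int.ofNat n)) (φ.monotone hin))
    (isZero_extendZero _ (by have := hi₀; change φ.toFun i₀ < 0; omega))
  have i₂ := Q'.mono_map hE (homOfLE (hφ (Int.ofNat n)))
  have i₃ := mono_comp' i₂ (IsIso.mono_of_iso
    (quotProj hE Q' (pr (φ.toFun i₀) (φ.toFun (Int.ofNat n)) (φ.monotone hin))))
  have := (key a).symm.trans ((congrArg (fun t : (indSysToAdmFun hE q).obj S ⟶
    ((indSysToAdmFun hE q).obj S').reindex φ => quotProj hE Q (pr i₀ (Int.ofNat n) hin) ≫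
      t.hom.app (pr i₀ (Int.ofNat n) hin)) h).trans (key b))
  exact i₃.right_cancellation _ _ this

/-- A fraction gives a map into a bicofinal reindexing `φ`, which `exists_quotAdmMap` lifts to
systems because `φ` is negative in low degrees. Since `φ ≥ id`, it restricts to a map of `ℕ`, whose
extension by the identity is bounded by `φ`. -/
lemma exists_map_indSysToBeilinson {S S' : IndSys E}
    (f : (indSysToBeilinson hE q).obj S ⟶ (indSysToBeilinson hE q).obj S') :
    ∃ (φ : ℕ →o ℕ) (h : ∀ n, n ≤ φ n) (a : S ⟶ S'.reindex φ), (indSysToBeilinson hE q).map a =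
      f ≫ (indSysToBeilinson hE q).map (S'.toReindex φ h) := by
  obtain ⟨⟨φ, hφ⟩, u, hu⟩ := (admReindexing E).exists_map (toBeilinson E)
    (X := (indSysToAdmFun hE q).obj S) (Y := (indSysToAdmFun hE q).obj S') f
  let Q := extendQuotients hE (q S)
  let Q' := extendQuotients hE (q S')
  obtain ⟨i₀, hi₀⟩ := φ.exists_le (-1)
  obtain ⟨g, hg⟩ := exists_quotAdmMap hE Q (Q'.reindex φ) i₀
    (fun i hi => isZero_extendZero _ ((φ.monotone hi).trans_lt (by omega))) u
  have hn (n : ℕ) : φ.toFun (Int.ofNat n) = Int.ofNat (φ.toFun (Int.ofNat n)).toNat :=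
    (Int.toNat_of_nonneg ((Int.natCast_nonneg n).trans (hφ _))).symm
  let ψ : ℕ →o ℕ := ⟨fun n => (φ.toFun (Int.ofNat n)).toNat, fun n m h =>
    Int.toNat_le_toNat (φ.monotone (Int.ofNat_le.2 h))⟩
  have hψ (n) : n ≤ ψ n := Int.ofNat_le.1 ((hφ _).trans (hn n).le)
  have hψφ : ∀ i, (extendNat ψ hψ).toFun i ≤ φ.toFun i
    | Int.ofNat n => (hn n).ge
    | Int.negSucc n => hφ _
  let a : S ⟶ S'.reindex ψ := ObjectProperty.homMk
    { app n := g.app (Int.ofNat n) ≫ (extendZero S'.obj).map (homOfLE (hn n).le)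
      naturality n m t := by
        have h : n ≤ m := leOfHom t
        have h₁ := g.naturality (homOfLE (Int.ofNat_le.2 h))
        refine (Category.assoc _ _ _).symm.trans ((congrArg (· ≫ _) h₁).trans ?_)
        refine (Category.assoc _ _ _).trans (Eq.trans ?_ (Category.assoc _ _ _).symm)
        refine congrArg (g.app (Int.ofNat n) ≫ ·) ?_
        exact ((extendZero S'.obj).map_comp _ _).symm.trans ((extendZero S'.obj).map_comp
          (homOfLE (hn n).le) (homOfLE (Int.ofNat_le.2 (ψ.monotone h)))) }
  have ha : extendZeroMap a.hom ≫ (extendZeroReindex S' ψ hψ).hom ≫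
      precompMap (extendZero S'.obj) hψφ = g := by
    ext i
    match i with
    | Int.ofNat n =>
      refine (congrArg _ (Category.id_comp _)).trans ?_
      refine (Category.assoc _ _ _).trans ?_
      refine (congrArg _ ((extendZero S'.obj).map_comp _ _).symm).trans ?_
      exact (congrArg _ ((extendZero S'.obj).map_id _)).trans (Category.comp_id _)
    | Int.negSucc _ => exact (isZero_zero A).eq_of_src _ _
  refine ⟨ψ, hψ, a, ?_⟩
  -- `r` becomes invertible in the Beilinson category. It carries `a` to `u` and `S'.toReindex ψ hψ`
  -- to the map `η` of `φ`, so cancelling it gives the claim.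
  let r := indSysToAdmFunReindex hE q S' ψ hψ ≫ AdmFun.reindexMap _ hψφ
  have hr : IsIso ((toBeilinson E).map r) := by
    have : IsIso ((toBeilinson E).map (((indSysToAdmFun hE q).obj S').reindexMap hψφ)) :=
      isIso_toBeilinson_reindexMap E _
    rw [Functor.map_comp]
    infer_instance
  have hr' : r = quotAdmMap hE (extendQuotients hE (q (S'.reindex ψ))) (Q'.reindex φ)
      ((extendZeroReindex S' ψ hψ).hom ≫ precompMap (extendZero S'.obj) hψφ) :=
    (congrArg (indSysToAdmFunReindex hE q S' ψ hψ ≫ ·)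
      (quotAdmMap_precompMap hE Q' hψφ).symm).trans (quotAdmMap_comp hE _ _ _ _ _)
  have h₁ : (indSysToAdmFun hE q).map a ≫ r = u := by
    rw [hr']
    exact (quotAdmMap_comp hE _ _ _ _ _).trans ((congrArg _ ha).trans hg)
  have h₂ : (indSysToAdmFun hE q).map (S'.toReindex ψ hψ) ≫ r =
      ((admReindexing E).η ⟨φ, hφ⟩).app ((indSysToAdmFun hE q).obj S') := by
    have e : extendZeroMap (S'.toReindex ψ hψ).hom ≫ (extendZeroReindex S' ψ hψ).hom ≫
        precompMap (extendZero S'.obj) hψφ =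
        precompMap (extendZero S'.obj) (φ := Bicofinal.id) hφ := by
      refine (Category.assoc _ _ _).symm.trans ?_
      rw [extendZeroMap_toReindex]
      ext i
      exact ((extendZero S'.obj).map_comp _ _).symm
    rw [hr']
    exact (quotAdmMap_comp hE _ _ _ _ _).trans ((congrArg _ e).trans
      (quotAdmMap_precompMap hE Q' (φ := Bicofinal.id) hφ))
  refine (cancel_mono ((toBeilinson E).map r)).1 ?_
  refine ((toBeilinson E).map_comp _ _).symm.trans ?_
  rw [h₁]
  refine hu.trans (Eq.trans ?_ (Category.assoc _ _ _).symm)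
  refine congrArg (f ≫ ·) ?_
  rw [← h₂]
  exact (toBeilinson E).map_comp _ _

end Ind

/-! ### The essential image: admissible functors vanishing in low degrees. -/

section EssImage

variable {A : Type u} [Category.{v} A] [Preadditive A] {E : SeqClass A} (hE : IsExactStructure E)

/-- The admissible functors that vanish in low degrees. -/
def AdmFun.IsBoundedBelow (X : AdmFun E) : Prop :=
  ∃ N : ℤ, ∀ p : Pairs, p.1.2 ≤ N → IsZero (X.obj.obj p)

-- If `φ j ≤ N`, the map `X (i, j) ⟶ X (θ i, θ j)` factors through `Y (φ i, φ j) = 0`. For `θ i ≤ j`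
-- it is also an epimorphism onto `X (θ i, j)` followed by a monomorphism. So `X (θ i, j)` is zero,
-- and with it its quotient `X (k, j)` for `θ i ≤ k ≤ j`.
include hE in
lemma AdmFun.IsBoundedBelow.of_iso {X Y : AdmFun E} (hY : Y.IsBoundedBelow)
    (e : (toBeilinson E).obj X ≅ (toBeilinson E).obj Y) : X.IsBoundedBelow := by
  obtain ⟨N, hN⟩ := hY
  obtain ⟨φ, a, ha⟩ := (admReindexing E).exists_map (toBeilinson E) e.hom
  have : IsIso ((toBeilinson E).map a) := by
    rw [ha]
    infer_instance
  obtain ⟨ψ, b, hb⟩ := (admReindexing E).exists_map (toBeilinson E) (inv ((toBeilinson E).map a))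
  obtain ⟨χ, hχ⟩ := ((admReindexing E).map_eq_iff (toBeilinson E) (a ≫ b)
    (((admReindexing E).η ψ).app X)).1 (by rw [Functor.map_comp, hb, IsIso.hom_inv_id_assoc])
  obtain ⟨N', hN'⟩ := φ.1.exists_le N
  refine ⟨N', ?_⟩
  rintro ⟨⟨k, j⟩, hkj : k ≤ j⟩ (hj : j ≤ N')
  let θ := ψ.1.comp χ.1
  have hθ (i) : i ≤ θ.toFun i := (χ.2 i).trans (ψ.2 _)
  obtain ⟨i, hi⟩ := θ.exists_le k
  have hik := (hθ i).trans hi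
  have h0 : X.obj.map (prHom (hθ i) (hθ j) : pr i j (hik.trans hkj) ⟶
      pr (θ.toFun i) (θ.toFun j) (θ.monotone (hik.trans hkj))) = 0 := by
    have h₁ : a.hom.app (pr i j (hik.trans hkj)) = 0 :=
      (hN _ ((φ.1.monotone hj).trans hN')).eq_of_tgt _ _
    have h₂ := congrArg (fun t : X ⟶ (X.reindex ψ.1).reindex χ.1 =>
      t.hom.app (pr i j (hik.trans hkj))) hχ
    refine (X.obj.map_comp (prHom (ψ.2 i) (ψ.2 j) : pr i j (hik.trans hkj) ⟶ pr _ _ (ψ.1.monotone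
      (hik.trans hkj))) (prHom (ψ.1.monotone (χ.2 i)) (ψ.1.monotone (χ.2 j)))).trans
      (Eq.trans h₂.symm ?_)
    refine (Category.assoc _ _ _).trans ((congrArg (· ≫ _) h₁).trans zero_comp)
  have e₁ := hE.epi (X.property i (θ.toFun i) j (hθ i) (hi.trans hkj))
  have e₂ := hE.isQuillenExact.mono (X.property (θ.toFun i) j (θ.toFun j) (hi.trans hkj) (hθ j))
  have e₃ := hE.epi (X.property (θ.toFun i) k j hi hkj)
  have hz : IsZero (X.obj.obj (pr (θ.toFun i) j (hi.trans hkj))) := by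
    rw [IsZero.iff_id_eq_zero, ← cancel_mono (X.obj.map (prHom le_rfl (hθ j) :
      pr (θ.toFun i) j (hi.trans hkj) ⟶ pr (θ.toFun i) (θ.toFun j) ((hi.trans hkj).trans (hθ j)))),
      ← cancel_epi (X.obj.map (prHom (hθ i) le_rfl :
        pr i j (hik.trans hkj) ⟶ pr (θ.toFun i) j (hi.trans hkj))), Category.id_comp,
      ← Functor.map_comp, zero_comp, comp_zero]
    exact h0
  exact IsZero.of_epi (X.obj.map (prHom hi le_rfl : pr _ j _ ⟶ pr k j hkj)) hz

end EssImage

section EssImageInd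

variable {A : Type u} [Category.{v} A] [Preadditive A] [HasZeroObject A] {E : SeqClass A}
  (hE : IsExactStructure E) (q : ∀ S : IndSys E, Quotients E S.obj)

lemma isBoundedBelow_indSysToAdmFun (S : IndSys E) :
    ((indSysToAdmFun hE q).obj S).IsBoundedBelow := by
  refine ⟨-1, fun p hp => ?_⟩
  have := quotProj_epi hE (extendQuotients hE (q S)) p
  exact @IsZero.of_epi _ _ _ _ _ (quotProj hE (extendQuotients hE (q S)) p) this
    (isZero_extendZero _ (by omega))

/-- The functor `(i, j) ↦ (max (-1) i, max (-1) j)` on `Π`. -/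
def truncPairs : Pairs ⥤ Pairs where
  obj p := pr (max (-1) p.1.1) (max (-1) p.1.2) (max_le_max le_rfl p.2)
  map f := prHom (max_le_max le_rfl (leOfHom f).1) (max_le_max le_rfl (leOfHom f).2)

/-- The functor `j ↦ (-1, max (-1) j)`. -/
def rowPairs : ℤ ⥤ Pairs where
  obj j := pr (-1) (max (-1) j) (le_max_left _ _)
  map f := prHom le_rfl (max_le_max le_rfl (leOfHom f))

/-- The values of `X` as quotients of the row `X (-1, j)`. -/
def rowQuotients (X : AdmFun E) : Quotients E (rowPairs ⋙ X.obj) where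
  obj i j h := X.obj.obj (truncPairs.obj (pr i j h))
  proj _ _ _ := X.obj.map (prHom (le_max_left _ _) le_rfl)
  adm _ _ h := X.property (-1) _ _ (le_max_left _ _) (max_le_max le_rfl h)

omit [HasZeroObject A] in
lemma quotFunctor_rowQuotients (X : AdmFun E) {p p' : Pairs} (g : p ⟶ p') :
    (quotFunctor hE (rowQuotients X)).map g = X.obj.map (truncPairs.map g) := by
  have := quotProj_epi hE (rowQuotients X) p
  refine (cancel_epi (quotProj hE (rowQuotients X) p)).1 ((quotProj_map hE _ g).trans ?_)
  exact (X.obj.map_comp _ _).symm.trans (X.obj.map_comp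
    (prHom (le_max_left _ _) le_rfl : rowPairs.obj p.1.2 ⟶ truncPairs.obj p) (truncPairs.map g))

/-- The natural map from `X` to its truncation. -/
def toRowQuotients (X : AdmFun E) : X ⟶ quotAdm hE (rowQuotients X) :=
  ObjectProperty.homMk
    { app p := X.obj.map (prHom (le_max_right _ _) (le_max_right _ _) : p ⟶ truncPairs.obj p)
      naturality p p' g := by
        refine Eq.trans ?_ (congrArg _ (quotFunctor_rowQuotients hE X g)).symm
        exact (X.obj.map_comp _ _).symm.trans (X.obj.map_comp
          (prHom (le_max_right _ _) (le_max_right _ _) : p ⟶ truncPairs.obj p) _) }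

-- The essential case is `i < -1 < j`: the kernel of `X (i, j) ⟶ X (-1, j)` is `X (i, -1) = 0`.
omit [HasZeroObject A] in
lemma isIso_toRowQuotients {X : AdmFun E} (hX : ∀ p : Pairs, p.1.2 ≤ -1 → IsZero (X.obj.obj p)) :
    IsIso (toRowQuotients hE X) := by
  have (p : Pairs) : IsIso (X.obj.map
      (prHom (le_max_right _ _) (le_max_right _ _) : p ⟶ truncPairs.obj p)) := by
    obtain ⟨⟨i, j⟩, hij : i ≤ j⟩ := p
    by_cases hi : -1 ≤ i
    · have : IsIso (prHom (le_max_right _ _) (le_max_right _ _) :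
          pr i j hij ⟶ truncPairs.obj (pr i j hij)) :=
        ⟨prHom (max_le hi le_rfl) (max_le (hi.trans hij) le_rfl), Subsingleton.elim _ _,
          Subsingleton.elim _ _⟩
      infer_instance
    · by_cases hj : j ≤ -1
      · have h₁ := hX (pr i j hij) hj
        have h₂ := hX (truncPairs.obj (pr i j hij)) (max_le le_rfl hj)
        exact ⟨0, h₁.eq_of_src _ _, h₂.eq_of_src _ _⟩
      · have h₁ : i ≤ max (-1) i := le_max_right _ _
        have h₂ : max (-1) i ≤ max (-1) j := max_le_max le_rfl hij
        have h₃ := X.property i (max (-1) i) (max (-1) j) h₁ h₂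
        have h₄ := hX (pr i (max (-1) i) h₁) (max_le le_rfl (by omega))
        have : IsIso (prHom le_rfl (le_max_right _ _) : pr i j hij ⟶ pr i (max (-1) j)
            (h₁.trans h₂)) :=
          ⟨prHom le_rfl (max_le (by omega) le_rfl), Subsingleton.elim _ _, Subsingleton.elim _ _⟩
        have : IsIso (X.obj.map (prHom h₁ le_rfl :
            pr i (max (-1) j) (h₁.trans h₂) ⟶ pr (max (-1) i) (max (-1) j) h₂)) := by
          obtain ⟨r, hr⟩ := hE.isQuillenExact.exists_desc h₃ (𝟙 _) (h₄.eq_of_src _ _)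
          have := hE.epi h₃
          have : IsSplitMono (X.obj.map (prHom h₁ le_rfl :
            pr i (max (-1) j) (h₁.trans h₂) ⟶ pr (max (-1) i) (max (-1) j) h₂)) := ⟨⟨r, hr⟩⟩
          exact isIso_of_epi_of_isSplitMono _
        have e : X.obj.map (prHom (le_max_right _ _) (le_max_right _ _) :
            pr i j hij ⟶ truncPairs.obj (pr i j hij)) = X.obj.map (prHom le_rfl (le_max_right _ _) :
            pr i j hij ⟶ pr i (max (-1) j) (h₁.trans h₂)) ≫ X.obj.map (prHom h₁ le_rfl) :=
          X.obj.map_comp _ _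
        rw [e]
        infer_instance
  have : IsIso (toRowQuotients hE X).hom := by
    have : ∀ p, IsIso ((toRowQuotients hE X).hom.app p) := this
    exact NatIso.isIso_of_isIso_app _
  exact (ObjectProperty.isoMk _ (asIso (toRowQuotients hE X).hom)).isIso_hom

/-- The system `X (-1, 0) ⟶ X (-1, 1) ⟶ ⋯`. -/
def rowSys (X : AdmFun E) : IndSys E :=
  ⟨{ obj n := X.obj.obj (pr (-1) (Int.ofNat n) (by have := Int.natCast_nonneg n; grind))
     map {n m} f := X.obj.map (prHom le_rfl (Int.ofNat_le.2 (leOfHom f)))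
     map_id n := X.obj.map_id _
     map_comp f g := X.obj.map_comp _ _ },
    fun {n m} f => ⟨_, _, X.property (-1) (Int.ofNat n) (Int.ofNat m) _
      (Int.ofNat_le.2 (leOfHom f))⟩⟩

/-- The comparison of the extension by zero of the row of `X`. -/
def extendZeroRow (X : AdmFun E) : extendZero (rowSys X).obj ⟶ rowPairs ⋙ X.obj where
  app
    | Int.ofNat n => X.obj.map (prHom le_rfl (le_max_right _ _))
    | Int.negSucc _ => 0
  naturality i j f := match i, j, f with
    | Int.ofNat _, Int.ofNat _, f => (X.obj.map_comp _ _).symm.trans (X.obj.map_comp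
        (prHom le_rfl (le_max_right _ _)) (rowPairs.map f))
    | Int.negSucc _, _, _ => (isZero_zero A).eq_of_src _ _
    | Int.ofNat _, Int.negSucc _, g =>
      absurd (leOfHom g) (by have := Int.negSucc_lt_zero; grind)

-- In negative degrees the row is `X (-1, -1) = 0`.
include hE in
lemma isIso_extendZeroRow (X : AdmFun E) : IsIso (extendZeroRow X) := by
  have : ∀ i, IsIso ((extendZeroRow X).app i)
    | Int.ofNat n => by
      have hn : -1 ≤ Int.ofNat n := by have := Int.natCast_nonneg n; grind
      have : IsIso (prHom le_rfl (le_max_right _ _) :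
          pr (-1) (Int.ofNat n) hn ⟶ rowPairs.obj (Int.ofNat n)) :=
        ⟨prHom le_rfl (max_le hn le_rfl), Subsingleton.elim _ _, Subsingleton.elim _ _⟩
      exact (inferInstance : IsIso (X.obj.map (prHom le_rfl (le_max_right _ _) :
          pr (-1) (Int.ofNat n) hn ⟶ rowPairs.obj (Int.ofNat n))))
    | Int.negSucc n => by
      have h : rowPairs.obj (Int.negSucc n) = pr (-1) (-1) le_rfl := by
        have : max (-1) (Int.negSucc n) = -1 := max_eq_left (by grind)
        simp [rowPairs, this]
      have hz : IsZero ((rowPairs ⋙ X.obj).obj (Int.negSucc n)) := by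
        rw [Functor.comp_obj, h]
        exact X.property.isZero_diag hE (-1)
      exact ⟨0, (isZero_zero A).eq_of_src _ _, hz.eq_of_src _ _⟩
  exact NatIso.isIso_of_isIso_app _

/-- After a shift, a functor that is bounded below vanishes for `j ≤ -1`, and its values are the
quotients of the row `X (-1, j)`. Conversely, boundedness is invariant under isomorphism in the
Beilinson category. -/
lemma essImage_indSysToBeilinson_iff (X : AdmFun E) :
    (indSysToBeilinson hE q).essImage ((toBeilinson E).obj X) ↔ X.IsBoundedBelow := by
  constructor
  · rintro ⟨S, ⟨e⟩⟩
    exact (isBoundedBelow_indSysToAdmFun hE q S).of_iso hE e.symm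
  · rintro ⟨N, hN⟩
    -- Adding `N + 1` carries the range `j ≤ -1` into `j ≤ N`.
    let s : Bicofinal := ⟨fun i => i + (N + 1), fun i j h => by simpa using h,
      Filter.tendsto_atTop_add_const_right _ _ Filter.tendsto_id,
      Filter.tendsto_atBot_add_const_right _ _ Filter.tendsto_id⟩
    let Y := X.reindex s
    have hY : ∀ p : Pairs, p.1.2 ≤ -1 → IsZero (Y.obj.obj p) := fun p hp =>
      hN _ (show p.1.2 + (N + 1) ≤ N by omega)
    have i₁ := isIso_toRowQuotients hE hY
    have i₂ := isIso_extendZeroRow hE Y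
    have i₃ := isIso_quotAdmMap hE (extendQuotients hE (q (rowSys Y))) (rowQuotients Y)
      (extendZeroRow Y)
    exact ⟨rowSys Y, ⟨(toBeilinson E).mapIso
      (@asIso _ _ _ _ _ i₃ ≪≫ (asIso (toRowQuotients hE Y)).symm) ≪≫ reindexIso E X s⟩⟩

/-- The essential image of the ind-systems is closed under extensions. -/
lemma closedUnderExtensions_indSysToBeilinson :
    ClosedUnderExtensions (beilinsonSeq E) (indSysToBeilinson hE q) := by
  rintro X Y Z f g ⟨X', Y', Z', f', g', a, b, c, h, -, -⟩ hX hZ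
  obtain ⟨N, hN⟩ := (essImage_indSysToBeilinson_iff hE q X').1
    (Functor.essImage.ofIso a hX)
  obtain ⟨M, hM⟩ := (essImage_indSysToBeilinson_iff hE q Z').1
    (Functor.essImage.ofIso c hZ)
  -- Below `min N M` the components of `Y'` are extensions of zero by zero.
  refine Functor.essImage.ofIso b.symm ((essImage_indSysToBeilinson_iff hE q Y').2
    ⟨min N M, fun p hp => hE.isZero_mid (h p) (hN p ?_) (hM p ?_)⟩)
  · exact hp.trans (min_le_left _ _)
  · exact hp.trans (min_le_right _ _)

end EssImageInd

/-! ### Extension-closed full subcategories of exact categories. -/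

section Induced

variable {B : Type*} [Category B] {L : Type*} [Category L] {E : SeqClass L} {F : B ⥤ L}

lemma ClosedUnderExtensions.op (h : ClosedUnderExtensions E F) :
    ClosedUnderExtensions E.op F.op := by
  rintro X Y Z f g hfg ⟨X', ⟨a⟩⟩ ⟨Z', ⟨c⟩⟩
  obtain ⟨Y', ⟨b⟩⟩ := h g.unop f.unop hfg ⟨_, ⟨c.unop.symm⟩⟩ ⟨_, ⟨a.unop.symm⟩⟩
  exact ⟨Opposite.op Y', ⟨b.symm.op⟩⟩

variable [Preadditive L] (hE : IsExactStructure E) [F.Full] [F.Faithful]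

include hE

omit [F.Faithful] in
lemma isAdmMono_induced {X Y : B} {f : X ⟶ Y} {Q : L} {c : F.obj Y ⟶ Q} (h : E (F.map f) c)
    (hQ : F.essImage Q) : IsAdmMono (E.induced F) f := by
  obtain ⟨Z, ⟨e⟩⟩ := hQ
  refine ⟨Z, F.preimage (c ≫ e.inv), ?_⟩
  refine hE.of_iso _ _ _ _ (Iso.refl _) (Iso.refl _) e.symm ?_ ?_ h <;> simp

variable (hF : ClosedUnderExtensions E F)

include hF

-- By the third isomorphism theorem, the cokernel of the composite is an extension of the cokernel
-- of `g` by that of `f`.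
omit [F.Faithful] in
lemma admMono_comp_induced {X Y Z : B} (f : X ⟶ Y) (g : Y ⟶ Z) (hf : IsAdmMono (E.induced F) f)
    (hg : IsAdmMono (E.induced F) g) : IsAdmMono (E.induced F) (f ≫ g) := by
  obtain ⟨P, p, hp⟩ := hf
  obtain ⟨R, r, hr⟩ := hg
  obtain ⟨Q, c, hc⟩ := hE.admMono_comp _ _ ⟨_, _, hp⟩ ⟨_, _, hr⟩
  have h₀ := hE.comp_zero _ _ hc
  rw [Category.assoc] at h₀
  have h₁ := hE.comp_zero _ _ hr
  have hs := hE.noether rfl hp hc hr (hE.fac hp _ h₀)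
    (hE.fac hc (F.map r) (by rw [Category.assoc, h₁, comp_zero]))
  rw [← F.map_comp] at hc
  exact isAdmMono_induced hE hc (hF _ _ hs (F.obj_mem_essImage P) (F.obj_mem_essImage R))

/-- The pushout formed in `L` is an extension of the cokernel of `f` by `W`, so it lies in the
essential image. -/
lemma pushout_induced {X Y W : B} (f : X ⟶ Y) (h : X ⟶ W) (hf : IsAdmMono (E.induced F) f) :
    ∃ (P : B) (h' : Y ⟶ P) (f' : W ⟶ P), IsPushout f h h' f' ∧ IsAdmMono (E.induced F) f' := by
  obtain ⟨Z, g, hg⟩ := hf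
  obtain ⟨P, h', f', sq, -⟩ := hE.pushout (F.map f) (F.map h) ⟨_, _, hg⟩
  obtain ⟨k, -, -, hk⟩ := hE.isQuillenExact.pushout_seq hg sq
  obtain ⟨P', ⟨e⟩⟩ := hF _ _ hk (F.obj_mem_essImage W) (F.obj_mem_essImage Z)
  have sq' : IsPushout (F.map f) (F.map h) (F.map (F.preimage (h' ≫ e.inv)))
      (F.map (F.preimage (f' ≫ e.inv))) :=
    sq.of_iso (Iso.refl _) (Iso.refl _) (Iso.refl _) e.symm (by simp) (by simp) (by simp) (by simp)
  refine ⟨P', F.preimage (h' ≫ e.inv), F.preimage (f' ≫ e.inv),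
    IsPushout.of_map F (F.map_injective (by simpa using sq'.w)) sq', ?_⟩
  refine isAdmMono_induced hE (c := e.hom ≫ k) ?_ (F.obj_mem_essImage Z)
  exact hE.isQuillenExact.of_iso_mid e.symm (by simp) (by simp) hk

/-- The axioms for admissible epimorphisms are those for monomorphisms applied to `F.op`, whose
essential image is again closed under extensions. -/
lemma isQuillenExact_induced [Preadditive B] [F.Additive] : IsQuillenExact (E.induced F) where
  comp_zero X Y Z f g h := F.map_injective (by simpa using hE.comp_zero _ _ h)
  isKernel X Y Z f g h w := by
    have := hE.isQuillenExact.mono h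
    have : Mono f := F.mono_of_mono_map this
    refine ⟨KernelFork.IsLimit.ofι' f w fun {W} k hk => ?_⟩
    have hl := hE.isQuillenExact.exists_lift h (F.map k) (by rw [← F.map_comp, hk, F.map_zero])
    exact ⟨F.preimage hl.choose, F.map_injective (by simpa using hl.choose_spec)⟩
  isCokernel X Y Z f g h w := by
    have := hE.epi h
    have : Epi g := F.epi_of_epi_map this
    refine ⟨CokernelCofork.IsColimit.ofπ' g w fun {W} k hk => ?_⟩
    have hl := hE.isQuillenExact.exists_desc h (F.map k) (by rw [← F.map_comp, hk, F.map_zero])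
    exact ⟨F.preimage hl.choose, F.map_injective (by simpa using hl.choose_spec)⟩
  of_iso X Y Z X' Y' Z' f g f' g' a b c h₁ h₂ h :=
    hE.of_iso _ _ _ _ (F.mapIso a) (F.mapIso b) (F.mapIso c)
      ((F.map_comp _ _).symm.trans ((congrArg F.map h₁).trans (F.map_comp _ _)))
      ((F.map_comp _ _).symm.trans ((congrArg F.map h₂).trans (F.map_comp _ _))) h
  split X Z b hb := hE.split (F.mapBinaryBicone b) (isBinaryBilimitOfTotal _ (by
    have := congrArg F.map (IsBilimit.binary_total hb)
    rw [Functor.map_add, Functor.map_comp, Functor.map_comp, F.map_id] at this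
    exact this))
  admMono_comp _ _ _ f g := admMono_comp_induced hE hF f g
  admEpi_comp _ _ _ f g hf hg :=
    IsAdmMono.unop (E := E.induced F) (admMono_comp_induced hE.op hF.op g.op f.op hg.op hf.op)
  pullback Y Z W g h hg := by
    obtain ⟨P, h', g', sq, hg'⟩ := pushout_induced hE.op hF.op g.op h.op hg.op
    exact ⟨P.unop, h'.unop, g'.unop, sq.unop.flip, IsAdmMono.unop (E := E.induced F) hg'⟩
  pushout _ _ _ f h := pushout_induced hE hF f h

/-- A full subcategory of an exact category which is closed under extensions and contains a zero
object is exact. -/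
theorem isExactCategory_induced [HasFiniteBiproducts L] {O : B} (hO : IsZero (F.obj O)) :
    IsExactCategory (E.induced F) := by
  -- `IsExactCategory` leaves the preadditive structure to be chosen; the one pulled back along `F`
  -- makes `F` additive.
  let : Preadditive B := Preadditive.ofFullyFaithful (Functor.FullyFaithful.ofFullyFaithful F)
  have : F.Additive :=
    (Functor.FullyFaithful.ofFullyFaithful F).additive_ofFullyFaithful
  have : HasZeroObject B := ⟨O, IsZero.of_full_of_faithful_of_isZero F O hO⟩
  have := hasBinaryBiproducts_of_finite_biproducts L
  have : HasBinaryBiproducts B := ⟨fun X Z => by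
    obtain ⟨Y, ⟨e⟩⟩ := hF _ _ (hE.split (BinaryBiproduct.bicone (F.obj X) (F.obj Z))
      (BinaryBiproduct.isBilimit _ _)) (F.obj_mem_essImage X) (F.obj_mem_essImage Z)
    let b : BinaryBicone X Z :=
      { pt := Y
        fst := F.preimage (e.hom ≫ biprod.fst)
        snd := F.preimage (e.hom ≫ biprod.snd)
        inl := F.preimage (biprod.inl ≫ e.inv)
        inr := F.preimage (biprod.inr ≫ e.inv)
        inl_fst := F.map_injective (by simp)
        inl_snd := F.map_injective (by simp)
        inr_fst := F.map_injective (by simp)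
        inr_snd := F.map_injective (by simp) }
    refine HasBinaryBiproduct.mk ⟨b, isBinaryBilimitOfTotal b (F.map_injective ?_)⟩
    rw [← cancel_epi e.inv, ← cancel_mono e.hom]
    simp [b]⟩
  have : HasFiniteProducts B := hasFiniteProducts_of_has_binary_and_terminal
  exact ⟨inferInstance, HasFiniteBiproducts.of_hasFiniteProducts,
    (isQuillenExact_induced hE hF).isExactStructure⟩

end Induced

/-! ### The embeddings of ind-objects and pro-objects. -/

section Main

variable {A : Type u} [Category.{v} A] [Preadditive A] [HasFiniteBiproducts A] {E : SeqClass A}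
  (hE : IsExactStructure E)

/-- `indLim` is a localization whose class is inverted by the functor on systems, so that functor
descends, and fullness and faithfulness can be tested on systems. The zero object is recorded for
`isExactCategory_induced`. -/
theorem indAdm_embedding (q : ∀ S : IndSys E, Quotients E S.obj) :
    (∃ F : IndAdm E ⥤ Beilinson E, Nonempty (indLim E ⋙ F ≅ indSysToBeilinson hE q)) ∧
    ∀ F : IndAdm E ⥤ Beilinson E, Nonempty (indLim E ⋙ F ≅ indSysToBeilinson hE q) →
      F.Full ∧ F.Faithful ∧ ClosedUnderExtensions (beilinsonSeq E) F ∧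
        ∃ X, F.essImage X ∧ IsZero X := by
  have := isLocalization_indLim (E := E) fun X Y f ⟨Z, g, h⟩ => hE.isQuillenExact.mono h
  have hinv : (indReindexing E).W.IsInvertedBy (indSysToBeilinson hE q) :=
    (indReindexing E).isInvertedBy _ fun φ S => isIso_indSysToBeilinson_toReindex hE q S φ.1 φ.2
  refine ⟨⟨Localization.lift _ hinv (indLim E), ⟨Localization.fac _ hinv (indLim E)⟩⟩, ?_⟩
  rintro F ⟨e⟩
  have ess {X : Beilinson E} : F.essImage X ↔ (indSysToBeilinson hE q).essImage X := by
    constructor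
    · rintro ⟨Y, ⟨i⟩⟩
      exact ⟨(indLim E).objPreimage Y, ⟨e.symm.app _ ≪≫
        F.mapIso ((indLim E).objObjPreimageIso Y) ≪≫ i⟩⟩
    · rintro ⟨S, ⟨i⟩⟩
      exact ⟨(indLim E).obj S, ⟨e.app S ≪≫ i⟩⟩
  refine ⟨?_, ?_, ?_, ?_⟩
  · refine (indReindexing E).full_of_iso (indLim E) e fun S S' f => ?_
    obtain ⟨φ, h, a, ha⟩ := exists_map_indSysToBeilinson hE q f
    exact ⟨⟨φ, h⟩, a, ha⟩
  · refine (indReindexing E).faithful_of_iso (indLim E) e fun S S' a b h => ?_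
    obtain ⟨φ⟩ := (indReindexing E).nonempty
    exact ⟨φ, by rw [map_injective_indSysToBeilinson hE q h]⟩
  · intro X Y Z f g h hX hZ
    exact ess.2 (closedUnderExtensions_indSysToBeilinson hE q f g h (ess.1 hX) (ess.1 hZ))
  · have := hasZeroObject_admFun hE
    refine ⟨(toBeilinson E).obj 0, ess.2 ((essImage_indSysToBeilinson_iff hE q _).2
      ⟨0, fun p _ => ?_⟩), (toBeilinson E).map_isZero (isZero_zero _)⟩
    exact ((IsAdmissible E).ι ⋙ (evaluation Pairs A).obj p).map_isZero (isZero_zero _)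

/-- Composed with the inverse duality, `F` is the opposite of a functor to which `indAdm_embedding`
for `Aᵒᵖ` applies; all the properties pass through the equivalence. -/
theorem proAdm_embedding (q : ∀ S : IndSys E.op, Quotients E.op S.obj) :
    (∃ F : ProAdm E ⥤ Beilinson E,
      Nonempty ((indLim E.op).op ⋙ F ≅ proSysToBeilinson hE q)) ∧
    ∀ F : ProAdm E ⥤ Beilinson E, Nonempty ((indLim E.op).op ⋙ F ≅ proSysToBeilinson hE q) →
      F.Full ∧ F.Faithful ∧ ClosedUnderExtensions (beilinsonSeq E) F ∧
        ∃ X, F.essImage X ∧ IsZero X := by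
  have : HasFiniteBiproducts Aᵒᵖ := HasFiniteBiproducts.of_hasFiniteProducts
  obtain ⟨⟨G, ⟨e⟩⟩, hG⟩ := indAdm_embedding hE.op q
  let D := beilinsonDuality E
  let i : proSysToBeilinson hE q ≅ (indSysToBeilinson hE.op q).op ⋙ D.functor :=
    Functor.isoWhiskerLeft (indSysToAdmFun hE.op q).op (beilinsonDualityIso E).symm
  refine ⟨⟨G.op ⋙ D.functor, ⟨Functor.isoWhiskerRight (NatIso.op e.symm) D.functor ≪≫ i.symm⟩⟩, ?_⟩
  rintro F ⟨e⟩
  let F' : IndAdm E.op ⥤ Beilinson E.op := (F ⋙ D.inverse).unop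
  let e₁ : (indLim E.op ⋙ F').op ≅ (indSysToBeilinson hE.op q).op :=
    Functor.isoWhiskerRight (e ≪≫ i) D.inverse ≪≫
      Functor.isoWhiskerLeft (indSysToBeilinson hE.op q).op D.unitIso.symm
  let e' : indLim E.op ⋙ F' ≅ indSysToBeilinson hE.op q := (NatIso.removeOp e₁).symm
  obtain ⟨h₁, h₂, h₃, X₀, h₄, h₅⟩ := hG F' ⟨e'⟩
  have ess {X : Beilinson E} : F.essImage X ↔ F'.essImage (D.inverse.obj X).unop := by
    constructor
    · rintro ⟨Y, ⟨j⟩⟩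
      exact ⟨Y.unop, ⟨(D.inverse.mapIso j).unop.symm⟩⟩
    · rintro ⟨S, ⟨j⟩⟩
      exact ⟨op S, ⟨(D.inverse.preimageIso j.op).symm⟩⟩
  have h₁' : (F ⋙ D.inverse).Full := inferInstanceAs F'.op.Full
  have h₂' : (F ⋙ D.inverse).Faithful := inferInstanceAs F'.op.Faithful
  refine ⟨Functor.Full.of_comp_faithful F D.inverse, Functor.Faithful.of_comp F D.inverse,
    fun X Y Z f g h hX hZ => ?_, D.functor.obj (op X₀), ?_, ?_⟩
  · exact ess.2 (h₃ _ _ (h.dual_inverse hE) (ess.1 hZ) (ess.1 hX))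
  · exact ess.2 (Functor.essImage.ofIso (D.unitIso.app (op X₀)).symm.unop h₄)
  · exact IsZero.of_iso (D.functor.map_isZero h₅.op) (Iso.refl _)

end Main

end TateExact

end

theorem mainTheorem10 {A : Type u} [Category.{v} A] [Preadditive A] [HasFiniteBiproducts A]
    (E : TateExact.SeqClass A) (hE : TateExact.IsExactStructure E) :
    TateExact.IsExactCategory (TateExact.beilinsonSeq E) ∧
    (∀ q : ∀ S : TateExact.IndSys E, TateExact.Quotients E S.obj,
      (∃ F : TateExact.IndAdm E ⥤ TateExact.Beilinson E,
        Nonempty (TateExact.indLim E ⋙ F ≅ TateExact.indSysToBeilinson hE q)) ∧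
      ∀ F : TateExact.IndAdm E ⥤ TateExact.Beilinson E,
        Nonempty (TateExact.indLim E ⋙ F ≅ TateExact.indSysToBeilinson hE q) →
        F.Full ∧ F.Faithful ∧
        TateExact.ClosedUnderExtensions (TateExact.beilinsonSeq E) F ∧
        TateExact.IsExactCategory ((TateExact.beilinsonSeq E).induced F)) ∧
    (∀ q : ∀ S : TateExact.IndSys E.op, TateExact.Quotients E.op S.obj,
      (∃ F : TateExact.ProAdm E ⥤ TateExact.Beilinson E,
        Nonempty ((TateExact.indLim E.op).op ⋙ F ≅ TateExact.proSysToBeilinson hE q)) ∧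
      ∀ F : TateExact.ProAdm E ⥤ TateExact.Beilinson E,
        Nonempty ((TateExact.indLim E.op).op ⋙ F ≅ TateExact.proSysToBeilinson hE q) →
        F.Full ∧ F.Faithful ∧
        TateExact.ClosedUnderExtensions (TateExact.beilinsonSeq E) F ∧
        TateExact.IsExactCategory ((TateExact.beilinsonSeq E).induced F)) := by
  have exact {B : Type (max u (v + 1))} [Category.{v} B] {F : B ⥤ TateExact.Beilinson E}
      (h : F.Full ∧ F.Faithful ∧ TateExact.ClosedUnderExtensions (TateExact.beilinsonSeq E) F ∧
        ∃ X, F.essImage X ∧ IsZero X) :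
      F.Full ∧ F.Faithful ∧ TateExact.ClosedUnderExtensions (TateExact.beilinsonSeq E) F ∧
        TateExact.IsExactCategory ((TateExact.beilinsonSeq E).induced F) := by
    obtain ⟨h₁, h₂, h₃, X, ⟨O, ⟨i⟩⟩, hX⟩ := h
    have := TateExact.hasFiniteBiproducts_beilinson hE
    exact ⟨h₁, h₂, h₃, TateExact.isExactCategory_induced
      (TateExact.isExactStructure_beilinsonSeq hE) h₃ (hX.of_iso i)⟩
  refine ⟨TateExact.isExactCategory_beilinsonSeq hE, fun q => ?_, fun q => ?_⟩
  · obtain ⟨h₁, h₂⟩ := TateExact.indAdm_embedding hE q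
    exact ⟨h₁, fun F hF => exact (h₂ F hF)⟩
  · obtain ⟨h₁, h₂⟩ := TateExact.proAdm_embedding hE q
    exact ⟨h₁, fun F hF => exact (h₂ F hF)⟩
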